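/- Work over $\mathbb{Q}$. For a commutative cochain algebra (cdga) $(A,d)$, graded over $\mathbb{N}$, let $\mu\colon A\otimes A\to A$ be the multiplication, and let $\mathrm{TC}(A)$ be the least integer $m\ge 0$ such that the projection $$\rho_m\colon A\otimes A\to \frac{A\otimes A}{(\ker\mu)^{m+1}}$$ admits a homotopy retraction: there are a relative Sullivan model $A\otimes A\xrightarrow{\ i\ } A\otimes A\otimes\Lambda Z\xrightarrow{\ \xi\ }\frac{A\otimes A}{(\ker\mu)^{m+1}}$ of $\rho_m$ (so $\xi$ is a quasi-isomorphism and $\xi i=\rho_m$) and a cdga morphism $r\colon A\otimes A\otimes \Lambda Z\to A\otimes A$ with $r\circ i=\mathrm{id}$. **Theorem 5.3.** Let $n\ge 0$ and let $(\Lambda W,d)$ be a cdga whose underlying graded algebra is the free graded commutative algebra $\Lambda(x_1,\dots,x_n,u_1,\dots,u_n,y)$ on a graded vector space $W$ with basis $x_1,\dots,x_n,u_1,\dots,u_n,y$, all of degree at least $2$, with the $x_i$ of even degree and the $u_i$ and $y$ of odd degree, and with $dx_i=0$, $du_i=x_i^2$ and $dy\in\operatorname{span}_{\mathbb{Q}}\{x_ix_j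 : 1\le i,j\le n\}$. Then $$\mathrm{TC}(\Lambda W)=\dim W=2n+1 .$$ Moreover, there are cocycles $\Omega\in(\ker\mu)^{n+1}$ and $\beta\in(\ker\mu)^{n}$ such that the cocycle $\Omega\cdot\beta\in(\ker\mu)^{2n+1}$ represents a non-zero class in $H^*(\Lambda W\otimes\Lambda W)$. -/

import Mathlib

open scoped TensorProduct DirectSum

universe u

/-- A commutative cochain algebra over `ℚ` (cdga): an `ℕ`-graded `ℚ`-algebra `⨁ n, gr n` which is
commutative in the graded sense, with a differential `d` of degree `+1` satisfying the graded
Leibniz rule. -/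
structure CDGA where
  carrier : Type u
  [ring : Ring carrier]
  [algebra : Algebra ℚ carrier]
  gr : ℕ → Submodule ℚ carrier
  [graded : GradedAlgebra gr]
  mul_comm' : ∀ {i j : ℕ} {a b : carrier}, a ∈ gr i → b ∈ gr j →
    a * b = (-1 : ℚ) ^ (i * j) • (b * a)
  d : carrier →ₗ[ℚ] carrier
  d_mem : ∀ {i : ℕ} {a : carrier}, a ∈ gr i → d a ∈ gr (i + 1)
  d_d : ∀ a : carrier, d (d a) = 0
  leibniz : ∀ {i : ℕ} {a : carrier}, a ∈ gr i → ∀ b : carrier,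
    d (a * b) = d a * b + (-1 : ℚ) ^ i • (a * d b)

namespace CDGA

instance : CoeSort CDGA.{u} (Type u) := ⟨CDGA.carrier⟩

attribute [instance] CDGA.ring CDGA.algebra CDGA.graded

/-- Induction on sums of homogeneous elements. -/
theorem hom_induction (A : CDGA.{u}) {P : A → Prop} (h0 : P 0)
    (hh : ∀ i, ∀ a ∈ A.gr i, P a) (hadd : ∀ a b, P a → P b → P (a + b)) (a : A) : P a :=
  DirectSum.Decomposition.inductionOn A.gr h0 (fun {i} m => hh i m m.2) hadd a

/-- A cdga morphism: a unital algebra morphism preserving degrees and commuting with `d`. -/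
structure Hom (A B : CDGA.{u}) where
  toAlgHom : A →ₐ[ℚ] B
  map_gr : ∀ {i : ℕ} {a : A}, a ∈ A.gr i → toAlgHom a ∈ B.gr i
  map_d : ∀ a : A, toAlgHom (A.d a) = B.d (toAlgHom a)

instance (A B : CDGA.{u}) : CoeFun (Hom A B) (fun _ => A → B) := ⟨fun f => f.toAlgHom⟩

/-- The degree involution, `a ↦ (-1) ^ i • a` on elements of degree `i`. -/
noncomputable def sgn (A : CDGA.{u}) : A →ₗ[ℚ] A :=
  DirectSum.toModule ℚ ℕ A (fun i => (-1 : ℚ) ^ i • (A.gr i).subtype) ∘ₗ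
    (DirectSum.decomposeLinearEquiv A.gr).toLinearMap

theorem sgn_of_mem (A : CDGA.{u}) {i : ℕ} {a : A} (ha : a ∈ A.gr i) :
    A.sgn a = (-1 : ℚ) ^ i • a := by
  simp only [sgn, LinearMap.comp_apply, LinearEquiv.coe_coe, DirectSum.decomposeLinearEquiv_apply]
  rw [DirectSum.decompose_of_mem _ ha, ← DirectSum.lof_eq_of ℚ, DirectSum.toModule_lof]
  rfl

theorem sgn_d (A : CDGA.{u}) (a : A) : A.sgn (A.d a) = - A.d (A.sgn a) := by
  induction a using A.hom_induction with
  | h0 => simp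
  | hh i a ha => rw [A.sgn_of_mem ha, A.sgn_of_mem (A.d_mem ha), map_smul, pow_succ]; simp
  | hadd a b ha hb => simp only [map_add, ha, hb, neg_add]

section Tensor
variable (A B : CDGA.{u})

/-- The underlying algebra of `A ⊗ B`, with the product
`(a ⊗ b) (a' ⊗ b') = (-1) ^ (deg b * deg a') • (a a' ⊗ b b')`. -/
abbrev TCarrier : Type u := GradedTensorProduct ℚ A.gr B.gr

variable {A B} in
/-- The element `a ⊗ b`. -/
noncomputable def tm (a : A) (b : B) : TCarrier A B := GradedTensorProduct.tmul ℚ a b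

theorem smul_tm (c : ℚ) (a : A) (b : B) : tm (c • a) b = c • tm a b :=
  congrArg (GradedTensorProduct.of ℚ A.gr B.gr) (TensorProduct.smul_tmul' c a b).symm

theorem tm_smul (c : ℚ) (a : A) (b : B) : tm a (c • b) = c • tm a b :=
  congrArg (GradedTensorProduct.of ℚ A.gr B.gr) (TensorProduct.tmul_smul c a b)

theorem add_tm (a a' : A) (b : B) : tm (a + a') b = tm a b + tm a' b :=
  congrArg (GradedTensorProduct.of ℚ A.gr B.gr) (TensorProduct.add_tmul a a' b)

theorem tm_add (a : A) (b b' : B) : tm a (b + b') = tm a b + tm a b' :=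
  congrArg (GradedTensorProduct.of ℚ A.gr B.gr) (TensorProduct.tmul_add a b b')

theorem zero_tm (b : B) : tm (0 : A) b = 0 :=
  congrArg (GradedTensorProduct.of ℚ A.gr B.gr) (TensorProduct.zero_tmul A b)

theorem tm_zero (a : A) : tm a (0 : B) = 0 :=
  congrArg (GradedTensorProduct.of ℚ A.gr B.gr) (TensorProduct.tmul_zero B a)

theorem tm_mul_tm {j i : ℕ} (a : A) {b : B} (hb : b ∈ B.gr j) {a' : A} (ha' : a' ∈ A.gr i)
    (b' : B) : (tm a b * tm a' b' : TCarrier A B) = (-1 : ℚ) ^ (j * i) • tm (a * a') (b * b') := by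
  have h := GradedTensorProduct.tmul_coe_mul_coe_tmul A.gr B.gr (R := ℚ) a ⟨b, hb⟩ ⟨a', ha'⟩ b'
  refine h.trans ?_
  rcases Nat.even_or_odd (j * i) with he | he
  · simp [he.neg_one_pow, tm]
  · simp [he.neg_one_pow, tm, Units.smul_def]

/-- The degree `n` part of `A ⊗ B`. -/
noncomputable def tGr (n : ℕ) : Submodule ℚ (TCarrier A B) :=
  Submodule.span ℚ {t | ∃ i j : ℕ, i + j = n ∧ ∃ a ∈ A.gr i, ∃ b ∈ B.gr j, t = tm a b}

variable {A B} in
theorem tm_mem {i j : ℕ} {a : A} {b : B} (ha : a ∈ A.gr i) (hb : b ∈ B.gr j) :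
    tm a b ∈ tGr A B (i + j) := Submodule.subset_span ⟨i, j, rfl, a, ha, b, hb, rfl⟩

variable {A B} in
theorem tensor_induction {P : TCarrier A B → Prop} (h0 : P 0)
    (hh : ∀ i j, ∀ a ∈ A.gr i, ∀ b ∈ B.gr j, P (tm a b))
    (hadd : ∀ s t, P s → P t → P (s + t)) (t : TCarrier A B) : P t := by
  refine TensorProduct.induction_on (motive := fun t => P t) t h0 (fun a b => ?_) hadd
  change P (tm a b)
  induction a using A.hom_induction with
  | h0 => rw [zero_tm]; exact h0
  | hadd a a' ha ha' => rw [add_tm]; exact hadd _ _ ha ha'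
  | hh i a ha =>
    induction b using B.hom_induction with
    | h0 => rw [tm_zero]; exact h0
    | hadd b b' hb hb' => rw [tm_add]; exact hadd _ _ hb hb'
    | hh j b hb => exact hh i j a ha b hb

variable {A B} in
theorem tGr_induction {n : ℕ} {P : TCarrier A B → Prop} (h0 : P 0)
    (hh : ∀ i j, i + j = n → ∀ a ∈ A.gr i, ∀ b ∈ B.gr j, P (tm a b))
    (hadd : ∀ s t, P s → P t → P (s + t)) {t : TCarrier A B} (ht : t ∈ tGr A B n) : P t := by
  induction ht using Submodule.span_induction with
  | mem t h => obtain ⟨i, j, hij, a, ha, b, hb, rfl⟩ := h; exact hh i j hij a ha b hb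
  | zero => exact h0
  | add s t _ _ hs ht => exact hadd s t hs ht
  | smul c t ht' hPt =>
    clear hPt
    induction ht' using Submodule.span_induction generalizing c with
    | mem t h =>
      obtain ⟨i, j, hij, a, ha, b, hb, rfl⟩ := h
      rw [← smul_tm]; exact hh i j hij _ (Submodule.smul_mem _ c ha) b hb
    | zero => simpa using h0
    | add s t _ _ hs ht => rw [smul_add]; exact hadd _ _ (hs c) (ht c)
    | smul c' t _ h => rw [smul_smul]; exact h _

theorem one_mem_tGr : (1 : TCarrier A B) ∈ tGr A B 0 := by
  have h := tm_mem (i := 0) (j := 0) (SetLike.GradedOne.one_mem (A := A.gr))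
    (SetLike.GradedOne.one_mem (A := B.gr))
  rw [add_zero] at h
  exact h

theorem mul_mem_tGr {m n : ℕ} {s t : TCarrier A B} (hs : s ∈ tGr A B m) (ht : t ∈ tGr A B n) :
    s * t ∈ tGr A B (m + n) := by
  refine tGr_induction (P := fun s => s * t ∈ tGr A B (m + n)) ?_ ?_ ?_ hs
  · rw [zero_mul]; exact Submodule.zero_mem _
  · intro i j hij a ha b hb
    refine tGr_induction (P := fun t => tm a b * t ∈ tGr A B (m + n)) ?_ ?_ ?_ ht
    · rw [mul_zero]; exact Submodule.zero_mem _
    · intro i' j' hij' a' ha' b' hb'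
      rw [tm_mul_tm A B a hb ha' b']
      refine Submodule.smul_mem _ _ ?_
      have := tm_mem (SetLike.GradedMul.mul_mem ha ha') (SetLike.GradedMul.mul_mem hb hb')
      have e : i + i' + (j + j') = m + n := by omega
      rwa [e] at this
    · intro s t hs ht; rw [mul_add]; exact Submodule.add_mem _ hs ht
  · intro s t hs ht; rw [add_mul]; exact Submodule.add_mem _ hs ht

instance : SetLike.GradedMonoid (tGr A B) where
  one_mem := one_mem_tGr A B
  mul_mem _ _ _ _ hs ht := mul_mem_tGr A B hs ht

/-- Auxiliary map for the decomposition of `A ⊗ B` into its graded parts. -/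
noncomputable def tDecAux (i j : ℕ) : A.gr i →ₗ[ℚ] B.gr j →ₗ[ℚ] ⨁ n, tGr A B n :=
  LinearMap.mk₂ ℚ
    (fun a b => DirectSum.lof ℚ ℕ (fun n => tGr A B n) (i + j) ⟨tm (a : A) (b : B), tm_mem a.2 b.2⟩)
    (fun a a' b => by
      rw [← map_add]; congr 1; ext; exact add_tm A B _ _ _)
    (fun c a b => by
      rw [← map_smul]; congr 1)
    (fun a b b' => by
      rw [← map_add]; congr 1; ext; exact tm_add A B _ _ _)
    (fun c a b => by
      rw [← map_smul]; congr 1; ext; exact tm_smul A B _ _ _)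

/-- The decomposition of `A ⊗ B` into its graded parts. -/
noncomputable def tDec : TCarrier A B →ₗ[ℚ] ⨁ n, tGr A B n :=
  TensorProduct.lift (DirectSum.toModule ℚ ℕ _ fun i =>
      (DirectSum.toModule ℚ ℕ _ fun j => (tDecAux A B i j).flip).flip) ∘ₗ
    (GradedTensorProduct.auxEquiv ℚ A.gr B.gr).toLinearMap

theorem tDec_tm {i j : ℕ} {a : A} {b : B} (ha : a ∈ A.gr i) (hb : b ∈ B.gr j) :
    tDec A B (tm a b) = DirectSum.lof ℚ ℕ (fun n => tGr A B n) (i + j) ⟨tm a b, tm_mem ha hb⟩ := by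
  simp only [tDec, LinearMap.comp_apply, LinearEquiv.coe_coe, tm, GradedTensorProduct.auxEquiv_tmul]
  rw [DirectSum.decompose_of_mem _ ha, DirectSum.decompose_of_mem _ hb, TensorProduct.lift.tmul,
    ← DirectSum.lof_eq_of ℚ, ← DirectSum.lof_eq_of ℚ, DirectSum.toModule_lof,
    LinearMap.flip_apply, DirectSum.toModule_lof]
  rfl

theorem tDec_of_mem {n : ℕ} {t : TCarrier A B} (ht : t ∈ tGr A B n) :
    tDec A B t = DirectSum.lof ℚ ℕ (fun n => tGr A B n) n ⟨t, ht⟩ := by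
  have key : ∃ h : t ∈ tGr A B n,
      tDec A B t = DirectSum.lof ℚ ℕ (fun n => tGr A B n) n ⟨t, h⟩ := by
    refine tGr_induction (P := fun t => ∃ h : t ∈ tGr A B n,
      tDec A B t = DirectSum.lof ℚ ℕ (fun n => tGr A B n) n ⟨t, h⟩) ?_ ?_ ?_ ht
    · exact ⟨Submodule.zero_mem _, by
        rw [map_zero]; exact (map_zero (DirectSum.lof ℚ ℕ (fun n => tGr A B n) n)).symm⟩
    · rintro i j rfl a ha b hb
      exact ⟨tm_mem ha hb, tDec_tm A B ha hb⟩
    · rintro s t ⟨hs, hs'⟩ ⟨ht, ht'⟩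
      exact ⟨Submodule.add_mem _ hs ht, by rw [map_add, hs', ht', ← map_add]; rfl⟩
  exact key.2

noncomputable instance : DirectSum.Decomposition (tGr A B) where
  decompose' := tDec A B
  left_inv := by
    intro t
    refine tensor_induction
      (P := fun t => DirectSum.coeAddMonoidHom (tGr A B) (tDec A B t) = t) ?_ ?_ ?_ t
    · simp
    · intro i j a ha b hb
      rw [tDec_tm A B ha hb, DirectSum.lof_eq_of, DirectSum.coeAddMonoidHom_of]
    · intro s t hs ht; rw [map_add, map_add, hs, ht]
  right_inv := by
    intro x
    induction x using DirectSum.induction_on with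
    | zero => simp
    | of i x =>
      rw [DirectSum.coeAddMonoidHom_of, tDec_of_mem A B x.2, DirectSum.lof_eq_of]
    | add x y hx hy => rw [map_add, map_add, hx, hy]

noncomputable instance : GradedAlgebra (tGr A B) :=
  { (inferInstance : SetLike.GradedMonoid (tGr A B)),
    (inferInstance : DirectSum.Decomposition (tGr A B)) with }

/-- The differential `a ⊗ b ↦ d a ⊗ b + (-1) ^ (deg a) • (a ⊗ d b)` of `A ⊗ B`. -/
noncomputable def tD : TCarrier A B →ₗ[ℚ] TCarrier A B :=
  (GradedTensorProduct.of ℚ A.gr B.gr).toLinearMap ∘ₗ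
    (TensorProduct.map A.d LinearMap.id + TensorProduct.map A.sgn B.d) ∘ₗ
      (GradedTensorProduct.of ℚ A.gr B.gr).symm.toLinearMap

theorem tD_tm' (a : A) (b : B) : tD A B (tm a b) = tm (A.d a) b + tm (A.sgn a) (B.d b) := by
  simp [tD, tm]

theorem tD_tm {i : ℕ} {a : A} (ha : a ∈ A.gr i) (b : B) :
    tD A B (tm a b) = tm (A.d a) b + (-1 : ℚ) ^ i • tm a (B.d b) := by
  rw [tD_tm', A.sgn_of_mem ha, smul_tm]

/-- The tensor product of two cdgas. -/
noncomputable def tensor : CDGA.{u} where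
  carrier := TCarrier A B
  gr := tGr A B
  d := tD A B
  mul_comm' := by
    intro m n s t hs ht
    refine tGr_induction (P := fun s => s * t = (-1 : ℚ) ^ (m * n) • (t * s)) ?_ ?_ ?_ hs
    · simp
    · rintro i j rfl a ha b hb
      refine tGr_induction
        (P := fun t => tm a b * t = (-1 : ℚ) ^ ((i + j) * n) • (t * tm a b)) ?_ ?_ ?_ ht
      · simp
      · rintro i' j' rfl a' ha' b' hb'
        rw [tm_mul_tm A B a hb ha' b', tm_mul_tm A B a' hb' ha b, A.mul_comm' ha ha',
          B.mul_comm' hb hb', smul_tm, tm_smul, smul_smul, smul_smul, smul_smul]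
        congr 1
        rw [← pow_add, ← pow_add, ← pow_add]
        have h2 : (-1 : ℚ) ^ (2 * (i * j' )) = 1 := by simp [pow_mul]
        have : (i + j) * (i' + j') + j' * i = j * i' + i * i' + j * j' + 2 * (i * j') := by ring
        rw [this, pow_add _ _ (2 * (i * j')), h2, mul_one]
      · intro s t hs ht; rw [mul_add, hs, ht, ← smul_add, ← add_mul]
    · intro s t hs ht; rw [add_mul, hs, ht, ← smul_add, ← mul_add]
  d_mem := by
    intro n t ht
    refine tGr_induction (P := fun t => tD A B t ∈ tGr A B (n + 1)) ?_ ?_ ?_ ht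
    · simp
    · rintro i j rfl a ha b hb
      rw [tD_tm A B ha]
      refine Submodule.add_mem _ ?_ (Submodule.smul_mem _ _ ?_)
      · have := tm_mem (A.d_mem ha) hb
        have e : i + 1 + j = i + j + 1 := by omega
        rwa [e] at this
      · exact tm_mem (i := i) (j := j + 1) ha (B.d_mem hb)
    · intro s t hs ht; rw [map_add]; exact Submodule.add_mem _ hs ht
  d_d := by
    intro t
    refine tensor_induction (P := fun t => tD A B (tD A B t) = 0) ?_ ?_ ?_ t
    · simp
    · intro i j a ha b hb
      rw [tD_tm A B ha, map_add, map_smul, tD_tm A B (A.d_mem ha), tD_tm A B ha, A.d_d, B.d_d]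
      rw [zero_tm, tm_zero, smul_zero, pow_succ]; simp
    · intro s t hs ht; rw [map_add, map_add, hs, ht, add_zero]
  leibniz := by
    intro n s hs t
    refine tGr_induction
      (P := fun s => tD A B (s * t) = tD A B s * t + (-1 : ℚ) ^ n • (s * tD A B t)) ?_ ?_ ?_ hs
    · simp
    · rintro i j rfl a ha b hb
      refine tensor_induction (P := fun t => tD A B (tm a b * t) =
        tD A B (tm a b) * t + (-1 : ℚ) ^ (i + j) • (tm a b * tD A B t)) ?_ ?_ ?_ t
      · simp
      · intro i' j' a' ha' b' hb'
        rw [tm_mul_tm A B a hb ha' b', map_smul, tD_tm A B (SetLike.mul_mem_graded ha ha'),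
          A.leibniz ha, B.leibniz hb, tD_tm A B ha, tD_tm A B ha', add_mul, mul_add,
          smul_mul_assoc, mul_smul_comm, tm_mul_tm A B _ hb ha', tm_mul_tm A B _ (B.d_mem hb) ha',
          tm_mul_tm A B _ hb (A.d_mem ha'), tm_mul_tm A B _ hb ha', add_tm, tm_add, smul_tm,
          tm_smul]
        have e : ∀ k : ℕ, (-1 : ℚ) ^ k * (-1) ^ k = 1 := fun k => by
          rw [← mul_pow]; simp
        simp only [smul_add, smul_smul, add_mul, mul_add, mul_one, one_mul, pow_add, add_assoc]
        have e1 := e j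
        have : (-1 : ℚ) ^ i * (-1) ^ j * ((-1) ^ (j * i') * (-1) ^ j)
          = (-1) ^ (j * i') * (-1) ^ i := by linear_combination (-1 : ℚ) ^ i * (-1) ^ (j * i') * e1
        rw [this]
        have h2 : (-1 : ℚ) ^ (j * i') * ((-1) ^ i * (-1) ^ i') = 
          (-1) ^ i * ((-1) ^ (j * i') * (-1) ^ i') := by ring
        have h3 : (-1 : ℚ) ^ (j * i') * ((-1) ^ i * ((-1) ^ i' * (-1) ^ j)) = 
          (-1) ^ i * ((-1) ^ j * ((-1) ^ i' * (-1) ^ (j * i')))  := by ring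
        simp only [mul_assoc]
        module
      · intro s t hs ht
        rw [mul_add, map_add, map_add, hs, ht, mul_add, mul_add, smul_add]; abel
    · intro s s' hs ht
      rw [add_mul, map_add, map_add, hs, ht, add_mul, add_mul, smul_add]; abel

end Tensor

/-- The multiplication `a ⊗ b ↦ a * b` as a homomorphism of algebras. -/
noncomputable def muAlg (A : CDGA.{u}) : TCarrier A A →ₐ[ℚ] A :=
  GradedTensorProduct.lift A.gr A.gr (AlgHom.id ℚ A) (AlgHom.id ℚ A) (by
    intro i j a b
    have h := A.mul_comm' a.2 b.2
    refine h.trans ?_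
    rw [mul_comm i j]
    rcases Nat.even_or_odd (j * i) with he | he
    · simp [he.neg_one_pow]
    · simp [he.neg_one_pow, Units.smul_def])

theorem muAlg_tm (A : CDGA.{u}) (a b : A) : muAlg A (tm a b) = a * b := rfl

/-- The multiplication `μ : A ⊗ A → A`, `a ⊗ b ↦ a * b`. -/
noncomputable def mu (A : CDGA.{u}) : Hom (A.tensor A) A where
  toAlgHom := muAlg A
  map_gr := by
    intro n t ht
    refine tGr_induction (A := A) (B := A) (P := fun t => muAlg A t ∈ A.gr n) ?_ ?_ ?_ ht
    · rw [map_zero]; exact Submodule.zero_mem _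
    · rintro i j rfl a ha b hb
      rw [muAlg_tm]
      exact SetLike.GradedMul.mul_mem ha hb
    · intro s t hs ht; rw [map_add]; exact Submodule.add_mem _ hs ht
  map_d := by
    intro t
    refine tensor_induction (A := A) (B := A)
      (P := fun t => muAlg A (tD A A t) = A.d (muAlg A t)) ?_ ?_ ?_ t
    · simp only [map_zero]
    · intro i j a ha b hb
      rw [tD_tm A A ha, map_add, map_smul, muAlg_tm, muAlg_tm, muAlg_tm]
      exact (A.leibniz ha b).symm
    · intro s t hs ht; rw [map_add, map_add, map_add, map_add, hs, ht]

/-- Two-sided homogeneous ideals stable under the differential. -/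
structure IsDGIdeal (A : CDGA.{u}) (I : Ideal A) : Prop where
  twoSided : I.IsTwoSided
  homogeneous : ∀ a ∈ I, ∀ n : ℕ, (DirectSum.decompose A.gr a n : A) ∈ I
  d_mem : ∀ a ∈ I, A.d a ∈ I

theorem IsDGIdeal.mul {A : CDGA.{u}} {I J : Ideal A} (hI : A.IsDGIdeal I) (hJ : A.IsDGIdeal J) :
    A.IsDGIdeal (I * J) := by
  have := hI.twoSided
  have := hJ.twoSided
  have key : ∀ P : A → Prop, P 0 → (∀ a b, P a → P b → P (a + b)) →
      (∀ i, ∀ a ∈ I, a ∈ A.gr i → ∀ b ∈ J, P (a * b)) → ∀ c ∈ I * J, P c := by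
    intro P h0 hadd hm c hc
    refine Submodule.smul_induction_on (p := P) hc (fun a ha b hb => ?_) hadd
    classical
    rw [smul_eq_mul, ← DirectSum.sum_support_decompose A.gr a, Finset.sum_mul]
    refine Finset.sum_induction _ P hadd h0 (fun i _ => ?_)
    exact hm i _ (hI.homogeneous a ha i) (SetLike.coe_mem _) b hb
  refine ⟨inferInstance, fun c hc n => ?_, fun c hc => ?_⟩
  · refine key (fun c => (DirectSum.decompose A.gr c n : A) ∈ I * J) ?_ ?_ ?_ c hc
    · simp
    · intro a b ha hb
      rw [DirectSum.decompose_add, DirectSum.add_apply, Submodule.coe_add]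
      exact Ideal.add_mem _ ha hb
    · intro i a ha hai b hb
      classical
      rw [DirectSum.coe_decompose_mul_of_left_mem A.gr n hai]
      split_ifs
      · exact Ideal.mul_mem_mul ha (hJ.homogeneous b hb _)
      · exact Ideal.zero_mem _
  · refine key (fun c => A.d c ∈ I * J) ?_ ?_ ?_ c hc
    · simp
    · intro a b ha hb; rw [map_add]; exact Ideal.add_mem _ ha hb
    · intro i a ha hai b hb
      rw [A.leibniz hai]
      refine Ideal.add_mem _ (Ideal.mul_mem_mul (hI.d_mem a ha) hb) ?_
      exact Submodule.smul_of_tower_mem _ _ (Ideal.mul_mem_mul ha (hJ.d_mem b hb))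

theorem IsDGIdeal.pow {A : CDGA.{u}} {I : Ideal A} (hI : A.IsDGIdeal I) (m : ℕ) :
    A.IsDGIdeal (I ^ m) := by
  have := hI.twoSided
  induction m with
  | zero =>
    rw [Submodule.pow_zero, Ideal.one_eq_top]
    exact ⟨inferInstance, fun _ _ _ => trivial, fun _ _ => trivial⟩
  | succ m ih =>
    rw [Ideal.IsTwoSided.pow_succ]
    exact hI.mul ih

theorem IsDGIdeal.ker {A B : CDGA.{u}} (f : Hom A B) :
    A.IsDGIdeal (RingHom.ker f.toAlgHom) where
  twoSided := inferInstance
  homogeneous := by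
    intro a ha n
    rw [RingHom.mem_ker] at ha ⊢
    have h : ∀ a : A, f.toAlgHom (DirectSum.decompose A.gr a n : A) =
        (DirectSum.decompose B.gr (f.toAlgHom a) n : B) := by
      intro a
      induction a using A.hom_induction with
      | h0 => simp
      | hh i a ha =>
        by_cases hin : i = n
        · subst hin
          rw [DirectSum.decompose_of_mem_same _ ha, DirectSum.decompose_of_mem_same _ (f.map_gr ha)]
        · rw [DirectSum.decompose_of_mem_ne _ ha hin,
            DirectSum.decompose_of_mem_ne _ (f.map_gr ha) hin, map_zero]
      | hadd a b ha hb =>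
        rw [DirectSum.decompose_add, DirectSum.add_apply, Submodule.coe_add, map_add, ha, hb,
          map_add, DirectSum.decompose_add, DirectSum.add_apply, Submodule.coe_add]
    rw [h, ha]; simp
  d_mem := by
    intro a ha
    rw [RingHom.mem_ker] at ha ⊢
    rw [f.map_d, ha, map_zero]

section Quotient
variable (A : CDGA.{u}) (I : Ideal A) [I.IsTwoSided]

/-- The degree `n` part of `A ⧸ I`. -/
noncomputable def qGr (n : ℕ) : Submodule ℚ (A ⧸ I) :=
  (A.gr n).map (Ideal.Quotient.mkₐ ℚ I).toLinearMap

variable {A I} in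
theorem mk_mem_qGr {n : ℕ} {a : A} (ha : a ∈ A.gr n) : Ideal.Quotient.mkₐ ℚ I a ∈ qGr A I n :=
  Submodule.mem_map_of_mem ha

variable {A I} in
/-- The decomposition of `A ⧸ I` into its graded parts. -/
noncomputable def qDec (h : A.IsDGIdeal I) : (A ⧸ I) →+ ⨁ n, qGr A I n :=
  QuotientAddGroup.lift I.toAddSubgroup
    ((DirectSum.map (fun n => (((Ideal.Quotient.mkₐ ℚ I).toLinearMap.restrict
        (fun _ ha => mk_mem_qGr ha) : A.gr n →ₗ[ℚ] qGr A I n)).toAddMonoidHom)).comp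
      (DirectSum.decomposeAddEquiv A.gr).toAddMonoidHom) (by
    intro a ha
    ext n
    exact Ideal.Quotient.eq_zero_iff_mem.mpr (h.homogeneous a ha n))

variable {A I} in
theorem qDec_mk (h : A.IsDGIdeal I) {n : ℕ} {a : A} (ha : a ∈ A.gr n) :
    qDec h (Ideal.Quotient.mkₐ ℚ I a) =
      DirectSum.of (fun n => qGr A I n) n ⟨Ideal.Quotient.mkₐ ℚ I a, mk_mem_qGr ha⟩ := by
  change (DirectSum.map _) (DirectSum.decompose A.gr a) = _
  rw [DirectSum.decompose_of_mem _ ha, DirectSum.map_of]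
  rfl

/-- The quotient cdga `(A ⧸ I, d)`. -/
noncomputable def quotient (h : A.IsDGIdeal I) : CDGA.{u} where
  carrier := A ⧸ I
  gr := qGr A I
  graded :=
    { one_mem := by
        rw [← map_one (Ideal.Quotient.mkₐ ℚ I)]
        exact mk_mem_qGr SetLike.GradedOne.one_mem
      mul_mem := by
        rintro i j _ _ ⟨a, ha, rfl⟩ ⟨b, hb, rfl⟩
        have := mk_mem_qGr (I := I) (SetLike.GradedMul.mul_mem ha hb)
        rwa [map_mul] at this
      decompose' := qDec h
      left_inv := by
        intro q
        obtain ⟨a, rfl⟩ := Ideal.Quotient.mkₐ_surjective ℚ I q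
        induction a using A.hom_induction with
        | h0 => simp
        | hh i a ha => rw [qDec_mk h ha, DirectSum.coeAddMonoidHom_of]
        | hadd a b ha hb => rw [map_add, map_add, map_add, ha, hb]
      right_inv := by
        intro x
        induction x using DirectSum.induction_on with
        | zero => simp
        | of i x =>
          obtain ⟨_, a, ha, rfl⟩ := x
          rw [DirectSum.coeAddMonoidHom_of]
          exact qDec_mk h ha
        | add x y hx hy => rw [map_add, map_add, hx, hy] }
  mul_comm' := by
    rintro i j _ _ ⟨a, ha, rfl⟩ ⟨b, hb, rfl⟩
    have := congrArg (Ideal.Quotient.mkₐ ℚ I) (A.mul_comm' ha hb)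
    rwa [map_smul, map_mul, map_mul] at this
  d := (I.restrictScalars ℚ).mapQ (I.restrictScalars ℚ) A.d (fun a ha => h.d_mem a ha)
  d_mem := by
    rintro i _ ⟨a, ha, rfl⟩
    exact mk_mem_qGr (A.d_mem ha)
  d_d := by
    intro q
    obtain ⟨a, rfl⟩ := Ideal.Quotient.mkₐ_surjective ℚ I q
    have := congrArg (Ideal.Quotient.mkₐ ℚ I) (A.d_d a)
    rwa [map_zero] at this
  leibniz := by
    rintro i _ ⟨a, ha, rfl⟩ q
    obtain ⟨b, rfl⟩ := Ideal.Quotient.mkₐ_surjective ℚ I q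
    have := congrArg (Ideal.Quotient.mkₐ ℚ I) (A.leibniz ha b)
    rwa [map_add, map_smul, map_mul (Ideal.Quotient.mkₐ ℚ I), map_mul (Ideal.Quotient.mkₐ ℚ I)] at this

/-- The canonical projection `A → A ⧸ I`. -/
noncomputable def toQuotient (h : A.IsDGIdeal I) : Hom A (A.quotient I h) where
  toAlgHom := Ideal.Quotient.mkₐ ℚ I
  map_gr := fun ha => mk_mem_qGr ha
  map_d := fun _ => rfl

end Quotient


/-- The relations `z i * z j = (-1) ^ (deg i * deg j) • (z j * z i)` of graded commutativity.
For `i = j` of odd degree this gives `z i ^ 2 = 0`, since `2` is invertible. -/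
inductive FreeRel {I : Type*} (deg : I → ℕ) : FreeAlgebra ℚ I → FreeAlgebra ℚ I → Prop
  | swap (i j : I) : FreeRel deg (FreeAlgebra.ι ℚ i * FreeAlgebra.ι ℚ j)
      ((-1 : ℚ) ^ (deg i * deg j) • (FreeAlgebra.ι ℚ j * FreeAlgebra.ι ℚ i))

/-- `Λ Z`: the free graded commutative `ℚ`-algebra on generators indexed by `I`, the generator of
index `i` having degree `deg i`. -/
abbrev Free {I : Type*} (deg : I → ℕ) : Type _ := RingQuot (FreeRel deg)

/-- The algebra morphism `Λ Z → A` sending the generator of index `i` to `v i`. -/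
noncomputable def freeLift (A : CDGA.{u}) {I : Type*} (deg : I → ℕ) (v : I → A)
    (hv : ∀ i, v i ∈ A.gr (deg i)) : Free deg →ₐ[ℚ] A :=
  RingQuot.liftAlgHom ℚ ⟨FreeAlgebra.lift ℚ v, by
    rintro _ _ ⟨i, j⟩
    rw [map_smul, map_mul, map_mul, FreeAlgebra.lift_ι_apply, FreeAlgebra.lift_ι_apply]
    exact A.mul_comm' (hv i) (hv j)⟩

/-- The underlying graded algebra of `A` is the free graded commutative algebra on the elements
`v i`, of degrees `deg i`; that is, `A = (Λ V, d)` with `V` spanned by the basis `v`. -/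
structure IsFreeOn (A : CDGA.{u}) {I : Type*} (deg : I → ℕ) (v : I → A) : Prop where
  mem : ∀ i, v i ∈ A.gr (deg i)
  bijective : Function.Bijective (A.freeLift deg v mem)

/-- `i : B → C` is a relative Sullivan algebra (KS-extension): there are homogeneous elements
`z k ∈ C` of positive degrees, spanning a graded space `Z`, such that `b ⊗ w ↦ i b * w` is an
isomorphism `B ⊗ Λ Z → C`, and `Z` is a union of stages `Z(0), Z(1), …` with
`d (Z(l)) ⊆ B ⊗ Λ (Z(0) ⊕ ⋯ ⊕ Z(l - 1))`; here `Z(l)` is spanned by the `z k` with `level k = l`. -/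
def IsRelativeSullivan {B C : CDGA.{u}} (i : Hom B C) : Prop :=
  ∃ (I : Type u) (deg : I → ℕ) (z : I → C) (hz : ∀ k, z k ∈ C.gr (deg k)) (level : I → ℕ),
    (∀ k, 1 ≤ deg k) ∧
    Function.Bijective (TensorProduct.lift
      ((LinearMap.mul ℚ C).compl₁₂ i.toAlgHom.toLinearMap (C.freeLift deg z hz).toLinearMap)) ∧
    ∀ k, C.d (z k) ∈ Algebra.adjoin ℚ (Set.range i ∪ z '' {l | level l < level k})

/-- The cohomology `ker d ⧸ im d`, as the direct sum of its graded parts. -/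
abbrev Cohomology (A : CDGA.{u}) : Type u :=
  LinearMap.ker A.d ⧸ (LinearMap.range A.d).submoduleOf (LinearMap.ker A.d)

/-- The map induced in cohomology by a cdga morphism. -/
noncomputable def Hom.mapCohomology {A B : CDGA.{u}} (f : Hom A B) :
    A.Cohomology →ₗ[ℚ] B.Cohomology :=
  Submodule.mapQ _ _
    (f.toAlgHom.toLinearMap.restrict (p := LinearMap.ker A.d) (q := LinearMap.ker B.d) (by
      intro a ha
      rw [LinearMap.mem_ker] at ha ⊢
      exact (f.map_d a).symm.trans (by rw [ha, map_zero])))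
    (by
      rintro ⟨a, ha⟩ ⟨b, hb⟩
      exact ⟨f b, (f.map_d b).symm.trans (congrArg f hb)⟩)

/-- Quasi-isomorphisms. -/
def Hom.IsQuasiIso {A B : CDGA.{u}} (f : Hom A B) : Prop := Function.Bijective f.mapCohomology

/-- `ρ : B → Q` admits a homotopy retraction: `ρ` has a relative Sullivan model
`B → C ≃ Q` (written `ρ = ξ ∘ i`) together with a cdga morphism `r : C → B` such that
`r ∘ i = id`. -/
def HasHomotopyRetraction {B Q : CDGA.{u}} (ρ : Hom B Q) : Prop :=
  ∃ (C : CDGA.{u}) (i : Hom B C) (ξ : Hom C Q),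
    IsRelativeSullivan i ∧ ξ.IsQuasiIso ∧ (∀ b, ξ (i b) = ρ b) ∧
      ∃ r : Hom C B, ∀ b, r (i b) = b

/-- The kernel of the multiplication `μ : A ⊗ A → A`. -/
noncomputable def kerMu (A : CDGA.{u}) : Ideal (A.tensor A) := RingHom.ker A.mu.toAlgHom

instance (A : CDGA.{u}) : A.kerMu.IsTwoSided := (IsDGIdeal.ker A.mu).twoSided

/-- The projection `A ⊗ A → (A ⊗ A) ⧸ (ker μ) ^ (m + 1)`. -/
noncomputable def rho (A : CDGA.{u}) (m : ℕ) :
    Hom (A.tensor A) ((A.tensor A).quotient (A.kerMu ^ (m + 1)) ((IsDGIdeal.ker A.mu).pow (m + 1))) :=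
  toQuotient _ _ _

/-- The topological complexity of a cdga: the least `m` such that the projection `rho m` admits a
homotopy retraction (`⊤` if there is none). -/
noncomputable def TC (A : CDGA.{u}) : ℕ∞ :=
  sInf {k | ∃ m : ℕ, k = m ∧ HasHomotopyRetraction (A.rho m)}

/-- `A = Λ (x 1, …, x n, u 1, …, u n, y)` with `x i` of even degree `p i`, `u i` of odd degree
`q i`, `y` of odd degree `r`, all degrees at least `2` (simple connectivity), `d (x i) = 0`,
`d (u i) = x i ^ 2`, and `d y` a quadratic form in the `x i`. -/
structure IsEllipticExtension (A : CDGA.{u}) {n : ℕ} (p q : Fin n → ℕ) (r : ℕ)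
    (x u : Fin n → A) (y : A) : Prop where
  free : A.IsFreeOn (Sum.elim p (Sum.elim q fun _ : Unit => r))
    (Sum.elim x (Sum.elim u fun _ : Unit => y))
  even_x : ∀ i, Even (p i)
  odd_u : ∀ i, Odd (q i)
  odd_y : Odd r
  two_le_x : ∀ i, 2 ≤ p i
  two_le_u : ∀ i, 2 ≤ q i
  two_le_y : 2 ≤ r
  d_x : ∀ i, A.d (x i) = 0
  d_u : ∀ i, A.d (u i) = x i ^ 2
  d_y : A.d y ∈ Submodule.span ℚ (Set.range fun ij : Fin n × Fin n => x ij.1 * x ij.2)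

end CDGA

/-!
The multiplication of `A = Λ (x, u, y)` has kernel `K`, generated by the differences
`x i ⊗ 1 - 1 ⊗ x i`, `u i ⊗ 1 - 1 ⊗ u i` and `y ⊗ 1 - 1 ⊗ y`. Both inequalities for `TC A` are
proved by working directly in `T = A ⊗ A`.

*Lower bound.* Put `a i = x i ⊗ 1 - 1 ⊗ x i` and `b i = x i ⊗ 1 + 1 ⊗ x i`, so that `a i * b i` is
the coboundary of `u i ⊗ 1 - 1 ⊗ u i`. Multiplied by `∏ a i`, the differential of `y ⊗ 1 - 1 ⊗ y`
becomes the coboundary of an element of the ideal of the `u i`, and so does that of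
`y ⊗ 1 + 1 ⊗ y`, after addition of a multiple of `y ⊗ 1 - 1 ⊗ y` (`IsDoubled.exists_omega`,
`IsDoubled.exists_eta`). This gives cocycles `Ω ∈ K ^ (n + 1)` and `β ∈ K ^ n`. Their product is
not a coboundary: under the morphism killing the `u i` and all `x i ^ 2`, the differential turns
into a graded commutator with a contraction, so coboundaries have no component along
`(y ⊗ 1) (1 ⊗ y)`, whereas `Ω β` has there a non-zero multiple of the product of all `x i ⊗ 1` and
`1 ⊗ x i` (`IsEllipticExtension.exists_detecting`). A homotopy retraction of `T → T ⧸ K ^ (m + 1)`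
makes every cocycle in `K ^ (m + 1)` a coboundary (`HasHomotopyRetraction.exists_d_eq`), so that
`m ≥ 2 n + 1`.

*Upper bound.* Let `I` be the ideal of `T` generated by the `u i ⊗ 1`, `1 ⊗ u i` and the squares
of the `x i ⊗ 1`, `1 ⊗ x i`. It is acyclic (`IsKillingPairs.acyclic`), because the squares form a
regular sequence, and it contains `K ^ (2 n + 2)`, because modulo `I` the `a i` have cube zero and
`y ⊗ 1 - 1 ⊗ y` has square zero (`IsEllipticExtension.kerMu_pow_le`). Hence the fibre product `P`
of `T` and `T ⧸ K ^ (2 n + 2)` over `T ⧸ I` is quasi-isomorphic to `T ⧸ K ^ (2 n + 2)`, while the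
inclusion `T → P` is split by the first projection. A relative Sullivan model of `T → P` is then a
relative Sullivan model of `T → T ⧸ K ^ (2 n + 2)` with a retraction
(`hasHomotopyRetraction_of_acyclic`).

The existence of relative Sullivan models is proved for injective morphisms `f : B → P` of simply
connected cdgas (`Hom.exists_relativeSullivanModel`), which is the case needed. In place of a
colimit of extensions, one single free extension of `B` is used, having a generator for each
possible value of the differential and each possible image in `P` (`SaturatedExtension`). Inside
it, generators are selected degree by degree, those of degree `k` bijectively representing a basis
of the relative cohomology in that degree (`SaturatedExtension.IsSelection`). Simple connectivity
ensures that later generators do not interfere with what was achieved in lower degrees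
(`SaturatedExtension.exists_linear_part`).
-/

namespace CDGA

/-! ### The degree involution and the Leibniz rule -/

theorem sgn_one (A : CDGA.{u}) : A.sgn 1 = 1 := by
  rw [A.sgn_of_mem SetLike.GradedOne.one_mem, pow_zero, one_smul]

theorem sgn_mul (A : CDGA.{u}) (a b : A) : A.sgn (a * b) = A.sgn a * A.sgn b := by
  induction a using A.hom_induction with
  | h0 => simp
  | hadd a a' ha ha' => simp only [add_mul, map_add, ha, ha']
  | hh i a ha =>
    induction b using A.hom_induction with
    | h0 => simp
    | hadd b b' hb hb' => simp only [mul_add, map_add, hb, hb']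
    | hh j b hb =>
      rw [A.sgn_of_mem ha, A.sgn_of_mem hb, A.sgn_of_mem (SetLike.GradedMul.mul_mem ha hb),
        smul_mul_smul_comm, pow_add]

theorem sgn_sgn (A : CDGA.{u}) (a : A) : A.sgn (A.sgn a) = a := by
  induction a using A.hom_induction with
  | h0 => simp
  | hadd a a' ha ha' => simp only [map_add, ha, ha']
  | hh i a ha =>
    rw [A.sgn_of_mem ha, map_smul, A.sgn_of_mem ha, smul_smul, ← mul_pow]
    simp

/-- The degree involution as a morphism of algebras. -/
noncomputable def sgnHom (A : CDGA.{u}) : A →ₐ[ℚ] A :=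
  AlgHom.ofLinearMap A.sgn A.sgn_one A.sgn_mul

theorem sgnHom_apply (A : CDGA.{u}) (a : A) : A.sgnHom a = A.sgn a := rfl

theorem d_mul (A : CDGA.{u}) (a b : A) : A.d (a * b) = A.d a * b + A.sgn a * A.d b := by
  induction a using A.hom_induction with
  | h0 => simp
  | hadd a a' ha ha' => simp only [add_mul, map_add, ha, ha']; abel
  | hh i a ha => rw [A.leibniz ha, A.sgn_of_mem ha, smul_mul_assoc]

theorem d_one (A : CDGA.{u}) : A.d 1 = 0 := by
  have h := A.d_mul 1 1
  rw [mul_one, mul_one, sgn_one, one_mul] at h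
  simpa using h

theorem Hom.map_sgn {A B : CDGA.{u}} (f : Hom A B) (a : A) :
    f.toAlgHom (A.sgn a) = B.sgn (f.toAlgHom a) := by
  induction a using A.hom_induction with
  | h0 => simp
  | hadd a a' ha ha' => simp only [map_add, ha, ha']
  | hh i a ha => rw [A.sgn_of_mem ha, B.sgn_of_mem (f.map_gr ha), map_smul]

theorem even_comm (A : CDGA.{u}) {i : ℕ} (hi : Even i) {a : A} (ha : a ∈ A.gr i) (b : A) :
    a * b = b * a := by
  induction b using A.hom_induction with
  | h0 => simp
  | hadd b b' hb hb' => simp only [add_mul, mul_add, hb, hb']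
  | hh j b hb => rw [A.mul_comm' ha hb, (hi.mul_right j).neg_one_pow, one_smul]

theorem odd_comm (A : CDGA.{u}) {i : ℕ} (hi : Odd i) {a : A} (ha : a ∈ A.gr i) (b : A) :
    a * b = A.sgn b * a := by
  induction b using A.hom_induction with
  | h0 => simp
  | hadd b b' hb hb' => simp only [add_mul, mul_add, map_add, hb, hb']
  | hh j b hb =>
    rw [A.mul_comm' ha hb, A.sgn_of_mem hb, smul_mul_assoc, pow_mul, hi.neg_one_pow]

theorem odd_sq (A : CDGA.{u}) {i : ℕ} (hi : Odd i) {a : A} (ha : a ∈ A.gr i) : a * a = 0 := by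
  have h := A.mul_comm' ha ha
  rw [(hi.mul hi).neg_one_pow, neg_smul, one_smul] at h
  have h2 : (2 : ℚ) • (a * a) = 0 := by
    rw [two_smul]
    nth_rewrite 2 [h]
    exact add_neg_cancel _
  exact (smul_eq_zero.mp h2).resolve_left two_ne_zero

/-! ### Free graded commutative algebras -/

section Free
variable {I : Type*} {deg : I → ℕ}

/-- The generator of `Λ Z` of index `i`. -/
noncomputable def gen (deg : I → ℕ) (i : I) : Free deg :=
  RingQuot.mkAlgHom ℚ (FreeRel deg) (FreeAlgebra.ι ℚ i)

theorem gen_mul_gen (i j : I) :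
    gen deg i * gen deg j = (-1 : ℚ) ^ (deg i * deg j) • (gen deg j * gen deg i) := by
  have h := RingQuot.mkAlgHom_rel ℚ (FreeRel.swap (deg := deg) i j)
  rwa [map_smul, map_mul, map_mul] at h

/-- The universal property of `Λ Z` with respect to all algebras: a family of elements satisfying
the relations of graded commutativity extends to a morphism. -/
noncomputable def freeLiftAlg {W : Type*} [Semiring W] [Algebra ℚ W] (w : I → W)
    (hw : ∀ i j, w i * w j = (-1 : ℚ) ^ (deg i * deg j) • (w j * w i)) : Free deg →ₐ[ℚ] W :=
  RingQuot.liftAlgHom ℚ ⟨FreeAlgebra.lift ℚ w, by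
    rintro _ _ ⟨i, j⟩
    rw [map_smul, map_mul, map_mul, FreeAlgebra.lift_ι_apply, FreeAlgebra.lift_ι_apply]
    exact hw i j⟩

theorem freeLiftAlg_gen {W : Type*} [Semiring W] [Algebra ℚ W] (w : I → W)
    (hw : ∀ i j, w i * w j = (-1 : ℚ) ^ (deg i * deg j) • (w j * w i)) (i : I) :
    freeLiftAlg w hw (gen deg i) = w i := by
  rw [freeLiftAlg, gen, RingQuot.liftAlgHom_mkAlgHom_apply, FreeAlgebra.lift_ι_apply]

theorem freeLift_gen (A : CDGA.{u}) (v : I → A) (hv : ∀ i, v i ∈ A.gr (deg i)) (i : I) :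
    A.freeLift deg v hv (gen deg i) = v i := by
  rw [freeLift, gen, RingQuot.liftAlgHom_mkAlgHom_apply, FreeAlgebra.lift_ι_apply]

theorem free_hom_ext {W : Type*} [Semiring W] [Algebra ℚ W] {f g : Free deg →ₐ[ℚ] W}
    (h : ∀ i, f (gen deg i) = g (gen deg i)) : f = g := by
  refine RingQuot.ringQuot_ext' ℚ _ _ (FreeAlgebra.hom_ext ?_)
  ext i
  exact h i

theorem free_adjoin : Algebra.adjoin ℚ (Set.range (gen deg)) = ⊤ := by
  rw [eq_top_iff]
  rintro w -
  obtain ⟨w, rfl⟩ := RingQuot.mkAlgHom_surjective ℚ (FreeRel deg) w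
  induction w using FreeAlgebra.induction with
  | grade0 r => rw [AlgHom.commutes]; exact Subalgebra.algebraMap_mem _ _
  | grade1 i => exact Algebra.subset_adjoin ⟨i, rfl⟩
  | mul a b ha hb => rw [map_mul]; exact mul_mem ha hb
  | add a b ha hb => rw [map_add]; exact add_mem ha hb

/-- The degree `n` part of `Λ Z`, spanned by the monomials of degree `n` in the generators. -/
noncomputable def freeGr (deg : I → ℕ) (n : ℕ) : Submodule ℚ (Free deg) :=
  Submodule.span ℚ {w | ∃ l : List I, (l.map deg).sum = n ∧ w = (l.map (gen deg)).prod}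

theorem gen_mem (i : I) : gen deg i ∈ freeGr deg (deg i) :=
  Submodule.subset_span ⟨[i], by simp, by simp⟩

instance : SetLike.GradedMonoid (freeGr deg) where
  one_mem := Submodule.subset_span ⟨[], by simp, by simp⟩
  mul_mem := by
    intro m n s t hs ht
    have h : freeGr deg m * freeGr deg n ≤ freeGr deg (m + n) := by
      rw [freeGr, freeGr, Submodule.span_mul_span, Submodule.span_le]
      rintro _ ⟨_, ⟨l, rfl, rfl⟩, _, ⟨l', rfl, rfl⟩, rfl⟩
      exact Submodule.subset_span ⟨l ++ l', by simp, by simp⟩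
    exact h (Submodule.mul_mem_mul hs ht)

theorem of_freeGr_congr {m n : ℕ} (h : m = n) {s t : Free deg} (hs : s ∈ freeGr deg m)
    (ht : t ∈ freeGr deg n) (hst : s = t) :
    DirectSum.of (fun n => freeGr deg n) m ⟨s, hs⟩ =
      DirectSum.of (fun n => freeGr deg n) n ⟨t, ht⟩ := by
  subst h; subst hst; rfl

/-- The decomposition of `Λ Z` into its graded parts, as a morphism of algebras. -/
noncomputable def freeDec (deg : I → ℕ) : Free deg →ₐ[ℚ] ⨁ n, freeGr deg n :=
  freeLiftAlg (fun i => DirectSum.of (fun n => freeGr deg n) (deg i) ⟨gen deg i, gen_mem i⟩) (by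
    intro i j
    rw [DirectSum.of_mul_of, DirectSum.of_mul_of, ← DirectSum.lof_eq_of ℚ, ← DirectSum.lof_eq_of ℚ,
      ← map_smul, DirectSum.lof_eq_of, DirectSum.lof_eq_of]
    exact of_freeGr_congr (add_comm _ _) _ _ (gen_mul_gen i j))

theorem freeDec_prod (l : List I) {n : ℕ} (h : (l.map deg).sum = n)
    (hl : (l.map (gen deg)).prod ∈ freeGr deg n) :
    freeDec deg (l.map (gen deg)).prod = DirectSum.of (fun n => freeGr deg n) n ⟨_, hl⟩ := by
  induction l generalizing n with
  | nil =>
    simp only [List.map_nil, List.sum_nil] at h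
    subst h
    simp only [List.map_nil, List.prod_nil, map_one]
    rfl
  | cons i l ih =>
    simp only [List.map_cons, List.sum_cons] at h
    have hl' : (l.map (gen deg)).prod ∈ freeGr deg (l.map deg).sum :=
      Submodule.subset_span ⟨l, rfl, rfl⟩
    simp only [List.map_cons, List.prod_cons, map_mul]
    rw [ih rfl hl', freeDec, freeLiftAlg_gen, DirectSum.of_mul_of]
    exact of_freeGr_congr h _ _ rfl

noncomputable instance : GradedAlgebra (freeGr deg) :=
  GradedAlgebra.ofAlgHom _ (freeDec deg)
    (free_hom_ext fun i => by
      rw [AlgHom.comp_apply, freeDec, freeLiftAlg_gen, DirectSum.coeAlgHom_of]; rfl)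
    (by
      rintro n ⟨w, hw⟩
      have key : ∃ h : w ∈ freeGr deg n,
          freeDec deg w = DirectSum.of (fun n => freeGr deg n) n ⟨w, h⟩ := by
        refine Submodule.span_induction (p := fun w _ => ∃ h : w ∈ freeGr deg n,
          freeDec deg w = DirectSum.of (fun n => freeGr deg n) n ⟨w, h⟩) ?_ ?_ ?_ ?_ hw
        · rintro _ ⟨l, hl, rfl⟩
          exact ⟨Submodule.subset_span ⟨l, hl, rfl⟩, freeDec_prod l hl _⟩
        · exact ⟨Submodule.zero_mem _, by
            rw [map_zero]; exact (map_zero (DirectSum.of (fun n => freeGr deg n) n)).symm⟩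
        · rintro s t _ _ ⟨hs, hs'⟩ ⟨ht, ht'⟩
          exact ⟨Submodule.add_mem _ hs ht, by rw [map_add, hs', ht', ← map_add]; rfl⟩
        · rintro c s _ ⟨hs, hs'⟩
          refine ⟨Submodule.smul_mem _ c hs, ?_⟩
          rw [map_smul, hs', ← DirectSum.lof_eq_of ℚ, ← map_smul]; rfl
      exact key.2)

theorem gen_mul_prod (i : I) (l : List I) :
    gen deg i * (l.map (gen deg)).prod =
      (-1 : ℚ) ^ (deg i * (l.map deg).sum) • ((l.map (gen deg)).prod * gen deg i) := by
  induction l with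
  | nil => simp
  | cons j l ih =>
    simp only [List.map_cons, List.prod_cons, List.sum_cons]
    rw [← mul_assoc, gen_mul_gen, smul_mul_assoc, mul_assoc, ih, mul_smul_comm, smul_smul, mul_add,
      pow_add, mul_assoc]

theorem prod_mul_prod (l l' : List I) :
    (l.map (gen deg)).prod * (l'.map (gen deg)).prod =
      (-1 : ℚ) ^ ((l.map deg).sum * (l'.map deg).sum) •
        ((l'.map (gen deg)).prod * (l.map (gen deg)).prod) := by
  induction l with
  | nil => simp
  | cons j l ih =>
    simp only [List.map_cons, List.prod_cons, List.sum_cons]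
    rw [mul_assoc, ih, mul_smul_comm, ← mul_assoc, gen_mul_prod, smul_mul_assoc, smul_smul, add_mul,
      pow_add, mul_assoc, mul_comm ((-1 : ℚ) ^ _)]

theorem free_mul_comm {m n : ℕ} {s t : Free deg} (hs : s ∈ freeGr deg m) (ht : t ∈ freeGr deg n) :
    s * t = (-1 : ℚ) ^ (m * n) • (t * s) := by
  refine Submodule.span_induction (p := fun s _ => s * t = (-1 : ℚ) ^ (m * n) • (t * s))
    ?_ ?_ ?_ ?_ hs
  · rintro _ ⟨l, rfl, rfl⟩
    refine Submodule.span_induction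
      (p := fun t _ => (l.map (gen deg)).prod * t = (-1 : ℚ) ^ ((l.map deg).sum * n) •
        (t * (l.map (gen deg)).prod)) ?_ ?_ ?_ ?_ ht
    · rintro _ ⟨l', rfl, rfl⟩
      exact prod_mul_prod l l'
    · simp
    · intro s t _ _ hs ht; rw [mul_add, hs, ht, add_mul, smul_add]
    · intro c s _ hs; rw [mul_smul_comm, hs, smul_mul_assoc, smul_comm]
  · simp
  · intro s t _ _ hs ht; rw [add_mul, hs, ht, mul_add, smul_add]
  · intro c s _ hs; rw [smul_mul_assoc, hs, mul_smul_comm, smul_comm]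

end Free

/-- The cdga `(Λ Z, 0)`. -/
noncomputable def freeC {I : Type u} (deg : I → ℕ) : CDGA.{u} where
  carrier := Free deg
  gr := freeGr deg
  mul_comm' := free_mul_comm
  d := 0
  d_mem := fun _ => Submodule.zero_mem _
  d_d := fun _ => rfl
  leibniz := by intros; simp

theorem freeLift_mem (A : CDGA.{u}) {I : Type*} {deg : I → ℕ} (v : I → A)
    (hv : ∀ i, v i ∈ A.gr (deg i)) {n : ℕ} {w : Free deg} (hw : w ∈ freeGr deg n) :
    A.freeLift deg v hv w ∈ A.gr n := by
  refine Submodule.span_induction (p := fun w _ => A.freeLift deg v hv w ∈ A.gr n) ?_ ?_ ?_ ?_ hw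
  · rintro _ ⟨l, rfl, rfl⟩
    clear hw
    induction l with
    | nil => simpa using SetLike.GradedOne.one_mem (A := A.gr)
    | cons i l ih =>
      simp only [List.map_cons, List.prod_cons, List.sum_cons, map_mul, freeLift_gen]
      exact SetLike.GradedMul.mul_mem (hv i) ih
  · rw [map_zero]; exact Submodule.zero_mem _
  · intro s t _ _ hs ht; rw [map_add]; exact Submodule.add_mem _ hs ht
  · intro c s _ hs; rw [map_smul]; exact Submodule.smul_mem _ _ hs

namespace IsFreeOn
variable {A : CDGA.{u}} {I : Type*} {deg : I → ℕ} {v : I → A} (h : A.IsFreeOn deg v)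
  {W : Type*} [Ring W] [Algebra ℚ W]
include h

/-- A free cdga as an algebra is `Λ Z`. -/
noncomputable def equiv : Free deg ≃ₐ[ℚ] A := AlgEquiv.ofBijective _ h.bijective

theorem equiv_gen (i : I) : h.equiv (gen deg i) = v i := A.freeLift_gen v h.mem i

/-- Algebra morphisms out of a free cdga, forgetting the differential. -/
noncomputable def lift (w : I → W)
    (hw : ∀ i j, w i * w j = (-1 : ℚ) ^ (deg i * deg j) • (w j * w i)) : A →ₐ[ℚ] W :=
  (freeLiftAlg w hw).comp h.equiv.symm.toAlgHom

theorem lift_gen (w : I → W)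
    (hw : ∀ i j, w i * w j = (-1 : ℚ) ^ (deg i * deg j) • (w j * w i)) (i : I) :
    h.lift w hw (v i) = w i := by
  have e : h.equiv.symm (v i) = gen deg i := by
    rw [← h.equiv_gen, AlgEquiv.symm_apply_apply]
  exact (congrArg _ e).trans (freeLiftAlg_gen w hw i)

theorem adjoin : Algebra.adjoin ℚ (Set.range v) = ⊤ := by
  have e : Set.range v = h.equiv.toAlgHom '' Set.range (gen deg) := by
    rw [← Set.range_comp]
    congr 1
    ext i
    exact (h.equiv_gen i).symm
  rw [e, ← AlgHom.map_adjoin, free_adjoin, Algebra.map_top, AlgHom.range_eq_top]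
  exact h.equiv.surjective

/-- Induction over sums and products of generators. -/
theorem induction {P : A → Prop} (hc : ∀ c : ℚ, P (algebraMap ℚ A c)) (hv : ∀ i, P (v i))
    (hadd : ∀ a b, P a → P b → P (a + b)) (hmul : ∀ a b, P a → P b → P (a * b)) (a : A) : P a := by
  have ha : a ∈ Algebra.adjoin ℚ (Set.range v) := h.adjoin ▸ Algebra.mem_top
  refine Algebra.adjoin_induction (p := fun a _ => P a) ?_ hc (fun a b _ _ => hadd a b)
    (fun a b _ _ => hmul a b) ha
  rintro _ ⟨i, rfl⟩
  exact hv i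

theorem hom_ext {f g : A →ₐ[ℚ] W} (hfg : ∀ i, f (v i) = g (v i)) : f = g := by
  refine AlgHom.ext fun a => ?_
  induction a using h.induction with
  | hc c => simp
  | hv i => exact hfg i
  | hadd a b ha hb => rw [map_add, map_add, ha, hb]
  | hmul a b ha hb => rw [map_mul, map_mul, ha, hb]

/-- Homogeneous elements of a free cdga are linear combinations of monomials of that degree. -/
theorem gr_eq (n : ℕ) :
    A.gr n = Submodule.span ℚ {w | ∃ l : List I, (l.map deg).sum = n ∧ w = (l.map v).prod} := by
  have key : ∀ l : List I, A.freeLift deg v h.mem (l.map (gen deg)).prod = (l.map v).prod := by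
    intro l
    rw [map_list_prod, List.map_map]
    congr 2
    funext i
    exact A.freeLift_gen v h.mem i
  have e : Submodule.span ℚ {w | ∃ l : List I, (l.map deg).sum = n ∧ w = (l.map v).prod} =
      (freeGr deg n).map (A.freeLift deg v h.mem).toLinearMap := by
    rw [freeGr, Submodule.map_span]
    congr 1
    ext w
    constructor
    · rintro ⟨l, hl, rfl⟩
      exact ⟨_, ⟨l, hl, rfl⟩, key l⟩
    · rintro ⟨_, ⟨l, hl, rfl⟩, rfl⟩
      exact ⟨l, hl, key l⟩
  rw [e]
  apply le_antisymm
  · intro a ha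
    obtain ⟨w, rfl⟩ := h.bijective.2 a
    classical
    have hs := DirectSum.sum_support_decompose (freeGr deg) w
    have hw : A.freeLift deg v h.mem w =
        A.freeLift deg v h.mem (DirectSum.decompose (freeGr deg) w n : Free deg) := by
      have h1 := DirectSum.decompose_of_mem_same A.gr ha
      rw [← h1]
      conv_lhs => rw [← hs]
      rw [map_sum, DirectSum.decompose_sum, DFinsupp.finsetSum_apply,
        AddSubmonoidClass.coe_finsetSum]
      rw [Finset.sum_eq_single n]
      · exact DirectSum.decompose_of_mem_same A.gr (A.freeLift_mem v h.mem (SetLike.coe_mem _))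
      · intro m _ hm
        exact DirectSum.decompose_of_mem_ne A.gr (A.freeLift_mem v h.mem (SetLike.coe_mem _)) hm
      · intro hn
        rw [DFinsupp.notMem_support_iff] at hn
        rw [hn]; simp
    rw [hw]
    exact Submodule.mem_map_of_mem (SetLike.coe_mem _)
  · rintro _ ⟨w, hw, rfl⟩
    exact A.freeLift_mem v h.mem hw

end IsFreeOn

theorem freeC_isFreeOn {I : Type u} (deg : I → ℕ) : (freeC deg).IsFreeOn deg (gen deg) where
  mem := gen_mem
  bijective := by
    have : (freeC deg).freeLift deg (gen deg) gen_mem = AlgHom.id ℚ (Free deg) :=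
      free_hom_ext fun i => freeLift_gen (freeC deg) _ _ i
    rw [this]
    exact Function.bijective_id

/-- A cdga is simply connected here if its part of degree `0` consists of the scalars and its part
of degree `1` vanishes. -/
structure IsOneConnected (A : CDGA.{u}) : Prop where
  zero : ∀ a ∈ A.gr 0, ∃ c : ℚ, a = algebraMap ℚ A c
  one : ∀ a ∈ A.gr 1, a = 0

theorem IsFreeOn.isOneConnected {A : CDGA.{u}} {I : Type*} {deg : I → ℕ} {v : I → A}
    (h : A.IsFreeOn deg v) (hdeg : ∀ i, 2 ≤ deg i) : A.IsOneConnected := by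
  have key : ∀ l : List I, (l.map deg).sum < 2 → l = [] := by
    intro l hl
    cases l with
    | nil => rfl
    | cons i l =>
      have := hdeg i
      simp only [List.map_cons, List.sum_cons] at hl
      omega
  constructor
  · intro a ha
    rw [h.gr_eq] at ha
    refine Submodule.span_induction (p := fun a _ => ∃ c : ℚ, a = algebraMap ℚ A c) ?_ ?_ ?_ ?_ ha
    · rintro _ ⟨l, hl, rfl⟩
      obtain rfl := key l (by omega)
      exact ⟨1, by simp⟩
    · exact ⟨0, by simp⟩
    · rintro _ _ _ _ ⟨c, rfl⟩ ⟨c', rfl⟩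
      exact ⟨c + c', by simp⟩
    · rintro r _ _ ⟨c, rfl⟩
      exact ⟨r * c, by rw [map_mul, Algebra.smul_def]⟩
  · intro a ha
    rw [h.gr_eq] at ha
    have : {w | ∃ l : List I, (l.map deg).sum = 1 ∧ w = (l.map v).prod} = ∅ := by
      ext w
      simp only [Set.mem_ofPred_eq, Set.mem_empty_iff_false, iff_false]
      rintro ⟨l, hl, -⟩
      obtain rfl := key l (by omega)
      simp at hl
    rw [this, Submodule.span_empty] at ha
    simpa using ha

end CDGA

namespace CDGA

/-! ### Tensor products -/

section TensorAPI
variable (A B : CDGA.{u})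

/-- The inclusion `a ↦ a ⊗ 1`. -/
noncomputable def inl : Hom A (A.tensor B) where
  toAlgHom := GradedTensorProduct.includeLeft A.gr B.gr
  map_gr := fun {i a} ha => by
    have h := tm_mem (B := B) ha (SetLike.GradedOne.one_mem (A := B.gr))
    rwa [add_zero] at h
  map_d := fun a => by
    change tm (A.d a) 1 = tD A B (tm a 1)
    rw [tD_tm', B.d_one, tm_zero, add_zero]

/-- The inclusion `b ↦ 1 ⊗ b`. -/
noncomputable def inr : Hom B (A.tensor B) where
  toAlgHom := GradedTensorProduct.includeRight A.gr B.gr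
  map_gr := fun {i b} hb => by
    have h := tm_mem (A := A) (SetLike.GradedOne.one_mem (A := A.gr)) hb
    rwa [zero_add] at h
  map_d := fun b => by
    change tm 1 (B.d b) = tD A B (tm 1 b)
    rw [tD_tm', A.d_one, zero_tm, zero_add, A.sgn_one]

variable {A B}

theorem inl_mul_inr (a : A) (b : B) :
    (A.inl B).toAlgHom a * (A.inr B).toAlgHom b = (tm a b : TCarrier A B) :=
  GradedTensorProduct.tmul_one_mul_one_tmul A.gr B.gr a b

theorem tensor_hom_induction {P : A.tensor B → Prop} (h0 : P 0)
    (hh : ∀ i j, ∀ a ∈ A.gr i, ∀ b ∈ B.gr j, P ((A.inl B).toAlgHom a * (A.inr B).toAlgHom b))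
    (hadd : ∀ s t, P s → P t → P (s + t)) (t : A.tensor B) : P t := by
  refine tensor_induction (A := A) (B := B) (P := P) h0 ?_ hadd t
  intro i j a ha b hb
  rw [← inl_mul_inr]
  exact hh i j a ha b hb

theorem tensor_gr_induction {n : ℕ} {P : A.tensor B → Prop} (h0 : P 0)
    (hh : ∀ i j, i + j = n → ∀ a ∈ A.gr i, ∀ b ∈ B.gr j,
      P ((A.inl B).toAlgHom a * (A.inr B).toAlgHom b))
    (hadd : ∀ s t, P s → P t → P (s + t)) {t : A.tensor B} (ht : t ∈ (A.tensor B).gr n) : P t := by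
  refine tGr_induction (A := A) (B := B) (P := P) h0 ?_ hadd ht
  intro i j hij a ha b hb
  rw [← inl_mul_inr]
  exact hh i j hij a ha b hb

section Lift
variable {W : Type*} [Ring W] [Algebra ℚ W] (f : A →ₐ[ℚ] W) (g : B →ₐ[ℚ] W)
  (hfg : ∀ i j, ∀ a ∈ A.gr i, ∀ b ∈ B.gr j, f a * g b = (-1 : ℚ) ^ (i * j) • (g b * f a))

/-- The universal property of `A ⊗ B` with respect to all algebras. -/
noncomputable def tensorLift : A.tensor B →ₐ[ℚ] W :=
  GradedTensorProduct.lift A.gr B.gr f g (by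
    intro i j a b
    refine (hfg i j a a.2 b b.2).trans ?_
    rw [mul_comm i j]
    rcases Nat.even_or_odd (j * i) with he | he
    · simp [he.neg_one_pow]
    · simp [he.neg_one_pow, Units.smul_def])

theorem tensorLift_mul (a : A) (b : B) :
    tensorLift f g hfg ((A.inl B).toAlgHom a * (A.inr B).toAlgHom b) = f a * g b := by
  rw [inl_mul_inr]
  rfl

theorem tensorLift_inl (a : A) : tensorLift f g hfg ((A.inl B).toAlgHom a) = f a := by
  have h := tensorLift_mul f g hfg a 1
  rwa [map_one, mul_one, map_one, mul_one] at h

theorem tensorLift_inr (b : B) : tensorLift f g hfg ((A.inr B).toAlgHom b) = g b := by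
  have h := tensorLift_mul f g hfg 1 b
  rwa [map_one, one_mul, map_one, one_mul] at h

theorem tensor_hom_ext {f g : A.tensor B →ₐ[ℚ] W}
    (hl : ∀ a, f ((A.inl B).toAlgHom a) = g ((A.inl B).toAlgHom a))
    (hr : ∀ b, f ((A.inr B).toAlgHom b) = g ((A.inr B).toAlgHom b)) : f = g := by
  refine AlgHom.ext fun t => ?_
  induction t using tensor_hom_induction with
  | h0 => simp
  | hh i j a _ b _ => rw [map_mul, map_mul, hl, hr]
  | hadd s t hs ht => rw [map_add, map_add, hs, ht]

end Lift

theorem tensor_isOneConnected (hA : A.IsOneConnected) (hB : B.IsOneConnected) :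
    (A.tensor B).IsOneConnected := by
  constructor
  · intro t ht
    refine tensor_gr_induction (P := fun t => ∃ c : ℚ, t = algebraMap ℚ (A.tensor B) c)
      ⟨0, by simp⟩ ?_ ?_ ht
    · intro i j hij a ha b hb
      obtain ⟨rfl, rfl⟩ : i = 0 ∧ j = 0 := by omega
      obtain ⟨c, rfl⟩ := hA.zero a ha
      obtain ⟨c', rfl⟩ := hB.zero b hb
      exact ⟨c * c', by rw [AlgHom.commutes, AlgHom.commutes, map_mul]⟩
    · rintro _ _ ⟨c, rfl⟩ ⟨c', rfl⟩
      exact ⟨c + c', by simp⟩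
  · intro t ht
    refine tensor_gr_induction (P := fun t => t = 0) rfl ?_ ?_ ht
    · intro i j hij a ha b hb
      obtain ⟨rfl, rfl⟩ | ⟨rfl, rfl⟩ : (i = 1 ∧ j = 0) ∨ (i = 0 ∧ j = 1) := by omega
      · rw [hA.one a ha, map_zero, zero_mul]
      · rw [hB.one b hb, map_zero, mul_zero]
    · rintro s t rfl rfl
      exact add_zero 0

variable {I J : Type*} {deg : I → ℕ} {deg' : J → ℕ} {v : I → A} {w : J → B}

theorem IsFreeOn.map_mem_freeGr {K : Type*} {degK : K → ℕ} {e : I → K} (hv : A.IsFreeOn deg v)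
    {f : A →ₐ[ℚ] Free degK} (hf : ∀ i, f (v i) = gen degK (e i)) (he : ∀ i, degK (e i) = deg i)
    {n : ℕ} {a : A} (ha : a ∈ A.gr n) : f a ∈ freeGr degK n := by
  rw [hv.gr_eq] at ha
  refine Submodule.span_induction (p := fun a _ => f a ∈ freeGr degK n) ?_ ?_ ?_ ?_ ha
  · rintro _ ⟨l, rfl, rfl⟩
    refine Submodule.subset_span ⟨l.map e, ?_, ?_⟩
    · rw [List.map_map]
      congr 2
      funext i
      exact he i
    · rw [map_list_prod, List.map_map, List.map_map]
      congr 2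
      funext i
      exact hf i
  · rw [map_zero]; exact Submodule.zero_mem _
  · intro s t _ _ hs ht; rw [map_add]; exact Submodule.add_mem _ hs ht
  · intro c s _ hs; rw [map_smul]; exact Submodule.smul_mem _ _ hs

/-- The tensor product of free cdgas is free on the union of the generators. -/
theorem IsFreeOn.tensor (hv : A.IsFreeOn deg v) (hw : B.IsFreeOn deg' w) :
    (A.tensor B).IsFreeOn (Sum.elim deg deg')
      (Sum.elim (fun i => (A.inl B).toAlgHom (v i)) (fun j => (A.inr B).toAlgHom (w j))) := by
  have hmem : ∀ k, Sum.elim (fun i => (A.inl B).toAlgHom (v i))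
      (fun j => (A.inr B).toAlgHom (w j)) k ∈ (A.tensor B).gr (Sum.elim deg deg' k) := by
    rintro (i | j)
    · exact (A.inl B).map_gr (hv.mem i)
    · exact (A.inr B).map_gr (hw.mem j)
  refine ⟨hmem, ?_⟩
  -- The inverse is assembled from the morphisms `Λ V → Λ (V ⊕ W)` and `Λ W → Λ (V ⊕ W)`.
  let f : A →ₐ[ℚ] Free (Sum.elim deg deg') :=
    hv.lift (fun i => gen _ (Sum.inl i)) (fun i i' => gen_mul_gen (deg := Sum.elim deg deg') _ _)
  let g : B →ₐ[ℚ] Free (Sum.elim deg deg') :=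
    hw.lift (fun j => gen _ (Sum.inr j)) (fun i i' => gen_mul_gen (deg := Sum.elim deg deg') _ _)
  have hf : ∀ i, f (v i) = gen _ (Sum.inl i) := hv.lift_gen _ _
  have hg : ∀ j, g (w j) = gen _ (Sum.inr j) := hw.lift_gen _ _
  let F := (A.tensor B).freeLift (Sum.elim deg deg') _ hmem
  let G : A.tensor B →ₐ[ℚ] Free (Sum.elim deg deg') :=
    tensorLift f g (fun i j a ha b hb => free_mul_comm
      (hv.map_mem_freeGr hf (fun _ => rfl) ha) (hw.map_mem_freeGr hg (fun _ => rfl) hb))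
  have hF : ∀ k, F (gen _ k) = _ := fun k => freeLift_gen (A.tensor B) _ hmem k
  have hGF : G.comp F = AlgHom.id ℚ _ := by
    refine free_hom_ext fun k => ?_
    rw [AlgHom.comp_apply, hF]
    rcases k with i | j
    · exact (tensorLift_inl f g _ _).trans (hf i)
    · exact (tensorLift_inr f g _ _).trans (hg j)
  have hFG : F.comp G = AlgHom.id ℚ _ := by
    have hl : (F.comp f) = (A.inl B).toAlgHom := hv.hom_ext fun i => by
      rw [AlgHom.comp_apply, hf, hF]; rfl
    have hr : (F.comp g) = (A.inr B).toAlgHom := hw.hom_ext fun i => by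
      rw [AlgHom.comp_apply, hg, hF]; rfl
    refine tensor_hom_ext (fun a => ?_) (fun b => ?_)
    · rw [AlgHom.comp_apply, tensorLift_inl]
      exact AlgHom.congr_fun hl a
    · rw [AlgHom.comp_apply, tensorLift_inr]
      exact AlgHom.congr_fun hr b
  exact Function.bijective_iff_has_inverse.mpr
    ⟨G, AlgHom.congr_fun hGF, AlgHom.congr_fun hFG⟩

end TensorAPI

end CDGA

namespace CDGA

/-! ### Acyclic ideals generated by pairs `u, x ^ 2` with `d u = x ^ 2` -/

section Pairs
variable {R : CDGA.{u}} {I κ : Type*} {deg : I → ℕ} {v : I → R} {X U : κ → I}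

/-- In a free cdga on generators `v i`, families `x k = v (X k)` of even cocycles and
`u k = v (U k)` of odd elements with `d (u k) = x k ^ 2`. -/
structure IsKillingPairs (R : CDGA.{u}) (deg : I → ℕ) (v : I → R) (X U : κ → I) : Prop where
  free : R.IsFreeOn deg v
  even : ∀ k, Even (deg (X k))
  odd : ∀ k, Odd (deg (U k))
  injective_X : Function.Injective X
  injective_U : Function.Injective U
  d_X : ∀ k, R.d (v (X k)) = 0
  d_U : ∀ k, R.d (v (U k)) = v (X k) ^ 2

/-- The ideal generated by `u k` and `x k ^ 2` for `k ∈ S`. -/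
def pairIdeal (v : I → R) (X U : κ → I) (S : Set κ) : Ideal R :=
  Ideal.span {t | ∃ k ∈ S, t = v (U k) ∨ t = v (X k) ^ 2}

theorem u_mem_pairIdeal {S : Set κ} {k : κ} (hk : k ∈ S) : v (U k) ∈ pairIdeal v X U S :=
  Ideal.subset_span ⟨k, hk, Or.inl rfl⟩

theorem sq_mem_pairIdeal {S : Set κ} {k : κ} (hk : k ∈ S) : v (X k) ^ 2 ∈ pairIdeal v X U S :=
  Ideal.subset_span ⟨k, hk, Or.inr rfl⟩

theorem pairIdeal_induction {S : Set κ} {P : R → Prop} (h0 : P 0)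
    (hU : ∀ k ∈ S, ∀ r, P (r * v (U k))) (hX : ∀ k ∈ S, ∀ r, P (r * v (X k) ^ 2))
    (hadd : ∀ a b, P a → P b → P (a + b)) {t : R} (ht : t ∈ pairIdeal v X U S) : P t := by
  have key : t ∈ pairIdeal v X U S ∧ P t := by
    refine Submodule.closure_induction (p := fun t _ => t ∈ pairIdeal v X U S ∧ P t)
      ⟨zero_mem _, h0⟩ (fun a b _ _ ha hb => ⟨add_mem ha.1 hb.1, hadd a b ha.2 hb.2⟩) ?_ ht
    rintro r _ ⟨k, hk, rfl | rfl⟩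
    · exact ⟨Ideal.mul_mem_left _ r (u_mem_pairIdeal hk), hU k hk r⟩
    · exact ⟨Ideal.mul_mem_left _ r (sq_mem_pairIdeal hk), hX k hk r⟩
  exact key.2

theorem exists_eq_of_mem_insert {S : Set κ} {k : κ} {t : R}
    (ht : t ∈ pairIdeal v X U (insert k S)) :
    ∃ j ∈ pairIdeal v X U S, ∃ b c, t = j + b * v (U k) + c * v (X k) ^ 2 := by
  refine pairIdeal_induction
    (P := fun t => ∃ j ∈ pairIdeal v X U S, ∃ b c, t = j + b * v (U k) + c * v (X k) ^ 2)
    ?_ ?_ ?_ ?_ ht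
  · exact ⟨0, zero_mem _, 0, 0, by simp⟩
  · rintro l (rfl | hl) r
    · exact ⟨0, zero_mem _, r, 0, by simp⟩
    · exact ⟨_, Ideal.mul_mem_left _ r (u_mem_pairIdeal hl), 0, 0, by simp⟩
  · rintro l (rfl | hl) r
    · exact ⟨0, zero_mem _, 0, r, by simp⟩
    · exact ⟨_, Ideal.mul_mem_left _ r (sq_mem_pairIdeal hl), 0, 0, by simp⟩
  · rintro _ _ ⟨j, hj, b, c, rfl⟩ ⟨j', hj', b', c', rfl⟩
    exact ⟨j + j', add_mem hj hj', b + b', c + c', by simp only [add_mul]; abel⟩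

namespace IsKillingPairs
variable (h : IsKillingPairs R deg v X U)
include h

theorem X_ne_U (k l : κ) : X k ≠ U l := fun e =>
  Nat.not_even_iff_odd.mpr (h.odd l) (e ▸ h.even k)

theorem sq_mem (k : κ) : v (X k) ^ 2 ∈ R.gr (deg (X k) + deg (X k)) := by
  rw [sq]
  exact SetLike.GradedMul.mul_mem (h.free.mem _) (h.free.mem _)

theorem sq_comm (k : κ) (b : R) : v (X k) ^ 2 * b = b * v (X k) ^ 2 :=
  R.even_comm ((h.even k).add (h.even k)) (h.sq_mem k) b

theorem x_comm (k : κ) (b : R) : v (X k) * b = b * v (X k) :=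
  R.even_comm (h.even k) (h.free.mem _) b

theorem u_comm (k : κ) (b : R) : v (U k) * b = R.sgn b * v (U k) :=
  R.odd_comm (h.odd k) (h.free.mem _) b

theorem u_mul_u (k : κ) : v (U k) * v (U k) = 0 := R.odd_sq (h.odd k) (h.free.mem _)

theorem sgn_u (k : κ) : R.sgn (v (U k)) = - v (U k) := by
  rw [R.sgn_of_mem (h.free.mem _), (h.odd k).neg_one_pow, neg_smul, one_smul]

theorem sgn_sq (k : κ) : R.sgn (v (X k) ^ 2) = v (X k) ^ 2 := by
  rw [R.sgn_of_mem (h.sq_mem k), ((h.even k).add (h.even k)).neg_one_pow, one_smul]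

theorem d_sq (k : κ) : R.d (v (X k) ^ 2) = 0 := by
  rw [sq, R.d_mul, h.d_X, zero_mul, mul_zero, add_zero]

theorem sgn_mem_pairIdeal {S : Set κ} {t : R} (ht : t ∈ pairIdeal v X U S) :
    R.sgn t ∈ pairIdeal v X U S := by
  refine pairIdeal_induction (P := fun t => R.sgn t ∈ pairIdeal v X U S) ?_ ?_ ?_ ?_ ht
  · simp
  · intro k hk r
    rw [R.sgn_mul, h.sgn_u, mul_neg]
    exact neg_mem (Ideal.mul_mem_left _ _ (u_mem_pairIdeal hk))
  · intro k hk r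
    rw [R.sgn_mul, h.sgn_sq]
    exact Ideal.mul_mem_left _ _ (sq_mem_pairIdeal hk)
  · intro a b ha hb
    rw [map_add]; exact add_mem ha hb

theorem isDGIdeal (S : Set κ) : R.IsDGIdeal (pairIdeal v X U S) where
  twoSided := by
    refine ⟨fun {t} b ht => ?_⟩
    refine pairIdeal_induction (P := fun t => t * b ∈ pairIdeal v X U S) ?_ ?_ ?_ ?_ ht
    · simp
    · intro k hk r
      rw [mul_assoc, h.u_comm, ← mul_assoc]
      exact Ideal.mul_mem_left _ _ (u_mem_pairIdeal hk)
    · intro k hk r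
      rw [mul_assoc, h.sq_comm, ← mul_assoc]
      exact Ideal.mul_mem_left _ _ (sq_mem_pairIdeal hk)
    · intro a a' ha ha'
      rw [add_mul]; exact add_mem ha ha'
  homogeneous := by
    intro t ht n
    refine Ideal.homogeneous_span R.gr _ ?_ n ht
    rintro _ ⟨k, hk, rfl | rfl⟩
    · exact ⟨_, h.free.mem _⟩
    · exact ⟨_, h.sq_mem k⟩
  d_mem := by
    intro t ht
    refine pairIdeal_induction (P := fun t => R.d t ∈ pairIdeal v X U S) ?_ ?_ ?_ ?_ ht
    · simp
    · intro k hk r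
      rw [R.d_mul, h.d_U]
      exact add_mem (Ideal.mul_mem_left _ _ (u_mem_pairIdeal hk))
        (Ideal.mul_mem_left _ _ (sq_mem_pairIdeal hk))
    · intro k hk r
      rw [R.d_mul, h.d_sq, mul_zero, add_zero]
      exact Ideal.mul_mem_left _ _ (sq_mem_pairIdeal hk)
    · intro a b ha hb
      rw [map_add]; exact add_mem ha hb

/-- The algebra endomorphism `u k ↦ 0`, fixing the other generators. -/
theorem exists_eval (k : κ) : ∃ σ : R →ₐ[ℚ] R, σ (v (U k)) = 0 ∧
    (∀ i, i ≠ U k → σ (v i) = v i) ∧ (∀ a, ∃ e, a = σ a + e * v (U k)) ∧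
    ∀ a, σ (R.sgn a) = R.sgn (σ a) := by
  classical
  have hmem : ∀ i, (if i = U k then 0 else v i) ∈ R.gr (deg i) := by
    intro i
    split_ifs
    · exact zero_mem _
    · exact h.free.mem i
  obtain ⟨σ, hσ⟩ : ∃ σ : R →ₐ[ℚ] R, ∀ i, σ (v i) = if i = U k then 0 else v i :=
    ⟨h.free.lift _ fun i j => R.mul_comm' (hmem i) (hmem j), fun i => h.free.lift_gen _ _ i⟩
  refine ⟨σ, by simp [hσ], fun i hi => by simp [hσ, hi], fun a => ?_, fun a => ?_⟩
  · induction a using h.free.induction with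
    | hc c => exact ⟨0, by simp⟩
    | hv i =>
      by_cases hi : i = U k
      · exact ⟨1, by simp [hσ, hi]⟩
      · exact ⟨0, by simp [hσ, hi]⟩
    | hadd a b ha hb =>
      obtain ⟨e, he⟩ := ha
      obtain ⟨f, hf⟩ := hb
      refine ⟨e + f, ?_⟩
      nth_rewrite 1 [he, hf]
      rw [map_add, add_mul]
      abel
    | hmul a b ha hb =>
      obtain ⟨e, he⟩ := ha
      obtain ⟨f, hf⟩ := hb
      refine ⟨σ a * f + e * R.sgn (σ b), ?_⟩
      nth_rewrite 1 [he]
      nth_rewrite 1 [hf]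
      rw [map_mul, add_mul, add_mul, mul_add, mul_add, mul_assoc e, mul_assoc e, h.u_comm,
        ← mul_assoc (v (U k)), h.u_comm k f, mul_assoc (R.sgn f), h.u_mul_u]
      simp only [mul_zero, add_zero, mul_assoc, add_assoc]
  · refine AlgHom.congr_fun (h.free.hom_ext (f := σ.comp R.sgnHom) (g := R.sgnHom.comp σ) ?_) a
    intro i
    rw [AlgHom.comp_apply, AlgHom.comp_apply, sgnHom_apply, sgnHom_apply,
      R.sgn_of_mem (h.free.mem i), map_smul, hσ, R.sgn_of_mem (hmem i)]

/-- Division by `x k`: a linear map `Q` with `Q (x k * a) = a` which is linear over the other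
generators. It is the upper right entry of the algebra morphism `R → M₂(R)` sending `x k` to
`!![0, 1; 0, x k]` and every other generator to a scalar matrix. -/
theorem exists_div (k : κ) : ∃ Q : R →ₗ[ℚ] R, (∀ a, Q (a * v (X k)) = a) ∧
    (∀ i, i ≠ X k → ∀ a, Q (a * v i) = Q a * v i) := by
  classical
  let w : I → Matrix (Fin 2) (Fin 2) R := fun i =>
    if i = X k then !![0, 1; 0, v i] else !![v i, 0; 0, v i]
  have hw : ∀ i j, w i * w j = (-1 : ℚ) ^ (deg i * deg j) • (w j * w i) := by
    intro i j
    have hij := R.mul_comm' (h.free.mem i) (h.free.mem j)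
    by_cases hi : i = X k
    · subst hi
      have e : (-1 : ℚ) ^ (deg (X k) * deg j) = 1 := ((h.even k).mul_right _).neg_one_pow
      rw [e, one_smul] at hij ⊢
      by_cases hj : j = X k
      · rw [hj]
      · simp [w, hj, hij]
    · by_cases hj : j = X k
      · subst hj
        have e : (-1 : ℚ) ^ (deg i * deg (X k)) = 1 := ((h.even k).mul_left _).neg_one_pow
        rw [e, one_smul] at hij ⊢
        simp [w, hi, hij]
      · simp [w, hi, hj, hij]
  let Φ : R →ₐ[ℚ] Matrix (Fin 2) (Fin 2) R := h.free.lift w hw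
  have hΦ : ∀ i, Φ (v i) = w i := fun i => h.free.lift_gen _ _ i
  have h1 : ∀ a, Φ a 1 0 = 0 ∧ Φ a 1 1 = a := by
    intro a
    induction a using h.free.induction with
    | hc c => simp [Matrix.algebraMap_matrix_apply]
    | hv i => rw [hΦ]; by_cases hi : i = X k <;> simp [w, hi]
    | hadd a b ha hb => simp [ha, hb]
    | hmul a b ha hb => simp [Matrix.mul_apply, Fin.sum_univ_two, ha, hb]
  let Q : R →ₗ[ℚ] R :=
    { toFun := fun a => Φ a 0 1
      map_add' := fun a b => by simp
      map_smul' := fun c a => by simp }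
  refine ⟨Q, fun a => ?_, fun i hi a => ?_⟩
  · rw [← h.x_comm]
    change Φ _ 0 1 = a
    simp [Matrix.mul_apply, Fin.sum_univ_two, h1, hΦ, w]
  · change Φ _ 0 1 = Φ a 0 1 * _
    simp [Matrix.mul_apply, Fin.sum_univ_two, hΦ, w, hi]

/-- The ideal generated by finitely many pairs is acyclic: adding one pair `u, x ^ 2`, a cocycle is
`j + b u + c x ^ 2` with `j` in the previous ideal and `b, c` free of `u`; since `x ^ 2` is a
non-zero-divisor modulo that ideal, it is cohomologous to an element of it. -/
theorem acyclic (S : Finset κ) {t : R} (ht : t ∈ pairIdeal v X U S) (hd : R.d t = 0) :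
    ∃ s ∈ pairIdeal v X U S, R.d s = t := by
  classical
  induction S using Finset.induction_on generalizing t with
  | empty =>
    refine ⟨0, zero_mem _, ?_⟩
    have : t = 0 := pairIdeal_induction (P := fun t : R => t = (0 : R)) rfl (by simp) (by simp)
      (fun a b ha hb => by rw [ha, hb, add_zero]) ht
    rw [map_zero, this]
  | insert k S hk ih =>
    have hk' : k ∉ (S : Set κ) := by simpa using hk
    rw [Finset.coe_insert] at ht ⊢
    have hmono : pairIdeal v X U (S : Set κ) ≤ pairIdeal v X U (insert k (S : Set κ)) := by
      refine Ideal.span_mono ?_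
      rintro t ⟨l, hl, hlt⟩
      exact ⟨l, Set.mem_insert_of_mem _ hl, hlt⟩
    obtain ⟨σ, hσu, hσv, hσe, hσs⟩ := h.exists_eval k
    obtain ⟨Q, hQx, hQv⟩ := h.exists_div k
    set J := pairIdeal v X U (S : Set κ) with hJ
    have hσJ : ∀ t ∈ J, σ t ∈ J := by
      intro t ht
      refine pairIdeal_induction (P := fun t => σ t ∈ J) ?_ ?_ ?_ ?_ ht
      · simp
      · intro l hl r
        rw [map_mul, hσv _ (fun e => hk' (h.injective_U e ▸ hl))]
        exact Ideal.mul_mem_left _ _ (u_mem_pairIdeal hl)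
      · intro l hl r
        rw [map_mul, map_pow, hσv _ (h.X_ne_U l k)]
        exact Ideal.mul_mem_left _ _ (sq_mem_pairIdeal hl)
      · intro a b ha hb
        rw [map_add]; exact add_mem ha hb
    have hQJ : ∀ t ∈ J, Q t ∈ J := by
      intro t ht
      refine pairIdeal_induction (P := fun t => Q t ∈ J) ?_ ?_ ?_ ?_ ht
      · simp
      · intro l hl r
        rw [hQv _ (h.X_ne_U k l).symm]
        exact Ideal.mul_mem_left _ _ (u_mem_pairIdeal hl)
      · intro l hl r
        have hne : X l ≠ X k := fun e => hk' (h.injective_X e ▸ hl)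
        rw [sq, ← mul_assoc, hQv _ hne, hQv _ hne, mul_assoc, ← sq]
        exact Ideal.mul_mem_left _ _ (sq_mem_pairIdeal hl)
      · intro a b ha hb
        rw [map_add]; exact add_mem ha hb
    have hdiv : ∀ a, a * v (X k) ^ 2 ∈ J → a ∈ J := by
      intro a ha
      rw [sq, ← mul_assoc] at ha
      simpa [hQx] using hQJ _ (hQJ _ ha)
    have hu : ∀ a, a * v (U k) = σ a * v (U k) := by
      intro a
      obtain ⟨e, he⟩ := hσe a
      nth_rewrite 1 [he]
      rw [add_mul, mul_assoc e, h.u_mul_u, mul_zero, add_zero]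
    have := (h.isDGIdeal (S : Set κ)).twoSided
    obtain ⟨j, hj, b, c, rfl⟩ := exists_eq_of_mem_insert ht
    obtain ⟨f, hf⟩ := hσe c
    obtain ⟨b', hb'⟩ : ∃ b', b + f * v (X k) ^ 2 = b' := ⟨_, rfl⟩
    have ht' : j + b * v (U k) + c * v (X k) ^ 2 =
        j + σ b' * v (U k) + σ c * v (X k) ^ 2 := by
      rw [← hu, ← hb']
      nth_rewrite 1 [hf]
      rw [add_mul, add_mul, mul_assoc f, mul_assoc f, h.sq_comm k (v (U k))]
      abel
    rw [ht'] at hd ⊢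
    -- Apply `u ↦ 0` to the equation `d t = 0` and divide by `x ^ 2`.
    have he : σ (R.sgn (σ b') + R.d (σ c)) ∈ J := by
      apply hdiv
      have h0 := congrArg σ hd
      rw [map_add R.d, map_add R.d, R.d_mul, R.d_mul, h.d_U, h.d_sq, mul_zero, add_zero] at h0
      simp only [map_add, map_mul, map_pow, hσu, mul_zero, zero_add, hσv _ (h.X_ne_U k k),
        map_zero] at h0
      rw [map_add, add_mul]
      have h1 := hσJ _ ((h.isDGIdeal (S : Set κ)).d_mem j hj)
      rw [add_assoc] at h0
      rw [← neg_eq_of_add_eq_zero_right h0]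
      exact neg_mem h1
    -- Subtracting the coboundary of a multiple of `u` removes the term with `x ^ 2`, and leaves a
    -- multiple of `u` whose coefficient lies in `J`.
    have hred : j + σ b' * v (U k) + σ c * v (X k) ^ 2 - R.d (R.sgn (σ c) * v (U k)) ∈ J := by
      have e1 : j + σ b' * v (U k) + σ c * v (X k) ^ 2 - R.d (R.sgn (σ c) * v (U k)) =
          j + R.sgn (σ (R.sgn (σ b') + R.d (σ c))) * v (U k) := by
        have e2 : ∀ a, R.sgn (σ a) * v (U k) = R.sgn a * v (U k) := fun a => by rw [← hσs, ← hu]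
        rw [e2 (_ + _), R.d_mul, R.sgn_sgn, h.d_U, map_add, R.sgn_sgn, R.sgn_d, add_mul,
          neg_mul]
        abel
      rw [e1]
      exact add_mem hj (Ideal.mul_mem_right _ _ (h.sgn_mem_pairIdeal he))
    obtain ⟨s, hs, hds⟩ := ih hred (by rw [map_sub, hd, R.d_d, sub_zero])
    refine ⟨s + R.sgn (σ c) * v (U k), add_mem (hmono hs)
      (Ideal.mul_mem_left _ _ (u_mem_pairIdeal (Set.mem_insert _ _))), ?_⟩
    rw [map_add, hds, sub_add_cancel]

end IsKillingPairs
end Pairs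

end CDGA

/-! ### Powers of sums of ideals in a noncommutative ring -/

section Nilpotent
variable {R : Type*} [Ring R] [Algebra ℚ R]

theorem restrictScalars_mul_le {I : Ideal R} [I.IsTwoSided] (X : Submodule ℚ R) :
    I.restrictScalars ℚ * X ≤ I.restrictScalars ℚ :=
  Submodule.mul_le.mpr fun _ ha b _ => I.mul_mem_right b ha

theorem mul_restrictScalars_le {I : Ideal R} (X : Submodule ℚ R) :
    X * I.restrictScalars ℚ ≤ I.restrictScalars ℚ :=
  Submodule.mul_le.mpr fun a _ _ hb => I.mul_mem_left a hb

theorem restrictScalars_pow_le {I : Ideal R} [I.IsTwoSided] (m : ℕ) :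
    (I ^ (m + 1)).restrictScalars ℚ ≤ I.restrictScalars ℚ ^ (m + 1) := by
  induction m with
  | zero =>
    intro t ht
    rw [zero_add, pow_one]
    rwa [zero_add, Submodule.pow_one] at ht
  | succ m ih =>
    intro t ht
    have ht' : t ∈ I * I ^ (m + 1) := by
      rw [← Ideal.IsTwoSided.pow_succ]
      exact ht
    rw [pow_succ']
    refine Submodule.smul_induction_on
      (p := fun t => t ∈ I.restrictScalars ℚ * I.restrictScalars ℚ ^ (m + 1)) ht' ?_ ?_
    · intro a ha b hb
      have ha' : a ∈ I.restrictScalars ℚ := ha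
      have hb' : b ∈ (I ^ (m + 1)).restrictScalars ℚ := hb
      rw [smul_eq_mul]
      exact Submodule.mul_mem_mul ha' (ih hb')
    · intro a b ha hb
      exact add_mem ha hb

theorem pow_le_of_pow_le {I : Ideal R} [I.IsTwoSided] {J : Submodule ℚ R} {m k : ℕ}
    (h : J ^ m ≤ I.restrictScalars ℚ) (hk : m ≤ k) : J ^ k ≤ I.restrictScalars ℚ := by
  obtain ⟨l, rfl⟩ := Nat.exists_eq_add_of_le hk
  rw [pow_add]
  exact (mul_le_mul_left h _).trans (restrictScalars_mul_le _)

/-- If `J ^ m` and `A ^ 3` lie in `I` and `A`, `J` commute, then `(J + A) ^ (m + 2)` lies in `I`. -/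
theorem sup_pow_le {I : Ideal R} [I.IsTwoSided] {J A : Submodule ℚ R} (hJA : Commute J A) {m : ℕ}
    (hJ : J ^ m ≤ I.restrictScalars ℚ) (hA : A ^ 3 ≤ I.restrictScalars ℚ) :
    (J + A) ^ (m + 2) ≤ I.restrictScalars ℚ := by
  rw [hJA.add_pow]
  refine (Finset.sum_induction _ (fun X => X ≤ I.restrictScalars ℚ) (fun _ _ => sup_le) bot_le ?_)
  intro k hk
  rw [Finset.mem_range] at hk
  rw [(Nat.cast_commute _ _).eq.symm]
  refine (mul_le_mul_right ?_ _).trans (mul_restrictScalars_le _)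
  -- In `J ^ k * A ^ (m + 2 - k)`, either `m ≤ k` or `3 ≤ m + 2 - k`.
  by_cases h : m ≤ k
  · exact (mul_le_mul_left (pow_le_of_pow_le hJ h) _).trans (restrictScalars_mul_le _)
  · exact (mul_le_mul_right (pow_le_of_pow_le hA (by omega)) _).trans (mul_restrictScalars_le _)

theorem span_mul_span_le {a b : R} (ha : ∀ t, a * t = t * a) :
    (Ideal.span {a}).restrictScalars ℚ * (Ideal.span {b}).restrictScalars ℚ ≤
      (Ideal.span {a * b}).restrictScalars ℚ := by
  refine Submodule.mul_le.mpr fun s hs t ht => ?_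
  obtain ⟨s, rfl⟩ := Ideal.mem_span_singleton'.mp hs
  obtain ⟨t, rfl⟩ := Ideal.mem_span_singleton'.mp ht
  refine Ideal.mem_span_singleton'.mpr ⟨s * t, ?_⟩
  rw [mul_assoc, mul_assoc, ← mul_assoc t, ← ha, mul_assoc]

theorem isTwoSided_span_of_comm {R : Type*} [Ring R] {a : R} (ha : ∀ t, a * t = t * a) :
    (Ideal.span {a}).IsTwoSided := by
  refine ⟨fun {s} b hs => ?_⟩
  obtain ⟨s, rfl⟩ := Ideal.mem_span_singleton'.mp hs
  exact Ideal.mem_span_singleton'.mpr ⟨s * b, by rw [mul_assoc, ← ha, mul_assoc]⟩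

theorem isTwoSided_sup {R : Type*} [Ring R] (I J : Ideal R) [I.IsTwoSided] [J.IsTwoSided] :
    (I ⊔ J).IsTwoSided := by
  refine ⟨fun {s} b hs => ?_⟩
  obtain ⟨i, hi, j, hj, rfl⟩ := Submodule.mem_sup.mp hs
  rw [add_mul]
  exact Submodule.add_mem_sup (I.mul_mem_right b hi) (J.mul_mem_right b hj)

theorem commute_span {a : R} (ha : ∀ t, a * t = t * a) (J : Ideal R) [J.IsTwoSided] :
    Commute (J.restrictScalars ℚ) ((Ideal.span {a}).restrictScalars ℚ) := by
  refine le_antisymm ?_ ?_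
  · refine Submodule.mul_le.mpr fun s hs t ht => ?_
    obtain ⟨t, rfl⟩ := Ideal.mem_span_singleton'.mp ht
    rw [← mul_assoc, ← ha]
    exact Submodule.mul_mem_mul (Ideal.subset_span rfl) (J.mul_mem_right t hs)
  · refine Submodule.mul_le.mpr fun s hs t ht => ?_
    obtain ⟨s, rfl⟩ := Ideal.mem_span_singleton'.mp hs
    rw [mul_assoc, ha, ← mul_assoc]
    exact Submodule.mul_mem_mul (J.mul_mem_left s ht) (Ideal.subset_span rfl)

/-- If `J ^ 2 ≤ I`, adjoining to `J` central elements `a i` with `a i ^ 3 ∈ I` raises the exponent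
of nilpotency modulo `I` by at most `2` for each `i`. -/
theorem sup_span_pow_le {ι : Type*} {I J : Ideal R} [I.IsTwoSided] [J.IsTwoSided]
    (hJ : J.restrictScalars ℚ ^ 2 ≤ I.restrictScalars ℚ) (a : ι → R)
    (ha : ∀ i t, a i * t = t * a i) (ha3 : ∀ i, a i ^ 3 ∈ I) (S : Finset ι) :
    ∃ L : Ideal R, L.IsTwoSided ∧ J ≤ L ∧ (∀ i ∈ S, a i ∈ L) ∧
      L.restrictScalars ℚ ^ (2 * S.card + 2) ≤ I.restrictScalars ℚ := by
  classical
  induction S using Finset.induction_on with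
  | empty => exact ⟨J, inferInstance, le_rfl, by simp, by simpa using hJ⟩
  | insert i S hi ih =>
    obtain ⟨L, hL, hJL, haL, hLI⟩ := ih
    have := isTwoSided_span_of_comm (ha i)
    refine ⟨L ⊔ Ideal.span {a i}, isTwoSided_sup _ _, hJL.trans le_sup_left, ?_, ?_⟩
    · intro k hk
      rcases Finset.mem_insert.mp hk with rfl | hk
      · exact Ideal.mem_sup_right (Ideal.subset_span rfl)
      · exact Ideal.mem_sup_left (haL k hk)
    · rw [Finset.card_insert_of_notMem hi]
      have e : (L ⊔ Ideal.span {a i}).restrictScalars ℚ =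
          L.restrictScalars ℚ + (Ideal.span {a i}).restrictScalars ℚ :=
        Submodule.restrictScalars_sup ℚ _ _
      rw [e]
      refine sup_pow_le (m := 2 * S.card + 2) (commute_span (ha i) L) hLI ?_
      rw [pow_succ', sq]
      refine (mul_le_mul_right (span_mul_span_le (ha i)) _).trans
        ((span_mul_span_le (ha i)).trans ?_)
      rw [← pow_two, ← pow_succ']
      intro t ht
      obtain ⟨t, rfl⟩ := Ideal.mem_span_singleton'.mp ht
      exact I.mul_mem_left t (ha3 i)

end Nilpotent

namespace CDGA

/-! ### The kernel of the multiplication -/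

theorem mu_inl (A : CDGA.{u}) (a : A) : A.mu.toAlgHom ((A.inl A).toAlgHom a) = a :=
  (muAlg_tm A a 1).trans (mul_one a)

theorem mu_inr (A : CDGA.{u}) (a : A) : A.mu.toAlgHom ((A.inr A).toAlgHom a) = a :=
  (muAlg_tm A 1 a).trans (one_mul a)

theorem inl_sub_inr_mem (A : CDGA.{u}) (a : A) :
    (A.inl A).toAlgHom a - (A.inr A).toAlgHom a ∈ A.kerMu := by
  rw [kerMu, RingHom.mem_ker, map_sub, mu_inl, mu_inr, sub_self]

theorem IsFreeOn.kerMu_le {A : CDGA.{u}} {I : Type*} {deg : I → ℕ} {v : I → A}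
    (h : A.IsFreeOn deg v) {L : Ideal (A.tensor A)} [L.IsTwoSided]
    (hL : ∀ i, (A.inl A).toAlgHom (v i) - (A.inr A).toAlgHom (v i) ∈ L) : A.kerMu ≤ L := by
  have h1 : ∀ a, (A.inl A).toAlgHom a - (A.inr A).toAlgHom a ∈ L := by
    intro a
    induction a using h.induction with
    | hc c => rw [AlgHom.commutes, AlgHom.commutes, sub_self]; exact zero_mem _
    | hv i => exact hL i
    | hadd a b ha hb =>
      rw [map_add, map_add, add_sub_add_comm]
      exact add_mem ha hb
    | hmul a b ha hb =>
      have e : (A.inl A).toAlgHom (a * b) - (A.inr A).toAlgHom (a * b) =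
          (A.inl A).toAlgHom a * ((A.inl A).toAlgHom b - (A.inr A).toAlgHom b) +
          ((A.inl A).toAlgHom a - (A.inr A).toAlgHom a) * (A.inr A).toAlgHom b := by
        rw [map_mul, map_mul]; noncomm_ring
      rw [e]
      exact add_mem (L.mul_mem_left _ hb) (L.mul_mem_right _ ha)
  have h2 : ∀ t, t - (A.inl A).toAlgHom (A.mu.toAlgHom t) ∈ L := by
    intro t
    induction t using tensor_hom_induction with
    | h0 => simp
    | hadd s t hs ht =>
      rw [map_add, map_add, add_sub_add_comm]
      exact add_mem hs ht
    | hh i j a _ b _ =>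
      rw [map_mul, mu_inl, mu_inr, map_mul, ← mul_sub, ← neg_sub, mul_neg]
      exact neg_mem (L.mul_mem_left _ (h1 b))
  intro t ht
  have := h2 t
  rwa [RingHom.mem_ker.mp ht, map_zero, sub_zero] at this

end CDGA

namespace CDGA

/-! ### Two cocycles in powers of an ideal -/

section Cocycles

theorem mul_mem_pow_add {R : Type*} [Ring R] {K : Ideal R} [K.IsTwoSided] {i j : ℕ} {s t : R}
    (hs : s ∈ K ^ i) (ht : t ∈ K ^ j) : s * t ∈ K ^ (i + j) := by
  rw [Ideal.IsTwoSided.pow_add]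
  exact Ideal.mul_mem_mul hs ht

/-- A family of central cocycles extends to a morphism from a polynomial ring, whose values are
central cocycles. -/
theorem exists_polyHom {R : CDGA.{u}} {σ : Type*} (c : σ → R) (hc : ∀ s b, c s * b = b * c s)
    (hd : ∀ s, R.d (c s) = 0) :
    ∃ e : MvPolynomial σ ℚ →ₐ[ℚ] R, (∀ s, e (MvPolynomial.X s) = c s) ∧
      (∀ p b, e p * b = b * e p) ∧ ∀ p, R.d (e p) = 0 := by
  let e' : MvPolynomial σ ℚ →ₐ[ℚ] Subalgebra.center ℚ R :=
    MvPolynomial.aeval fun s => ⟨c s, Subalgebra.mem_center_iff.mpr fun b => (hc s b).symm⟩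
  let e : MvPolynomial σ ℚ →ₐ[ℚ] R := (Subalgebra.center ℚ R).val.comp e'
  have he : ∀ s, e (MvPolynomial.X s) = c s := fun s => by
    change ((e' (MvPolynomial.X s) : Subalgebra.center ℚ R) : R) = c s
    rw [MvPolynomial.aeval_X]
  refine ⟨e, he, fun p b => (Subalgebra.mem_center_iff.mp (e' p).2 b).symm, fun p => ?_⟩
  induction p using MvPolynomial.induction_on with
  | C a =>
    rw [← MvPolynomial.algebraMap_eq, AlgHom.commutes, Algebra.algebraMap_eq_smul_one, map_smul,
      R.d_one, smul_zero]
  | add p q hp hq => rw [map_add, map_add, hp, hq, add_zero]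
  | mul_X p s hp => rw [map_mul, R.d_mul, hp, he, hd, zero_mul, mul_zero, add_zero]

open MvPolynomial

variable {R : CDGA.{u}} {n : ℕ}

/-- The difference `x i - x' i`. -/
noncomputable abbrev pa (i : Fin n) : MvPolynomial (Fin n ⊕ Fin n) ℚ :=
  X (Sum.inl i) - X (Sum.inr i)

/-- The sum `x i + x' i`. -/
noncomputable abbrev pb (i : Fin n) : MvPolynomial (Fin n ⊕ Fin n) ℚ :=
  X (Sum.inl i) + X (Sum.inr i)

/-- The product of the differences `x i - x' i`, for `i ∈ s`. -/
noncomputable abbrev paProd (s : Finset (Fin n)) : MvPolynomial (Fin n ⊕ Fin n) ℚ := ∏ i ∈ s, pa i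

/-- The sum over `l` of `x l + x' l` times the product of the differences `x i - x' i`, `i ≠ l`. -/
noncomputable abbrev pbSum (n : ℕ) : MvPolynomial (Fin n ⊕ Fin n) ℚ :=
  ∑ l : Fin n, pb l * paProd (Finset.univ.erase l)

theorem pa_mul_sum (i j : Fin n) :
    pa j * ∑ l ∈ Finset.univ.erase j, pa i * pb l * paProd ((Finset.univ.erase j).erase l) =
      pa i * ∑ l ∈ Finset.univ.erase j, pb l * paProd (Finset.univ.erase l) := by
  rw [Finset.mul_sum, Finset.mul_sum]
  refine Finset.sum_congr rfl fun l hl => ?_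
  have hlj : j ∈ Finset.univ.erase l :=
    Finset.mem_erase.mpr ⟨(Finset.ne_of_mem_erase hl).symm, Finset.mem_univ j⟩
  have h1 : pa j * paProd ((Finset.univ.erase l).erase j) = paProd (Finset.univ.erase l) :=
    Finset.mul_prod_erase _ _ hlj
  rw [Finset.erase_right_comm, ← h1]
  ring

/-- Elements of a cdga behaving like generators of `Λ (x, u, y) ⊗ Λ (x, u, y)`: the values of `e`
are the polynomials in `x i = x i ⊗ 1` and `x' i = 1 ⊗ x i`, while `v i`, `w i` stand for the
difference and the sum of `u i ⊗ 1` and `1 ⊗ u i`, and `ym`, `yp` for those of `y ⊗ 1` and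
`1 ⊗ y`; here `d y` is the quadratic form with coefficients `c`. -/
structure IsDoubled (e : MvPolynomial (Fin n ⊕ Fin n) ℚ →ₐ[ℚ] R) (v w : Fin n → R) (ym yp : R)
    (c : Fin n × Fin n → ℚ) (K : Ideal R) : Prop where
  comm : ∀ p b, e p * b = b * e p
  d_e : ∀ p, R.d (e p) = 0
  d_v : ∀ i, R.d (v i) = e (pa i * pb i)
  d_w : ∀ i, R.d (w i) = e (X (Sum.inl i) ^ 2 + X (Sum.inr i) ^ 2)
  d_ym : R.d ym = ∑ k, c k •
    e (X (Sum.inl k.1) * X (Sum.inl k.2) - X (Sum.inr k.1) * X (Sum.inr k.2))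
  d_yp : R.d yp = ∑ k, c k •
    e (X (Sum.inl k.1) * X (Sum.inl k.2) + X (Sum.inr k.1) * X (Sum.inr k.2))
  twoSided : K.IsTwoSided
  a_mem : ∀ i, e (pa i) ∈ K
  v_mem : ∀ i, v i ∈ K
  ym_mem : ym ∈ K

namespace IsDoubled
variable {e : MvPolynomial (Fin n ⊕ Fin n) ℚ →ₐ[ℚ] R} {v w : Fin n → R} {ym yp : R}
  {c : Fin n × Fin n → ℚ} {K : Ideal R} (h : IsDoubled e v w ym yp c K)
include h

theorem d_mul_e (s : R) (p : MvPolynomial (Fin n ⊕ Fin n) ℚ) : R.d (s * e p) = R.d s * e p := by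
  rw [R.d_mul, h.d_e, mul_zero, add_zero]

theorem prod_mem (s : Finset (Fin n)) {m : ℕ} (hs : s.card = m) : e (paProd s) ∈ K ^ m := by
  classical
  have := h.twoSided
  induction s using Finset.induction_on generalizing m with
  | empty =>
    rw [Finset.card_empty] at hs
    subst hs
    rw [Submodule.pow_zero, Ideal.one_eq_top]
    trivial
  | insert i s hi ih =>
    rw [Finset.card_insert_of_notMem hi] at hs
    subst hs
    rw [paProd, Finset.prod_insert hi, map_mul, Ideal.IsTwoSided.pow_succ]
    exact Ideal.mul_mem_mul (h.a_mem i) (ih rfl)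

/-- The correction terms making `2 (y - y') ∏ (x i - x' i)` a cocycle. -/
theorem exists_omega (I : Ideal R) (hvI : ∀ i, v i ∈ I) (i j : Fin n) :
    ∃ ω ∈ K ^ (n + 1), ω ∈ I ∧ R.d ω =
      e (2 * (X (Sum.inl i) * X (Sum.inl j) - X (Sum.inr i) * X (Sum.inr j)) *
        paProd Finset.univ) := by
  have := h.twoSided
  have hn : 1 ≤ n := i.pos
  have key : ∀ i j, v j * e (pa i * paProd (Finset.univ.erase j)) ∈ K ^ (n + 1) ∧
      v j * e (pa i * paProd (Finset.univ.erase j)) ∈ I := by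
    intro i j
    refine ⟨?_, by rw [← h.comm]; exact I.mul_mem_left _ (hvI j)⟩
    have h1 : e (pa i * paProd (Finset.univ.erase j)) ∈ K ^ n := by
      rw [map_mul]
      have := mul_mem_pow_add (by rw [Submodule.pow_one]; exact h.a_mem i : e (pa i) ∈ K ^ 1)
        (h.prod_mem (Finset.univ.erase j) rfl)
      rwa [Finset.card_erase_of_mem (Finset.mem_univ j), Finset.card_univ, Fintype.card_fin,
        add_comm, Nat.sub_add_cancel hn] at this
    rw [Ideal.IsTwoSided.pow_succ]
    exact Ideal.mul_mem_mul (h.v_mem j) h1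
  refine ⟨v j * e (pa i * paProd (Finset.univ.erase j)) +
    v i * e (pa j * paProd (Finset.univ.erase i)), add_mem (key i j).1 (key j i).1,
    add_mem (key i j).2 (key j i).2, ?_⟩
  rw [map_add, h.d_mul_e, h.d_mul_e, h.d_v, h.d_v, ← map_mul e, ← map_mul e, ← map_add e]
  refine congrArg e ?_
  have hj : pa j * paProd (Finset.univ.erase j) = paProd Finset.univ :=
    Finset.mul_prod_erase _ _ (Finset.mem_univ j)
  have hi : pa i * paProd (Finset.univ.erase i) = paProd Finset.univ :=
    Finset.mul_prod_erase _ _ (Finset.mem_univ i)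
  linear_combination (pb j * pa i) * hj + (pb i * pa j) * hi

/-- The correction terms making
`4 (y + y') ∏ (x i - x' i) + 2 (y - y') ∑ l, (x l + x' l) ∏_{i ≠ l} (x i - x' i)` a cocycle. -/
theorem exists_eta (I : Ideal R) (hvI : ∀ i, v i ∈ I) (hwI : ∀ i, w i ∈ I) (i j : Fin n) :
    ∃ η ∈ K ^ n, η ∈ I ∧ R.d η =
      e (4 * (X (Sum.inl i) * X (Sum.inl j) + X (Sum.inr i) * X (Sum.inr j)) *
        paProd Finset.univ +
        2 * (X (Sum.inl i) * X (Sum.inl j) - X (Sum.inr i) * X (Sum.inr j)) * pbSum n) := by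
  have := h.twoSided
  have hn : 1 ≤ n := i.pos
  have hcard : ∀ j : Fin n, (Finset.univ.erase j).card = n - 1 := fun j => by
    rw [Finset.card_erase_of_mem (Finset.mem_univ j), Finset.card_univ, Fintype.card_fin]
  -- One half of the correction; the other one is obtained by exchanging `i` and `j`.
  have key : ∀ i j, ∃ η ∈ K ^ n, η ∈ I ∧ R.d η =
      e ((2 * (X (Sum.inl j) ^ 2 + X (Sum.inr j) ^ 2) * pa i + pa j * pb j * pb i) *
        paProd (Finset.univ.erase j) + pa i * pb j *
          ∑ l ∈ Finset.univ.erase j, pb l * paProd (Finset.univ.erase l)) := by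
    intro i j
    refine ⟨w j * e (2 * pa i * paProd (Finset.univ.erase j)) +
      v j * e (pb i * paProd (Finset.univ.erase j) +
        ∑ l ∈ Finset.univ.erase j, pa i * pb l * paProd ((Finset.univ.erase j).erase l)),
      ?_, ?_, ?_⟩
    · refine add_mem ?_ ?_
      · refine Ideal.mul_mem_left _ _ ?_
        rw [mul_assoc, map_mul, map_mul]
        refine Ideal.mul_mem_left _ _ ?_
        have := mul_mem_pow_add (by rw [Submodule.pow_one]; exact h.a_mem i : e (pa i) ∈ K ^ 1)
          (h.prod_mem (Finset.univ.erase j) (hcard j))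
        rwa [add_comm, Nat.sub_add_cancel hn] at this
      · have h1 : e (pb i * paProd (Finset.univ.erase j) +
            ∑ l ∈ Finset.univ.erase j, pa i * pb l * paProd ((Finset.univ.erase j).erase l)) ∈
            K ^ (n - 1) := by
          rw [map_add, map_mul, map_sum]
          refine add_mem (Ideal.mul_mem_left _ _ (h.prod_mem _ (hcard j)))
            (sum_mem fun l hl => ?_)
          have hn2 : 1 ≤ n - 1 := by
            rw [← hcard j]
            exact Finset.card_pos.mpr ⟨l, hl⟩
          rw [mul_comm (pa i), mul_assoc, map_mul, map_mul]
          refine Ideal.mul_mem_left _ _ ?_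
          have := mul_mem_pow_add (by rw [Submodule.pow_one]; exact h.a_mem i : e (pa i) ∈ K ^ 1)
            (h.prod_mem ((Finset.univ.erase j).erase l) rfl)
          rwa [Finset.card_erase_of_mem hl, hcard, add_comm, Nat.sub_add_cancel hn2] at this
        have := Ideal.mul_mem_mul (h.v_mem j) h1
        rwa [← Ideal.IsTwoSided.pow_succ, Nat.sub_add_cancel hn] at this
    · refine add_mem ?_ ?_
      · rw [← h.comm]; exact I.mul_mem_left _ (hwI j)
      · rw [← h.comm]; exact I.mul_mem_left _ (hvI j)
    · rw [map_add, h.d_mul_e, h.d_mul_e, h.d_v, h.d_w, ← map_mul e, ← map_mul e, ← map_add e]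
      refine congrArg e ?_
      have hs := pa_mul_sum i j
      linear_combination pb j * hs
  obtain ⟨η₁, hK₁, hI₁, hd₁⟩ := key i j
  obtain ⟨η₂, hK₂, hI₂, hd₂⟩ := key j i
  refine ⟨η₁ + η₂, add_mem hK₁ hK₂, add_mem hI₁ hI₂, ?_⟩
  rw [map_add, hd₁, hd₂, ← map_add e]
  refine congrArg e ?_
  have hj : pa j * paProd (Finset.univ.erase j) = paProd Finset.univ :=
    Finset.mul_prod_erase _ _ (Finset.mem_univ j)
  have hi : pa i * paProd (Finset.univ.erase i) = paProd Finset.univ :=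
    Finset.mul_prod_erase _ _ (Finset.mem_univ i)
  have hSj : pb j * paProd (Finset.univ.erase j) +
      ∑ l ∈ Finset.univ.erase j, pb l * paProd (Finset.univ.erase l) = pbSum n :=
    Finset.add_sum_erase _ (fun l => pb l * paProd (Finset.univ.erase l)) (Finset.mem_univ j)
  have hSi : pb i * paProd (Finset.univ.erase i) +
      ∑ l ∈ Finset.univ.erase i, pb l * paProd (Finset.univ.erase l) = pbSum n :=
    Finset.add_sum_erase _ (fun l => pb l * paProd (Finset.univ.erase l)) (Finset.mem_univ i)
  linear_combination (pa i * pb j) * hSj + (pa j * pb i) * hSi +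
    (pa i * pa j + pb i * pb j) * hj + (pa i * pa j + pb i * pb j) * hi

/-- The cocycles `Ω ∈ K ^ (n + 1)` and `β ∈ K ^ n`, known modulo any ideal containing the `v i` and
`w i`. -/
theorem exists_cocycles (I : Ideal R) (hvI : ∀ i, v i ∈ I) (hwI : ∀ i, w i ∈ I) :
    ∃ Ω ∈ K ^ (n + 1), ∃ β ∈ K ^ n, R.d Ω = 0 ∧ R.d β = 0 ∧
      ym * e (2 * paProd Finset.univ) - Ω ∈ I ∧
      yp * e (4 * paProd Finset.univ) + ym * e (2 * pbSum n) - β ∈ I := by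
  have := h.twoSided
  choose ω hωK hωI hωd using h.exists_omega I hvI
  choose η hηK hηI hηd using h.exists_eta I hvI hwI
  have hP : e (paProd Finset.univ) ∈ K ^ n := h.prod_mem Finset.univ (by simp)
  refine ⟨ym * e (2 * paProd Finset.univ) - ∑ k, c k • ω k.1 k.2, ?_,
    yp * e (4 * paProd Finset.univ) + ym * e (2 * pbSum n) - ∑ k, c k • η k.1 k.2, ?_,
    ?_, ?_, ?_, ?_⟩
  · refine sub_mem ?_ (sum_mem fun k _ => Submodule.smul_of_tower_mem _ _ (hωK _ _))
    rw [Ideal.IsTwoSided.pow_succ]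
    refine Ideal.mul_mem_mul h.ym_mem ?_
    rw [map_mul]
    exact Ideal.mul_mem_left _ _ hP
  · refine sub_mem (add_mem ?_ ?_) (sum_mem fun k _ => Submodule.smul_of_tower_mem _ _ (hηK _ _))
    · rw [map_mul]
      exact Ideal.mul_mem_left _ _ (Ideal.mul_mem_left _ _ hP)
    · rw [mul_comm 2, map_mul, pbSum, map_sum, Finset.sum_mul, Finset.mul_sum]
      refine sum_mem fun l _ => ?_
      have hn : 1 ≤ n := l.pos
      have h1 : e (pb l * paProd (Finset.univ.erase l)) ∈ K ^ (n - 1) := by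
        rw [map_mul]
        refine Ideal.mul_mem_left _ _ (h.prod_mem _ ?_)
        rw [Finset.card_erase_of_mem (Finset.mem_univ l), Finset.card_univ, Fintype.card_fin]
      have := Ideal.mul_mem_mul h.ym_mem h1
      rw [← Ideal.IsTwoSided.pow_succ, Nat.sub_add_cancel hn] at this
      rw [← mul_assoc]
      exact Ideal.mul_mem_right _ _ this
  · rw [map_sub, h.d_mul_e, h.d_ym, map_sum, Finset.sum_mul, ← Finset.sum_sub_distrib]
    refine Finset.sum_eq_zero fun k _ => ?_
    rw [map_smul, hωd, smul_mul_assoc, ← map_mul, ← smul_sub, ← map_sub]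
    have : ∀ s t : MvPolynomial (Fin n ⊕ Fin n) ℚ, s * (2 * t) - 2 * s * t = 0 :=
      fun s t => by ring
    rw [this, map_zero, smul_zero]
  · rw [map_sub, map_add, h.d_mul_e, h.d_mul_e, h.d_ym, h.d_yp, map_sum, Finset.sum_mul,
      Finset.sum_mul, ← Finset.sum_add_distrib, ← Finset.sum_sub_distrib]
    refine Finset.sum_eq_zero fun k _ => ?_
    rw [map_smul, hηd, smul_mul_assoc, smul_mul_assoc, ← map_mul, ← map_mul, ← smul_add,
      ← smul_sub, ← map_add, ← map_sub]
    have : ∀ s t P S : MvPolynomial (Fin n ⊕ Fin n) ℚ,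
      s * (4 * P) + t * (2 * S) - (4 * s * P + 2 * t * S) = 0 := fun s t P S => by ring
    rw [this, map_zero, smul_zero]
  · rw [sub_sub_cancel]
    exact sum_mem fun k _ => Submodule.smul_of_tower_mem _ _ (hωI _ _)
  · rw [sub_sub_cancel]
    exact sum_mem fun k _ => Submodule.smul_of_tower_mem _ _ (hηI _ _)

end IsDoubled
end Cocycles
end CDGA

namespace CDGA

/-! ### The truncated model of `A ⊗ A` -/

section Truncated

/-- The polynomial ring on `σ` modulo the squares of the variables. -/
abbrev Truncated (σ : Type*) : Type _ :=
  MvPolynomial σ ℚ ⧸ Ideal.span (Set.range fun s : σ => (MvPolynomial.X s ^ 2 : MvPolynomial σ ℚ))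

theorem truncated_sq {σ : Type*} (s : σ) :
    (Ideal.Quotient.mk _ (MvPolynomial.X s) : Truncated σ) ^ 2 = 0 := by
  rw [← map_pow]
  exact Ideal.Quotient.eq_zero_iff_mem.mpr (Ideal.subset_span ⟨s, rfl⟩)

theorem truncated_prod_ne_zero {σ : Type*} [Fintype σ] :
    (Ideal.Quotient.mk _ (∏ s, MvPolynomial.X s) : Truncated σ) ≠ 0 := by
  classical
  rw [Ne, Ideal.Quotient.eq_zero_iff_mem]
  have h1 : (Set.range fun s : σ => (MvPolynomial.X s ^ 2 : MvPolynomial σ ℚ)) =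
      (fun m => MvPolynomial.monomial m (1 : ℚ)) '' Set.range fun s : σ => Finsupp.single s 2 := by
    rw [← Set.range_comp]
    congr 1
    funext s
    exact MvPolynomial.X_pow_eq_monomial
  have h2 : (∏ s, MvPolynomial.X s : MvPolynomial σ ℚ) =
      MvPolynomial.monomial (∑ s, Finsupp.single s 1) 1 := by
    rw [MvPolynomial.monomial_sum_one]
    rfl
  rw [h1, h2, MvPolynomial.mem_ideal_span_monomial_image]
  intro h
  obtain ⟨_, ⟨s, rfl⟩, hs⟩ := h (∑ s, Finsupp.single s 1) (by simp [MvPolynomial.mem_support_iff])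
  have := hs s
  simp [Finsupp.finsetSum_apply, Finsupp.single_apply] at this

open Matrix

variable {Λ : Type*} [CommRing Λ]

/-- A matrix of square zero, by which `y ⊗ 1` acts on the exterior algebra on `y ⊗ 1`, `1 ⊗ y`. -/
def matY (Λ : Type*) [CommRing Λ] : Matrix (Fin 4) (Fin 4) Λ :=
  !![0, 0, 1, 0; 0, 0, 0, 1; 0, 0, 0, 0; 0, 0, 0, 0]

/-- A matrix of square zero, by which `1 ⊗ y` acts on the exterior algebra on `y ⊗ 1`, `1 ⊗ y`. -/
def matY' (Λ : Type*) [CommRing Λ] : Matrix (Fin 4) (Fin 4) Λ :=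
  !![0, 1, 0, 0; 0, 0, 0, 0; 0, 0, 0, -1; 0, 0, 0, 0]

/-- The contraction with the linear form `y ⊗ 1 ↦ a`, `1 ⊗ y ↦ b`. -/
def matContr (a b : Λ) : Matrix (Fin 4) (Fin 4) Λ :=
  !![0, 0, 0, 0; b, 0, 0, 0; a, 0, 0, 0; 0, a, -b, 0]

theorem matY_sq : matY Λ * matY Λ = 0 := by
  ext i j; fin_cases i <;> fin_cases j <;> simp [matY, Matrix.mul_apply, Fin.sum_univ_four]

theorem matY'_sq : matY' Λ * matY' Λ = 0 := by
  ext i j; fin_cases i <;> fin_cases j <;> simp [matY', Matrix.mul_apply, Fin.sum_univ_four]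

theorem matY_mul_matY' : matY Λ * matY' Λ = - (matY' Λ * matY Λ) := by
  ext i j; fin_cases i <;> fin_cases j <;> simp [matY, matY', Matrix.mul_apply, Fin.sum_univ_four]

theorem matContr_matY (a b : Λ) :
    matContr a b * matY Λ + matY Λ * matContr a b = algebraMap Λ _ a := by
  ext i j; fin_cases i <;> fin_cases j <;>
    simp [matY, matContr, Matrix.algebraMap_matrix_apply]

theorem matContr_matY' (a b : Λ) :
    matContr a b * matY' Λ + matY' Λ * matContr a b = algebraMap Λ _ b := by
  ext i j; fin_cases i <;> fin_cases j <;>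
    simp [matY', matContr, Matrix.algebraMap_matrix_apply]

theorem commutator_apply_zero_three (a b : Λ) (M N : Matrix (Fin 4) (Fin 4) Λ) :
    (matContr a b * M - N * matContr a b) 0 3 = 0 := by
  rw [Matrix.sub_apply, Matrix.mul_apply, Matrix.mul_apply, Fin.sum_univ_four, Fin.sum_univ_four]
  simp [matContr]

end Truncated

namespace IsEllipticExtension
variable {A : CDGA.{u}} {n : ℕ} {p q : Fin n → ℕ} {r : ℕ} {x u : Fin n → A} {y : A}

/-- The degrees of the generators `x i`, `u i`, `y`. -/
abbrev degs (p q : Fin n → ℕ) (r : ℕ) : Fin n ⊕ Fin n ⊕ Unit → ℕ :=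
  Sum.elim p (Sum.elim q fun _ : Unit => r)

/-- The generators `x i`, `u i`, `y`. -/
abbrev gens (x u : Fin n → A) (y : A) : Fin n ⊕ Fin n ⊕ Unit → A :=
  Sum.elim x (Sum.elim u fun _ : Unit => y)

/-- The generators of `A ⊗ A`. -/
noncomputable abbrev gens2 (x u : Fin n → A) (y : A) :
    (Fin n ⊕ Fin n ⊕ Unit) ⊕ (Fin n ⊕ Fin n ⊕ Unit) → A.tensor A :=
  Sum.elim (fun i => (A.inl A).toAlgHom (gens x u y i)) (fun i => (A.inr A).toAlgHom (gens x u y i))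

/-- The indices of `x i ⊗ 1` and `1 ⊗ x i`. -/
abbrev idxX (n : ℕ) : Fin n ⊕ Fin n → (Fin n ⊕ Fin n ⊕ Unit) ⊕ (Fin n ⊕ Fin n ⊕ Unit) :=
  Sum.map Sum.inl Sum.inl

/-- The indices of `u i ⊗ 1` and `1 ⊗ u i`. -/
abbrev idxU (n : ℕ) : Fin n ⊕ Fin n → (Fin n ⊕ Fin n ⊕ Unit) ⊕ (Fin n ⊕ Fin n ⊕ Unit) :=
  Sum.map (Sum.inr ∘ Sum.inl) (Sum.inr ∘ Sum.inl)

variable (h : A.IsEllipticExtension p q r x u y)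
include h

theorem free2 : (A.tensor A).IsFreeOn (Sum.elim (degs p q r) (degs p q r)) (gens2 x u y) :=
  h.free.tensor h.free

theorem pairs : IsKillingPairs (A.tensor A) (Sum.elim (degs p q r) (degs p q r)) (gens2 x u y)
    (idxX n) (idxU n) where
  free := h.free2
  even := by rintro (i | i) <;> exact h.even_x i
  odd := by rintro (i | i) <;> exact h.odd_u i
  injective_X := Sum.map_injective.mpr ⟨Sum.inl_injective, Sum.inl_injective⟩
  injective_U := Sum.map_injective.mpr ⟨Sum.inr_injective.comp Sum.inl_injective,
    Sum.inr_injective.comp Sum.inl_injective⟩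
  d_X := by
    rintro (i | i)
    · exact ((A.inl A).map_d (x i)).symm.trans (by rw [h.d_x, map_zero])
    · exact ((A.inr A).map_d (x i)).symm.trans (by rw [h.d_x, map_zero])
  d_U := by
    rintro (i | i)
    · exact ((A.inl A).map_d (u i)).symm.trans (by rw [h.d_u, map_pow]; rfl)
    · exact ((A.inr A).map_d (u i)).symm.trans (by rw [h.d_u, map_pow]; rfl)

theorem exists_coeff : ∃ c : Fin n × Fin n → ℚ, A.d y = ∑ k, c k • (x k.1 * x k.2) := by
  obtain ⟨c, hc⟩ := (Submodule.mem_span_range_iff_exists_fun ℚ).mp h.d_y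
  exact ⟨c, hc.symm⟩

open MvPolynomial in
/-- The tensor square of `A` has the structure from which the cocycles `Ω` and `β` are built, with
`e` the evaluation of polynomials at the `x i ⊗ 1` and `1 ⊗ x i`. -/
theorem exists_doubled (c : Fin n × Fin n → ℚ) (hc : A.d y = ∑ k, c k • (x k.1 * x k.2)) :
    ∃ e : MvPolynomial (Fin n ⊕ Fin n) ℚ →ₐ[ℚ] A.tensor A,
      (∀ s, e (X s) = gens2 x u y (idxX n s)) ∧
      IsDoubled e (fun i => (A.inl A).toAlgHom (u i) - (A.inr A).toAlgHom (u i))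
        (fun i => (A.inl A).toAlgHom (u i) + (A.inr A).toAlgHom (u i))
        ((A.inl A).toAlgHom y - (A.inr A).toAlgHom y)
        ((A.inl A).toAlgHom y + (A.inr A).toAlgHom y) c A.kerMu := by
  obtain ⟨e, he, hcomm, hd⟩ := exists_polyHom (fun s => gens2 x u y (idxX n s)) h.pairs.x_comm
    h.pairs.d_X
  have hl : ∀ i, e (X (Sum.inl i)) = (A.inl A).toAlgHom (x i) := fun i => he (Sum.inl i)
  have hr : ∀ i, e (X (Sum.inr i)) = (A.inr A).toAlgHom (x i) := fun i => he (Sum.inr i)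
  refine ⟨e, he, hcomm, hd, ?_, ?_, ?_, ?_, inferInstance, ?_, fun i => A.inl_sub_inr_mem _,
    A.inl_sub_inr_mem _⟩
  · intro i
    have e1 : (pa i * pb i : MvPolynomial (Fin n ⊕ Fin n) ℚ) =
      X (Sum.inl i) ^ 2 - X (Sum.inr i) ^ 2 := by ring
    rw [map_sub, ← Hom.map_d, ← Hom.map_d, h.d_u, e1, map_sub, map_pow e, map_pow e, hl, hr,
      map_pow, map_pow]
  · intro i
    rw [map_add, ← Hom.map_d, ← Hom.map_d, h.d_u, map_add, map_pow e, map_pow e, hl, hr,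
      map_pow, map_pow]
  · rw [map_sub, ← Hom.map_d, ← Hom.map_d, hc, map_sum, map_sum, ← Finset.sum_sub_distrib]
    refine Finset.sum_congr rfl fun k _ => ?_
    rw [map_smul, map_smul, ← smul_sub, map_sub e, map_mul e, map_mul e, hl, hl, hr, hr, map_mul,
      map_mul]
  · rw [map_add, ← Hom.map_d, ← Hom.map_d, hc, map_sum, map_sum, ← Finset.sum_add_distrib]
    refine Finset.sum_congr rfl fun k _ => ?_
    rw [map_smul, map_smul, ← smul_add, map_add e, map_mul e, map_mul e, hl, hl, hr, hr, map_mul,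
      map_mul]
  · intro i
    rw [map_sub, hl, hr]
    exact A.inl_sub_inr_mem _

/-- Sending the `u i` to `0` and the `x i` to elements of square zero maps `A ⊗ A` to an exterior
algebra on `y ⊗ 1`, `1 ⊗ y`, here realized by matrices; coboundaries have no component along
the product of `y ⊗ 1` and `1 ⊗ y`, because the differential becomes a contraction. -/
theorem exists_detecting {Λ : Type*} [CommRing Λ] [Algebra ℚ Λ] (ξ : Fin n ⊕ Fin n → Λ)
    (hξ : ∀ s, ξ s ^ 2 = 0) (c : Fin n × Fin n → ℚ)
    (hc : A.d y = ∑ k, c k • (x k.1 * x k.2)) :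
    ∃ Φ : A.tensor A →ₐ[ℚ] Matrix (Fin 4) (Fin 4) Λ,
      (∀ s, Φ (gens2 x u y (idxX n s)) = algebraMap Λ _ (ξ s)) ∧
      (∀ s, Φ (gens2 x u y (idxU n s)) = 0) ∧
      Φ ((A.inl A).toAlgHom y) = matY _ ∧ Φ ((A.inr A).toAlgHom y) = matY' _ ∧
      ∀ t, Φ ((A.tensor A).d t) 0 3 = 0 := by
  let w : (Fin n ⊕ Fin n ⊕ Unit) ⊕ (Fin n ⊕ Fin n ⊕ Unit) → Matrix (Fin 4) (Fin 4) Λ :=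
    Sum.elim
      (Sum.elim (fun i => algebraMap Λ _ (ξ (Sum.inl i))) (Sum.elim (fun _ => 0) fun _ => matY Λ))
      (Sum.elim (fun i => algebraMap Λ _ (ξ (Sum.inr i))) (Sum.elim (fun _ => 0) fun _ => matY' Λ))
  have hw : ∀ i j, w i * w j = (-1 : ℚ) ^ (Sum.elim (degs p q r) (degs p q r) i *
      Sum.elim (degs p q r) (degs p q r) j) • (w j * w i) := by
    have e1 : ∀ i m, (-1 : ℚ) ^ (p i * m) = 1 := fun i m => ((h.even_x i).mul_right m).neg_one_pow
    have e2 : ∀ i m, (-1 : ℚ) ^ (m * p i) = 1 := fun i m => ((h.even_x i).mul_left m).neg_one_pow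
    have e3 : (-1 : ℚ) ^ (r * r) = -1 := (h.odd_y.mul h.odd_y).neg_one_pow
    have e4 : ∀ (a : Λ) (M : Matrix (Fin 4) (Fin 4) Λ),
        algebraMap Λ _ a * M = M * algebraMap Λ _ a := fun a M => Algebra.commutes a M
    rintro ((i | i | i) | (i | i | i)) ((j | j | j) | (j | j | j)) <;>
      simp only [w, Sum.elim_inl, Sum.elim_inr, e1, e2, e3, one_smul, zero_mul, mul_zero, smul_zero,
        matY_sq, matY'_sq, matY_mul_matY', neg_smul]
    all_goals first | rw [e4] | rw [neg_neg]
  let Φ : A.tensor A →ₐ[ℚ] Matrix (Fin 4) (Fin 4) Λ := h.free2.lift w hw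
  have hΦ : ∀ k, Φ (gens2 x u y k) = w k := fun k => h.free2.lift_gen _ _ k
  refine ⟨Φ, ?_, ?_, hΦ (Sum.inl (Sum.inr (Sum.inr ()))), hΦ (Sum.inr (Sum.inr (Sum.inr ()))), ?_⟩
  · rintro (i | i) <;> exact hΦ _
  · rintro (i | i) <;> exact hΦ _
  let Θ : Matrix (Fin 4) (Fin 4) Λ :=
    matContr (∑ k, c k • (ξ (Sum.inl k.1) * ξ (Sum.inl k.2)))
      (∑ k, c k • (ξ (Sum.inr k.1) * ξ (Sum.inr k.2)))
  have hx : ∀ s, Φ (gens2 x u y (idxX n s)) = algebraMap Λ _ (ξ s) := by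
    rintro (i | i) <;> exact hΦ _
  have hsmul : ∀ (a : ℚ) (b : Λ), algebraMap Λ (Matrix (Fin 4) (Fin 4) Λ) (a • b) =
      a • algebraMap Λ (Matrix (Fin 4) (Fin 4) Λ) b := by
    intro a b
    rw [Algebra.algebraMap_eq_smul_one, Algebra.algebraMap_eq_smul_one, smul_assoc]
  have key : ∀ t, Φ ((A.tensor A).d t) = Θ * Φ t - Φ ((A.tensor A).sgn t) * Θ := by
    intro t
    induction t using h.free2.induction with
    | hc a =>
      rw [Algebra.algebraMap_eq_smul_one, map_smul, map_smul, map_smul, map_smul, map_smul,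
        (A.tensor A).d_one, (A.tensor A).sgn_one, map_one]
      simp
    | hadd s t hs ht =>
      simp only [map_add, hs, ht, mul_add, add_mul]
      abel
    | hmul s t hs ht =>
      rw [(A.tensor A).d_mul, (A.tensor A).sgn_mul, map_add, map_mul, map_mul, map_mul, map_mul,
        hs, ht]
      noncomm_ring
    | hv k =>
      have cX : ∀ s, Φ ((A.tensor A).d (gens2 x u y (idxX n s))) =
          Θ * Φ (gens2 x u y (idxX n s)) -
            Φ ((A.tensor A).sgn (gens2 x u y (idxX n s))) * Θ := by
        intro s
        rw [h.pairs.d_X, map_zero, (A.tensor A).sgn_of_mem (h.free2.mem _),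
          (h.pairs.even s).neg_one_pow, one_smul, hx, ← Algebra.commutes, sub_self]
      have cU : ∀ s, Φ ((A.tensor A).d (gens2 x u y (idxU n s))) =
          Θ * Φ (gens2 x u y (idxU n s)) -
            Φ ((A.tensor A).sgn (gens2 x u y (idxU n s))) * Θ := by
        intro s
        have h0 : Φ (gens2 x u y (idxU n s)) = 0 := by
          rcases s with i | i <;> exact hΦ _
        rw [h.pairs.d_U, map_pow, hx, ← map_pow, hξ, map_zero, h.pairs.sgn_u, map_neg, h0,
          neg_zero, mul_zero, zero_mul, sub_zero]
      rcases k with (i | i | i) | (i | i | i)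
      · exact cX (Sum.inl i)
      · exact cU (Sum.inl i)
      · rw [(A.tensor A).sgn_of_mem (h.free2.mem _)]
        change Φ ((A.tensor A).d ((A.inl A).toAlgHom y)) = _ - Φ ((-1 : ℚ) ^ r • _) * Θ
        rw [h.odd_y.neg_one_pow, neg_smul, one_smul, map_neg, neg_mul, sub_neg_eq_add, hΦ]
        refine Eq.trans ?_ (matContr_matY _ _).symm
        rw [← Hom.map_d, hc, map_sum, map_sum, map_sum]
        refine Finset.sum_congr rfl fun k _ => ?_
        rw [map_smul, map_smul, map_mul, map_mul, hsmul, map_mul]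
        exact congrArg₂ (fun s t => c k • (s * t)) (hx (Sum.inl k.1)) (hx (Sum.inl k.2))
      · exact cX (Sum.inr i)
      · exact cU (Sum.inr i)
      · rw [(A.tensor A).sgn_of_mem (h.free2.mem _)]
        change Φ ((A.tensor A).d ((A.inr A).toAlgHom y)) = _ - Φ ((-1 : ℚ) ^ r • _) * Θ
        rw [h.odd_y.neg_one_pow, neg_smul, one_smul, map_neg, neg_mul, sub_neg_eq_add, hΦ]
        refine Eq.trans ?_ (matContr_matY' _ _).symm
        rw [← Hom.map_d, hc, map_sum, map_sum, map_sum]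
        refine Finset.sum_congr rfl fun k _ => ?_
        rw [map_smul, map_smul, map_mul, map_mul, hsmul, map_mul]
        exact congrArg₂ (fun s t => c k • (s * t)) (hx (Sum.inr k.1)) (hx (Sum.inr k.2))
  intro t
  rw [key]
  exact commutator_apply_zero_three _ _ _ _

end IsEllipticExtension
end CDGA

namespace CDGA

/-! ### The generators, the classes `Ω` and `β`, and the powers of the kernel -/

/-- The generators of a free cdga are linearly independent: the morphism to the square-zero
extension of `ℚ` by the space with basis `I` separates them. -/
theorem IsFreeOn.linearIndependent {A : CDGA.{u}} {I : Type*} {deg : I → ℕ} {v : I → A}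
    (h : A.IsFreeOn deg v) : LinearIndependent ℚ v := by
  classical
  let Φ : A →ₐ[ℚ] TrivSqZeroExt ℚ (I →₀ ℚ) :=
    h.lift (fun i => TrivSqZeroExt.inr (Finsupp.single i 1)) (fun i j => by simp)
  have hΦ : ∀ i, Φ (v i) = TrivSqZeroExt.inr (Finsupp.single i 1) := h.lift_gen _ _
  let f : A →ₗ[ℚ] I →₀ ℚ := (TrivSqZeroExt.sndHom ℚ (I →₀ ℚ)).comp Φ.toLinearMap
  refine LinearIndependent.of_comp f ?_
  have : f ∘ v = fun i => Finsupp.single i (1 : ℚ) := by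
    funext i
    exact congrArg TrivSqZeroExt.snd (hΦ i)
  rw [this]
  exact Finsupp.linearIndependent_single_one ℚ I

/-- The value of `Ω β` in the truncated model: the product of `matY` and `matY'` is minus the matrix
unit with indices `0` and `3`. -/
theorem matY_product_entry {R : Type*} [CommRing R] (a b s : R) :
    ((matY R - matY' R) * algebraMap R (Matrix (Fin 4) (Fin 4) R) a *
      ((matY R + matY' R) * algebraMap R (Matrix (Fin 4) (Fin 4) R) b + (matY R - matY' R) *
        algebraMap R (Matrix (Fin 4) (Fin 4) R) s)) 0 3 =
      -(a * b * 2) := by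
  simp only [Algebra.algebraMap_eq_smul_one, mul_smul_comm, mul_one, smul_mul_assoc, mul_add,
    smul_add, Matrix.add_apply, Matrix.smul_apply]
  simp [matY, matY', Matrix.mul_apply, Fin.sum_univ_four]
  ring

namespace IsEllipticExtension
variable {A : CDGA.{u}} {n : ℕ} {p q : Fin n → ℕ} {r : ℕ} {x u : Fin n → A} {y : A}
  (h : A.IsEllipticExtension p q r x u y)
include h

theorem finrank_eq :
    Module.finrank ℚ (Submodule.span ℚ (Set.range x ∪ Set.range u ∪ {y})) = 2 * n + 1 := by
  have e : Set.range x ∪ Set.range u ∪ {y} = Set.range (gens x u y) := by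
    rw [Set.Sum.elim_range, Set.Sum.elim_range, Set.range_const, Set.union_assoc]
  rw [e, finrank_span_eq_card h.free.linearIndependent]
  simp
  ring

/-- The product of the cocycles `Ω` and `β` is not a coboundary: in the truncated model it is a
non-zero multiple of the product of `y ⊗ 1`, `1 ⊗ y` and of all `x i ⊗ 1`, `1 ⊗ x i`. -/
theorem exists_classes : ∃ Ω ∈ A.kerMu ^ (n + 1), ∃ β ∈ A.kerMu ^ n,
      (A.tensor A).d Ω = 0 ∧ (A.tensor A).d β = 0 ∧ Ω * β ∈ A.kerMu ^ (2 * n + 1) ∧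
      Ω * β ∉ LinearMap.range (A.tensor A).d := by
  obtain ⟨c, hc⟩ := h.exists_coeff
  obtain ⟨e, he, hdbl⟩ := h.exists_doubled c hc
  obtain ⟨Φ, hΦX, hΦU, hΦY, hΦY', hΦd⟩ := h.exists_detecting
    (fun s => (Ideal.Quotient.mk _ (MvPolynomial.X s) : Truncated (Fin n ⊕ Fin n)))
    truncated_sq c hc
  have hul : ∀ i, Φ ((A.inl A).toAlgHom (u i)) = 0 := fun i => hΦU (Sum.inl i)
  have hur : ∀ i, Φ ((A.inr A).toAlgHom (u i)) = 0 := fun i => hΦU (Sum.inr i)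
  obtain ⟨Ω, hΩ, β, hβ, hdΩ, hdβ, hΩΦ, hβΦ⟩ := hdbl.exists_cocycles (RingHom.ker Φ)
    (fun i => by rw [RingHom.mem_ker, map_sub, hul, hur, sub_zero])
    (fun i => by rw [RingHom.mem_ker, map_add, hul, hur, add_zero])
  refine ⟨Ω, hΩ, β, hβ, hdΩ, hdβ, ?_, ?_⟩
  · have := mul_mem_pow_add hΩ hβ
    rwa [show n + 1 + n = 2 * n + 1 by ring] at this
  rintro ⟨t, ht⟩
  have hΦe : ∀ P, Φ (e P) = algebraMap (Truncated (Fin n ⊕ Fin n)) _ (Ideal.Quotient.mk _ P) := by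
    let g : MvPolynomial (Fin n ⊕ Fin n) ℚ →ₐ[ℚ]
        Matrix (Fin 4) (Fin 4) (Truncated (Fin n ⊕ Fin n)) :=
      (IsScalarTower.toAlgHom ℚ (Truncated (Fin n ⊕ Fin n)) _).comp (Ideal.Quotient.mkₐ ℚ _)
    have : Φ.comp e = g := MvPolynomial.algHom_ext fun s => by
      rw [AlgHom.comp_apply, he, hΦX]
      rfl
    exact AlgHom.congr_fun this
  rw [RingHom.mem_ker, map_sub, sub_eq_zero] at hΩΦ hβΦ
  have h0 := hΦd t
  let R := Truncated (Fin n ⊕ Fin n)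
  set P2 : Truncated (Fin n ⊕ Fin n) := Ideal.Quotient.mk _ (2 * paProd Finset.univ) with hP
  set P4 : Truncated (Fin n ⊕ Fin n) := Ideal.Quotient.mk _ (4 * paProd Finset.univ) with hP'
  set S : Truncated (Fin n ⊕ Fin n) := Ideal.Quotient.mk _ (2 * pbSum n) with hS
  have hΩβ : Φ (Ω * β) = (matY R - matY' R) * algebraMap R _ P2 *
      ((matY R + matY' R) * algebraMap R _ P4 + (matY R - matY' R) * algebraMap R _ S) := by
    rw [map_mul Φ, ← hΩΦ, ← hβΦ, map_mul Φ, map_add Φ, map_mul Φ, map_mul Φ, map_sub Φ, map_add Φ,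
      hΦe, hΦe, hΦe, hΦY, hΦY']
  -- `P2 * P4 * 2` is `16 * ∏ (x i - x' i) ^ 2`, and `(x i - x' i) ^ 2 = -2 * x i * x' i` in the
  -- truncated ring.
  have h1 : P2 * P4 * 2 = 0 := by
    rw [ht, hΩβ, matY_product_entry] at h0
    linear_combination -h0
  have h2 : (Ideal.Quotient.mk _ (MvPolynomial.C (16 * (-2) ^ n) * ∏ s, MvPolynomial.X s) :
      Truncated (Fin n ⊕ Fin n)) = P2 * P4 * 2 := by
    have hsq : ∀ i : Fin n, (Ideal.Quotient.mk _ (pa i) : Truncated (Fin n ⊕ Fin n)) ^ 2 =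
        -2 * (Ideal.Quotient.mk _ (MvPolynomial.X (Sum.inl i)) *
          Ideal.Quotient.mk _ (MvPolynomial.X (Sum.inr i))) := by
      intro i
      rw [map_sub]
      linear_combination truncated_sq (Sum.inl i) + truncated_sq (Sum.inr i)
    have e1 : P2 * P4 * 2 =
        16 * ∏ i : Fin n, (Ideal.Quotient.mk _ (pa i) : Truncated (Fin n ⊕ Fin n)) ^ 2 := by
      rw [hP, hP', map_mul, map_mul, Finset.prod_pow, ← map_prod]
      simp only [map_ofNat]
      ring
    rw [e1, Finset.prod_congr rfl fun i _ => hsq i, Finset.prod_mul_distrib, Finset.prod_const,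
      Finset.card_univ, Fintype.card_fin, Finset.prod_mul_distrib, ← map_prod, ← map_prod, ← map_mul,
      ← Fintype.prod_sum_type, map_mul, MvPolynomial.C_mul, MvPolynomial.C_pow, map_mul, map_pow,
      MvPolynomial.C_neg, map_neg]
    simp only [map_ofNat]
    ring
  rw [h1] at h2
  apply truncated_prod_ne_zero (σ := Fin n ⊕ Fin n)
  have hne : (16 * (-2) ^ n : ℚ) ≠ 0 := mul_ne_zero (by norm_num) (pow_ne_zero _ (by norm_num))
  rw [Ideal.Quotient.eq_zero_iff_mem] at h2 ⊢
  have := Ideal.mul_mem_left _ (MvPolynomial.C (16 * (-2) ^ n : ℚ)⁻¹) h2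
  rwa [← mul_assoc, ← MvPolynomial.C_mul, inv_mul_cancel₀ hne, MvPolynomial.C_1, one_mul] at this

/-- The `(2 n + 2)`-nd power of the kernel of the multiplication lies in the ideal generated by the
`u i` and `x i ^ 2`: modulo the latter, each difference `x i ⊗ 1 - 1 ⊗ x i` has cube zero, and
`y ⊗ 1 - 1 ⊗ y` has square zero. -/
theorem kerMu_pow_le :
    A.kerMu ^ (2 * n + 2) ≤ pairIdeal (gens2 x u y) (idxX n) (idxU n) Set.univ := by
  set I := pairIdeal (gens2 x u y) (idxX n) (idxU n) Set.univ with hI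
  have hIdg : (A.tensor A).IsDGIdeal I := h.pairs.isDGIdeal Set.univ
  have := hIdg.twoSided
  obtain ⟨e, he, hcomm, -⟩ := exists_polyHom (fun s => gens2 x u y (idxX n s)) h.pairs.x_comm
    h.pairs.d_X
  set ym : A.tensor A := (A.inl A).toAlgHom y - (A.inr A).toAlgHom y with hym
  have hymem : ym ∈ (A.tensor A).gr r :=
    sub_mem ((A.inl A).map_gr (h.free.mem (Sum.inr (Sum.inr ()))))
      ((A.inr A).map_gr (h.free.mem (Sum.inr (Sum.inr ()))))
  have hyc : ∀ b, ym * b = (A.tensor A).sgn b * ym := (A.tensor A).odd_comm h.odd_y hymem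
  have hy2 : ym * ym = 0 := (A.tensor A).odd_sq h.odd_y hymem
  have hYt : (Ideal.span {ym}).IsTwoSided := by
    refine ⟨fun {s} b hs => ?_⟩
    obtain ⟨s, rfl⟩ := Ideal.mem_span_singleton'.mp hs
    exact Ideal.mem_span_singleton'.mpr ⟨s * (A.tensor A).sgn b, by rw [mul_assoc, mul_assoc, hyc]⟩
  have hJt := isTwoSided_sup I (Ideal.span {ym})
  have hJ : (I ⊔ Ideal.span {ym}).restrictScalars ℚ ^ 2 ≤ I.restrictScalars ℚ := by
    rw [sq]
    refine Submodule.mul_le.mpr fun s₀ hs₀ t₀ ht₀ => ?_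
    obtain ⟨s, hs, s', hs', rfl⟩ := Submodule.mem_sup.mp hs₀
    obtain ⟨t, ht, t', ht', rfl⟩ := Submodule.mem_sup.mp ht₀
    obtain ⟨s', rfl⟩ := Ideal.mem_span_singleton'.mp hs'
    obtain ⟨t', rfl⟩ := Ideal.mem_span_singleton'.mp ht'
    have e1 : s' * ym * (t' * ym) = 0 := by
      rw [mul_assoc, ← mul_assoc ym, hyc, mul_assoc _ ym, hy2, mul_zero, mul_zero]
    rw [add_mul, mul_add (s' * ym), e1, add_zero]
    exact add_mem (I.mul_mem_right _ hs) (I.mul_mem_left _ ht)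
  have ha3 : ∀ i : Fin n, e (pa i) ^ 3 ∈ I := by
    intro i
    have e1 : (pa i : MvPolynomial (Fin n ⊕ Fin n) ℚ) ^ 3 =
        (MvPolynomial.X (Sum.inl i) - 3 * MvPolynomial.X (Sum.inr i)) *
          MvPolynomial.X (Sum.inl i) ^ 2 +
        (3 * MvPolynomial.X (Sum.inl i) - MvPolynomial.X (Sum.inr i)) *
          MvPolynomial.X (Sum.inr i) ^ 2 := by ring
    rw [← map_pow, e1, map_add, map_mul, map_mul, map_pow, map_pow, he, he]
    exact add_mem (I.mul_mem_left _ (sq_mem_pairIdeal (Set.mem_univ _)))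
      (I.mul_mem_left _ (sq_mem_pairIdeal (Set.mem_univ _)))
  obtain ⟨L, hLt, hJL, haL, hLI⟩ := sup_span_pow_le hJ (fun i : Fin n => e (pa i))
    (fun i t => hcomm _ t) ha3 Finset.univ
  rw [Finset.card_univ, Fintype.card_fin] at hLI
  have hKL : A.kerMu ≤ L := by
    refine h.free.kerMu_le fun k => ?_
    rcases k with i | i | i
    · have := haL i (Finset.mem_univ i)
      rw [map_sub, he, he] at this
      exact this
    · refine hJL (Ideal.mem_sup_left (sub_mem ?_ ?_))
      · exact u_mem_pairIdeal (X := idxX n) (U := idxU n) (v := gens2 x u y)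
          (Set.mem_univ (Sum.inl i))
      · exact u_mem_pairIdeal (X := idxX n) (U := idxU n) (v := gens2 x u y)
          (Set.mem_univ (Sum.inr i))
    · exact hJL (Ideal.mem_sup_right (Ideal.subset_span rfl))
  exact (Ideal.pow_right_mono hKL _).trans ((restrictScalars_pow_le (2 * n + 1)).trans hLI)

end IsEllipticExtension
end CDGA

namespace CDGA

/-! ### Homogeneous components -/

/-- The homogeneous component of degree `n`. -/
noncomputable def comp (A : CDGA.{u}) (n : ℕ) : A →ₗ[ℚ] A := GradedAlgebra.proj A.gr n

theorem comp_mem (A : CDGA.{u}) (n : ℕ) (a : A) : A.comp n a ∈ A.gr n := SetLike.coe_mem _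

theorem comp_same {A : CDGA.{u}} {n : ℕ} {a : A} (ha : a ∈ A.gr n) : A.comp n a = a :=
  DirectSum.decompose_of_mem_same A.gr ha

theorem comp_of_ne {A : CDGA.{u}} {m n : ℕ} {a : A} (ha : a ∈ A.gr m) (h : m ≠ n) :
    A.comp n a = 0 :=
  DirectSum.decompose_of_mem_ne A.gr ha h

theorem exists_sum_comp (A : CDGA.{u}) (a : A) :
    ∃ s : Finset ℕ, ∀ t, s ⊆ t → a = ∑ n ∈ t, A.comp n a := by
  classical
  refine ⟨(DirectSum.decompose A.gr a).support, fun t ht =>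
    (DirectSum.sum_support_decompose A.gr a).symm.trans ?_⟩
  refine Finset.sum_subset ht fun n _ hn => ?_
  rw [DFinsupp.notMem_support_iff] at hn
  rw [hn]
  rfl

theorem comp_map {A B : CDGA.{u}} {f : A →ₗ[ℚ] B} {k : ℕ}
    (hf : ∀ i, ∀ a ∈ A.gr i, f a ∈ B.gr (i + k)) (n : ℕ) (a : A) :
    B.comp (n + k) (f a) = f (A.comp n a) := by
  induction a using A.hom_induction with
  | h0 => simp
  | hadd a b ha hb => simp only [map_add, ha, hb]
  | hh i a ha =>
    by_cases hin : i = n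
    · subst hin
      rw [comp_same ha, comp_same (hf i a ha)]
    · rw [comp_of_ne ha hin, map_zero, comp_of_ne (hf i a ha) (by omega)]

theorem comp_d (A : CDGA.{u}) (n : ℕ) (a : A) : A.comp (n + 1) (A.d a) = A.d (A.comp n a) :=
  comp_map (fun _ _ ha => A.d_mem ha) n a

theorem comp_zero_map {A B : CDGA.{u}} {f : A →ₗ[ℚ] B} {k : ℕ}
    (hf : ∀ i, ∀ a ∈ A.gr i, f a ∈ B.gr (i + k + 1)) (a : A) : B.comp 0 (f a) = 0 := by
  induction a using A.hom_induction with
  | h0 => simp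
  | hadd a b ha hb => simp only [map_add, ha, hb, add_zero]
  | hh i a ha => exact comp_of_ne (hf i a ha) (Nat.succ_ne_zero _)

theorem comp_zero_d (A : CDGA.{u}) (a : A) : A.comp 0 (A.d a) = 0 :=
  comp_zero_map (k := 0) (fun _ _ ha => A.d_mem ha) a

theorem Hom.comp_map {A B : CDGA.{u}} (f : Hom A B) (n : ℕ) (a : A) :
    B.comp n (f.toAlgHom a) = f.toAlgHom (A.comp n a) :=
  CDGA.comp_map (f := f.toAlgHom.toLinearMap) (k := 0) (fun _ _ ha => f.map_gr ha) n a

/-- A family of projections onto submodules, each vanishing on the other submodules, defines a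
direct sum decomposition, provided that every element is a sum of finitely many of its images. -/
noncomputable abbrev decompositionOfProj {M : Type*} [AddCommGroup M] [Module ℚ M]
    {gr : ℕ → Submodule ℚ M} (p : ℕ → M →ₗ[ℚ] M) (hmem : ∀ n m, p n m ∈ gr n)
    (hsame : ∀ n, ∀ m ∈ gr n, p n m = m) (hne : ∀ k n, ∀ m ∈ gr k, k ≠ n → p n m = 0)
    (hsum : ∀ m, ∃ s : Finset ℕ, m = ∑ n ∈ s, p n m) : DirectSum.Decomposition gr := by
  have key : DirectSum.IsInternal gr := by
    have hp : ∀ (x : ⨁ n, gr n) (n : ℕ), p n (DirectSum.coeAddMonoidHom gr x) = x n := by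
      intro x n
      induction x using DirectSum.induction_on with
      | zero => simp
      | of i x =>
        rw [DirectSum.coeAddMonoidHom_of]
        by_cases hin : i = n
        · subst hin
          rw [hsame i _ x.2, DirectSum.of_eq_same]
        · rw [hne i n _ x.2 hin, DirectSum.of_eq_of_ne _ _ _ (Ne.symm hin)]
          rfl
      | add x y hx hy => rw [map_add, map_add, hx, hy]; rfl
    refine ⟨fun x y hxy => ?_, fun m => ?_⟩
    · ext n
      rw [← hp, hxy, hp]
    · obtain ⟨s, hs⟩ := hsum m
      refine ⟨∑ n ∈ s, DirectSum.of (fun n => gr n) n ⟨p n m, hmem n m⟩, ?_⟩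
      rw [map_sum]
      conv_rhs => rw [hs]
      exact Finset.sum_congr rfl fun n _ => DirectSum.coeAddMonoidHom_of gr n _
  exact key.chooseDecomposition

/-! ### Products, subalgebras and pullbacks -/

section Prod
variable (A B : CDGA.{u})

instance prodGradedMonoid : SetLike.GradedMonoid fun n => (A.gr n).prod (B.gr n) where
  one_mem := ⟨SetLike.GradedOne.one_mem, SetLike.GradedOne.one_mem⟩
  mul_mem _ _ _ _ ha hb :=
    ⟨SetLike.GradedMul.mul_mem ha.1 hb.1, SetLike.GradedMul.mul_mem ha.2 hb.2⟩

/-- The product of two cdgas. -/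
noncomputable def prod : CDGA.{u} where
  carrier := A × B
  gr n := (A.gr n).prod (B.gr n)
  graded :=
    { prodGradedMonoid A B with
      toDecomposition := decompositionOfProj (fun n => (A.comp n).prodMap (B.comp n))
        (fun n m => ⟨A.comp_mem n m.1, B.comp_mem n m.2⟩)
        (fun n m hm => Prod.ext (comp_same hm.1) (comp_same hm.2))
        (fun k n m hm hkn => Prod.ext (comp_of_ne hm.1 hkn) (comp_of_ne hm.2 hkn))
        (by
          rintro ⟨a, b⟩
          obtain ⟨s, hs⟩ := A.exists_sum_comp a
          obtain ⟨t, ht⟩ := B.exists_sum_comp b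
          refine ⟨s ∪ t, Prod.ext ?_ ?_⟩
          · rw [Prod.fst_sum]
            exact hs _ Finset.subset_union_left
          · rw [Prod.snd_sum]
            exact ht _ Finset.subset_union_right) }
  mul_comm' ha hb := Prod.ext (A.mul_comm' ha.1 hb.1) (B.mul_comm' ha.2 hb.2)
  d := A.d.prodMap B.d
  d_mem ha := ⟨A.d_mem ha.1, B.d_mem ha.2⟩
  d_d a := Prod.ext (A.d_d a.1) (B.d_d a.2)
  leibniz ha b := Prod.ext (A.leibniz ha.1 b.1) (B.leibniz ha.2 b.2)

/-- The projection to the first factor. -/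
noncomputable def prodFst : Hom (A.prod B) A where
  toAlgHom := AlgHom.fst ℚ A B
  map_gr ha := ha.1
  map_d _ := rfl

/-- The projection to the second factor. -/
noncomputable def prodSnd : Hom (A.prod B) B where
  toAlgHom := AlgHom.snd ℚ A B
  map_gr ha := ha.2
  map_d _ := rfl

end Prod

section Sub

/-- A homogeneous subalgebra `S` of a graded commutative algebra `F`, together with a derivation `D`
of `F` of degree `1` which restricts to a differential on `S`. The derivation `D` is not required to
be the differential of `F`, nor to have square zero on all of `F`. -/
structure DiffSubalgebra (F : CDGA.{u}) where
  carrier : Subalgebra ℚ F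
  D : F →ₗ[ℚ] F
  D_gr : ∀ i, ∀ c ∈ F.gr i, D c ∈ F.gr (i + 1)
  leibniz : ∀ i, ∀ c ∈ F.gr i, ∀ b, D (c * b) = D c * b + (-1 : ℚ) ^ i • (c * D b)
  comp_mem : ∀ n, ∀ c ∈ carrier, F.comp n c ∈ carrier
  D_mem : ∀ c ∈ carrier, D c ∈ carrier
  D_D : ∀ c ∈ carrier, D (D c) = 0

variable {F : CDGA.{u}} (S : DiffSubalgebra F)

/-- The graded parts of a homogeneous subalgebra. -/
def DiffSubalgebra.gr (n : ℕ) : Submodule ℚ S.carrier :=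
  (F.gr n).comap S.carrier.val.toLinearMap

instance : SetLike.GradedMonoid S.gr where
  one_mem := SetLike.GradedOne.one_mem (A := F.gr)
  mul_mem _ _ _ _ ha hb := SetLike.GradedMul.mul_mem (A := F.gr) ha hb

/-- The cdga given by a homogeneous subalgebra with differential. -/
noncomputable def DiffSubalgebra.toCDGA : CDGA.{u} where
  carrier := S.carrier
  gr := S.gr
  graded :=
    { (inferInstance : SetLike.GradedMonoid S.gr) with
      toDecomposition := decompositionOfProj
        (fun n => (F.comp n).restrict (p := Subalgebra.toSubmodule S.carrier)
          (q := Subalgebra.toSubmodule S.carrier) (S.comp_mem n))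
        (fun n m => F.comp_mem n m.1)
        (fun n m hm => Subtype.ext (comp_same hm))
        (fun k n m hm hkn => Subtype.ext (comp_of_ne hm hkn))
        (by
          rintro ⟨a, ha⟩
          obtain ⟨s, hs⟩ := F.exists_sum_comp a
          refine ⟨s, Subtype.ext ?_⟩
          rw [AddSubmonoidClass.coe_finsetSum]
          exact hs s subset_rfl) }
  mul_comm' ha hb := Subtype.ext (F.mul_comm' ha hb)
  d := S.D.restrict (p := Subalgebra.toSubmodule S.carrier)
          (q := Subalgebra.toSubmodule S.carrier) S.D_mem
  d_mem ha := S.D_gr _ _ ha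
  d_d a := Subtype.ext (S.D_D _ a.2)
  leibniz ha b := Subtype.ext (S.leibniz _ _ ha b)

end Sub

section Pullback
variable {X Y Z : CDGA.{u}} (g : Hom X Z) (h : Hom Y Z)

/-- The subalgebra of `X × Y` on which two morphisms `X → Z` and `Y → Z` agree. -/
noncomputable def pullbackSub : DiffSubalgebra (X.prod Y) where
  carrier := AlgHom.equalizer (g.toAlgHom.comp (AlgHom.fst ℚ X Y))
    (h.toAlgHom.comp (AlgHom.snd ℚ X Y))
  D := (X.prod Y).d
  D_gr _ _ hc := (X.prod Y).d_mem hc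
  leibniz _ _ hc b := (X.prod Y).leibniz hc b
  comp_mem := by
    intro n c hc
    have e : (X.prod Y).comp n c = (X.comp n c.1, Y.comp n c.2) :=
      Prod.ext ((X.prodFst Y).comp_map n c).symm ((X.prodSnd Y).comp_map n c).symm
    rw [e]
    change g.toAlgHom (X.comp n c.1) = h.toAlgHom (Y.comp n c.2)
    rw [← g.comp_map, ← h.comp_map]
    exact congrArg (Z.comp n) hc
  D_mem := by
    intro c hc
    change g.toAlgHom (X.d c.1) = h.toAlgHom (Y.d c.2)
    rw [g.map_d, h.map_d]
    exact congrArg Z.d hc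
  D_D c _ := (X.prod Y).d_d c

/-- The fibre product of `X` and `Y` over `Z`. -/
noncomputable def pullback : CDGA.{u} := (pullbackSub g h).toCDGA


namespace pullback

/-- The first projection of the fibre product. -/
noncomputable def fst : Hom (pullback g h) X where
  toAlgHom := (AlgHom.fst ℚ X Y).comp (pullbackSub g h).carrier.val
  map_gr ha := ha.1
  map_d _ := rfl

/-- The second projection of the fibre product. -/
noncomputable def snd : Hom (pullback g h) Y where
  toAlgHom := (AlgHom.snd ℚ X Y).comp (pullbackSub g h).carrier.val
  map_gr ha := ha.2
  map_d _ := rfl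

theorem condition (t : pullback g h) :
    g.toAlgHom ((fst g h).toAlgHom t) = h.toAlgHom ((snd g h).toAlgHom t) := t.2

variable {g h} in
/-- The morphism into the fibre product with given components. -/
noncomputable def lift {W : CDGA.{u}} (a : Hom W X) (b : Hom W Y)
    (hab : ∀ w, g.toAlgHom (a.toAlgHom w) = h.toAlgHom (b.toAlgHom w)) : Hom W (pullback g h) where
  toAlgHom := (a.toAlgHom.prod b.toAlgHom).codRestrict (pullbackSub g h).carrier hab
  map_gr hw := ⟨a.map_gr hw, b.map_gr hw⟩
  map_d w := Subtype.ext (Prod.ext (a.map_d w) (b.map_d w))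

variable {g h} in
theorem ext {s t : pullback g h} (h1 : (fst g h).toAlgHom s = (fst g h).toAlgHom t)
    (h2 : (snd g h).toAlgHom s = (snd g h).toAlgHom t) : s = t :=
  Subtype.ext (Prod.ext h1 h2)

theorem exists_of_eq {a : X} {b : Y} (hab : g.toAlgHom a = h.toAlgHom b) :
    ∃ t : pullback g h, (fst g h).toAlgHom t = a ∧ (snd g h).toAlgHom t = b :=
  ⟨⟨(a, b), hab⟩, rfl, rfl⟩

end pullback
end Pullback

/-! ### Quasi-isomorphisms -/

/-- The composition of morphisms. -/
noncomputable def Hom.comp {A B C : CDGA.{u}} (g : Hom B C) (f : Hom A B) : Hom A C where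
  toAlgHom := g.toAlgHom.comp f.toAlgHom
  map_gr ha := g.map_gr (f.map_gr ha)
  map_d a := (congrArg g.toAlgHom (f.map_d a)).trans (g.map_d _)

theorem Hom.IsQuasiIso.comp {A B C : CDGA.{u}} {g : Hom B C} {f : Hom A B} (hg : g.IsQuasiIso)
    (hf : f.IsQuasiIso) : (g.comp f).IsQuasiIso := by
  have e : ⇑(g.comp f).mapCohomology = g.mapCohomology ∘ f.mapCohomology := by
    funext c
    obtain ⟨c, rfl⟩ := Submodule.Quotient.mk_surjective _ c
    rfl
  rw [Hom.IsQuasiIso, e]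
  exact Function.Bijective.comp hg hf

theorem Hom.mapCohomology_mk_eq_zero {A B : CDGA.{u}} (f : Hom A B) (a : LinearMap.ker A.d) :
    f.mapCohomology (Submodule.Quotient.mk a) = 0 ↔ ∃ b, B.d b = f.toAlgHom a :=
  Submodule.Quotient.mk_eq_zero _

/-- A morphism is a quasi-isomorphism if it reflects coboundaries among cocycles and if each cocycle
of the target is cohomologous to the image of a cocycle. -/
theorem Hom.isQuasiIso_of {A B : CDGA.{u}} (f : Hom A B)
    (hinj : ∀ a b, A.d a = 0 → f.toAlgHom a = B.d b → ∃ a', a = A.d a')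
    (hsurj : ∀ b, B.d b = 0 → ∃ a b', A.d a = 0 ∧ f.toAlgHom a - b = B.d b') : f.IsQuasiIso := by
  refine ⟨?_, ?_⟩
  · rw [injective_iff_map_eq_zero]
    intro c hc
    obtain ⟨⟨a, ha⟩, rfl⟩ := Submodule.Quotient.mk_surjective _ c
    obtain ⟨b, hb⟩ := (f.mapCohomology_mk_eq_zero _).mp hc
    obtain ⟨a', ha'⟩ := hinj a b ha hb.symm
    exact (Submodule.Quotient.mk_eq_zero _).mpr ⟨a', ha'.symm⟩
  · intro c
    obtain ⟨⟨b, hb⟩, rfl⟩ := Submodule.Quotient.mk_surjective _ c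
    obtain ⟨a, b', ha, hab⟩ := hsurj b hb
    exact ⟨Submodule.Quotient.mk ⟨a, ha⟩, (Submodule.Quotient.eq _).mpr ⟨b', hab.symm⟩⟩

theorem Hom.IsQuasiIso.exists_d_eq {A B : CDGA.{u}} {f : Hom A B} (hf : f.IsQuasiIso) {a : A}
    {b : B} (ha : A.d a = 0) (hab : f.toAlgHom a = B.d b) : ∃ a', a = A.d a' := by
  have h0 : (Submodule.Quotient.mk ⟨a, ha⟩ : A.Cohomology) = 0 :=
    hf.1 (((f.mapCohomology_mk_eq_zero ⟨a, ha⟩).mpr ⟨b, hab.symm⟩).trans (map_zero _).symm)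
  obtain ⟨a', ha'⟩ := (Submodule.Quotient.mk_eq_zero _).mp h0
  exact ⟨a', ha'.symm⟩

/-- The criterion `Hom.isQuasiIso_of` may be checked on homogeneous elements. -/
theorem Hom.isQuasiIso_of_homogeneous {A B : CDGA.{u}} (f : Hom A B)
    (hinj0 : ∀ a ∈ A.gr 0, A.d a = 0 → f.toAlgHom a = 0 → a = 0)
    (hinj : ∀ n, ∀ a ∈ A.gr (n + 1), ∀ b ∈ B.gr n, A.d a = 0 → f.toAlgHom a = B.d b →
      ∃ a', a = A.d a')
    (hsurj : ∀ n, ∀ b ∈ B.gr n, B.d b = 0 → ∃ a b', A.d a = 0 ∧ f.toAlgHom a - b = B.d b') :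
    f.IsQuasiIso := by
  refine f.isQuasiIso_of (fun a b ha hab => ?_) (fun b hb => ?_)
  · have hn : ∀ n, A.comp n a ∈ LinearMap.range A.d := by
      intro n
      have hd : A.d (A.comp n a) = 0 := by rw [← A.comp_d, ha, map_zero]
      cases n with
      | zero =>
        rw [hinj0 _ (A.comp_mem 0 a) hd (by rw [← f.comp_map, hab, B.comp_zero_d])]
        exact zero_mem _
      | succ n =>
        obtain ⟨a', ha'⟩ := hinj n _ (A.comp_mem _ a) _ (B.comp_mem n b) hd
          (by rw [← f.comp_map, hab, B.comp_d])
        exact ⟨a', ha'.symm⟩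
    obtain ⟨s, hs⟩ := A.exists_sum_comp a
    obtain ⟨a', ha'⟩ : a ∈ LinearMap.range A.d := by
      rw [hs s subset_rfl]
      exact sum_mem fun n _ => hn n
    exact ⟨a', ha'.symm⟩
  · have hn : ∀ n, ∃ a b', A.d a = 0 ∧ f.toAlgHom a - B.comp n b = B.d b' := fun n =>
      hsurj n _ (B.comp_mem n b) (by rw [← B.comp_d, hb, map_zero])
    choose a b' ha hab using hn
    obtain ⟨s, hs⟩ := B.exists_sum_comp b
    refine ⟨∑ n ∈ s, a n, ∑ n ∈ s, b' n, ?_, ?_⟩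
    · rw [map_sum, Finset.sum_eq_zero fun n _ => ha n]
    · rw [map_sum, map_sum, ← Finset.sum_congr rfl fun n _ => hab n, Finset.sum_sub_distrib,
        ← hs s subset_rfl]

/-- The base change of a surjection with acyclic kernel is a quasi-isomorphism. -/
theorem pullback.snd_isQuasiIso {X Y Z : CDGA.{u}} {g : Hom X Z} {h : Hom Y Z}
    (hg : Function.Surjective g.toAlgHom)
    (hac : ∀ t, g.toAlgHom t = 0 → X.d t = 0 → ∃ s, g.toAlgHom s = 0 ∧ X.d s = t) :
    (pullback.snd g h).IsQuasiIso := by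
  refine Hom.isQuasiIso_of _ (fun p y' hp hpy => ?_) (fun y hy => ?_)
  · obtain ⟨t', ht'⟩ := hg (h.toAlgHom y')
    have ht : X.d ((fst g h).toAlgHom p) = 0 := by rw [← (fst g h).map_d, hp, map_zero]
    obtain ⟨s, hs, hds⟩ := hac ((fst g h).toAlgHom p - X.d t')
      (by rw [map_sub, condition, hpy, g.map_d, ht', h.map_d, sub_self])
      (by rw [map_sub, ht, X.d_d, sub_self])
    obtain ⟨p', h1, h2⟩ := exists_of_eq g h (a := t' + s) (b := y')
      (by rw [map_add, hs, add_zero, ht'])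
    refine ⟨p', ext ?_ ?_⟩
    · rw [(fst g h).map_d, h1, map_add, hds, add_sub_cancel]
    · rw [(snd g h).map_d, h2, hpy]
  · obtain ⟨t, ht⟩ := hg (h.toAlgHom y)
    obtain ⟨s, hs, hds⟩ := hac (X.d t) (by rw [g.map_d, ht, ← h.map_d, hy, map_zero]) (X.d_d t)
    obtain ⟨p, h1, h2⟩ := exists_of_eq g h (a := t - s) (b := y)
      (by rw [map_sub, hs, sub_zero, ht])
    refine ⟨p, 0, ext ?_ ?_, by rw [h2, sub_self, map_zero]⟩
    · rw [(fst g h).map_d, h1, map_sub, hds, sub_self, map_zero]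
    · rw [(snd g h).map_d, h2, hy, map_zero]

end CDGA

namespace CDGA

/-! ### Derivations of `B ⊗ Λ Z` -/

section Derivation

/-- The matrix encoding the value `w` of a derivation at an element `a` of degree `i`. A linear map
`D` of degree `1` is a derivation if and only if `a ↦ !![(-1) ^ i • a, D a; 0, a]` is
multiplicative; this is how derivations are constructed on free algebras. -/
def dmat {F : CDGA.{u}} (i : ℕ) (a w : F) : Matrix (Fin 2) (Fin 2) F :=
  !![(-1 : ℚ) ^ i • a, w; 0, a]

variable {F : CDGA.{u}}

theorem dmat_zero_zero (i : ℕ) (a w : F) : dmat i a w 0 0 = (-1 : ℚ) ^ i • a := rfl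

theorem dmat_zero_one (i : ℕ) (a w : F) : dmat i a w 0 1 = w := rfl

theorem dmat_one_one (i : ℕ) (a w : F) : dmat i a w 1 1 = a := rfl

theorem dmat_mul (i j : ℕ) (a w b v : F) :
    dmat i a w * dmat j b v = dmat (i + j) (a * b) ((-1 : ℚ) ^ i • (a * v) + w * b) := by
  ext k l
  fin_cases k <;> fin_cases l <;> simp [dmat, Matrix.mul_apply, Fin.sum_univ_two, pow_add,
    smul_smul, mul_comm]

theorem dmat_add (i : ℕ) (a w b v : F) : dmat i a w + dmat i b v = dmat i (a + b) (w + v) := by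
  ext k l
  fin_cases k <;> fin_cases l <;> simp [dmat]

theorem dmat_smul (i : ℕ) (c : ℚ) (a w : F) : c • dmat i a w = dmat i (c • a) (c • w) := by
  ext k l
  fin_cases k <;> fin_cases l <;> simp [dmat, smul_comm c]

theorem dmat_zero (i : ℕ) : dmat i (0 : F) 0 = 0 := by
  ext k l
  fin_cases k <;> fin_cases l <;> simp [dmat]

theorem dmat_comm {i j : ℕ} {a w b v : F} (ha : a ∈ F.gr i) (hw : w ∈ F.gr (i + 1))
    (hb : b ∈ F.gr j) (hv : v ∈ F.gr (j + 1)) :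
    dmat i a w * dmat j b v = (-1 : ℚ) ^ (i * j) • (dmat j b v * dmat i a w) := by
  rw [dmat_mul, dmat_mul, dmat_smul, F.mul_comm' ha hb, F.mul_comm' ha hv, F.mul_comm' hw hb,
    add_comm j i]
  congr 1
  rw [smul_add, smul_smul, smul_smul, add_comm, ← pow_add, ← pow_add]
  congr 2
  · ring
  · have : i + i * (j + 1) = i * j + 2 * i := by ring
    rw [this, pow_add, pow_mul]
    simp

/-- The matrix encoding of the differential of `B`, along a morphism `B → F`. -/
theorem exists_dmat_hom {B : CDGA.{u}} (ι : Hom B F) :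
    ∃ ψ : B →ₐ[ℚ] Matrix (Fin 2) (Fin 2) F,
      ∀ i, ∀ b ∈ B.gr i, ψ b = dmat i (ι.toAlgHom b) (ι.toAlgHom (B.d b)) := by
  let φ : B →ₗ[ℚ] Matrix (Fin 2) (Fin 2) F :=
    { toFun := fun b => !![F.sgn (ι.toAlgHom b), ι.toAlgHom (B.d b); 0, ι.toAlgHom b]
      map_add' := fun b c => by
        simp only [map_add]
        ext k l
        fin_cases k <;> fin_cases l <;> simp
      map_smul' := fun r b => by
        simp only [map_smul]
        ext k l
        fin_cases k <;> fin_cases l <;> simp }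
  have hφ : ∀ b, φ b = !![F.sgn (ι.toAlgHom b), ι.toAlgHom (B.d b); 0, ι.toAlgHom b] := fun _ => rfl
  have h1 : φ 1 = 1 := by
    rw [hφ, map_one, F.sgn_one, B.d_one, map_zero, Matrix.one_fin_two]
  have hmul : ∀ b c, φ (b * c) = φ b * φ c := by
    intro b c
    rw [hφ, hφ, hφ, map_mul, F.sgn_mul, B.d_mul, Matrix.mul_fin_two, map_add, map_mul, map_mul,
      ι.map_sgn]
    simp [add_comm]
  refine ⟨AlgHom.ofLinearMap φ h1 hmul, fun i b hb => ?_⟩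
  rw [AlgHom.ofLinearMap_apply, hφ, dmat, F.sgn_of_mem (ι.map_gr hb)]

variable {B Λ : CDGA.{u}} {G : Type*} {deg : G → ℕ} {z : G → Λ}

/-- The matrix encoding of a derivation on a free algebra. -/
theorem IsFreeOn.exists_dmat (h : Λ.IsFreeOn deg z) (κ : Hom Λ F) (δ : G → F)
    (hδ : ∀ g, δ g ∈ F.gr (deg g + 1)) :
    ∃ ψ : Λ →ₐ[ℚ] Matrix (Fin 2) (Fin 2) F,
      (∀ g, ψ (z g) = dmat (deg g) (κ.toAlgHom (z g)) (δ g)) ∧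
      ∀ j, ∀ w ∈ Λ.gr j, ∃ v ∈ F.gr (j + 1), ψ w = dmat j (κ.toAlgHom w) v := by
  have hκ : ∀ g, κ.toAlgHom (z g) ∈ F.gr (deg g) := fun g => κ.map_gr (h.mem g)
  let ψ : Λ →ₐ[ℚ] Matrix (Fin 2) (Fin 2) F :=
    h.lift (fun g => dmat (deg g) (κ.toAlgHom (z g)) (δ g))
      (fun g g' => dmat_comm (hκ g) (hδ g) (hκ g') (hδ g'))
  have hψ : ∀ g, ψ (z g) = dmat (deg g) (κ.toAlgHom (z g)) (δ g) := h.lift_gen _ _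
  refine ⟨ψ, hψ, fun j w hw => ?_⟩
  rw [h.gr_eq] at hw
  refine Submodule.span_induction
    (p := fun w _ => ∃ v ∈ F.gr (j + 1), ψ w = dmat j (κ.toAlgHom w) v) ?_ ?_ ?_ ?_ hw
  · rintro _ ⟨l, rfl, rfl⟩
    clear hw
    induction l with
    | nil =>
      refine ⟨0, zero_mem _, ?_⟩
      simp only [List.map_nil, List.prod_nil, List.sum_nil, map_one]
      ext k l
      fin_cases k <;> fin_cases l <;> simp [dmat]
    | cons g l ih =>
      obtain ⟨v, hv, e⟩ := ih
      simp only [List.map_cons, List.prod_cons, List.sum_cons]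
      refine ⟨_, ?_, by rw [map_mul, e, hψ, dmat_mul, map_mul]⟩
      have hl : κ.toAlgHom ((l.map z).prod) ∈ F.gr (l.map deg).sum := by
        refine κ.map_gr ?_
        rw [h.gr_eq]
        exact Submodule.subset_span ⟨l, rfl, rfl⟩
      refine add_mem (Submodule.smul_mem _ _ ?_) ?_
      · have := SetLike.GradedMul.mul_mem (hκ g) hv
        rwa [← add_assoc] at this
      · have := SetLike.GradedMul.mul_mem (hδ g) hl
        rwa [add_right_comm] at this
  · exact ⟨0, zero_mem _, by rw [map_zero, map_zero, dmat_zero]⟩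
  · rintro s t - - ⟨v, hv, e⟩ ⟨v', hv', e'⟩
    exact ⟨v + v', add_mem hv hv', by rw [map_add, e, e', dmat_add, map_add]⟩
  · rintro c s - ⟨v, hv, e⟩
    exact ⟨c • v, Submodule.smul_mem _ c hv, by rw [map_smul, e, dmat_smul, map_smul]⟩

/-- The differential of `B` and arbitrary values on the generators of `Λ` extend to a derivation of
`B ⊗ Λ`. -/
theorem IsFreeOn.exists_derivation (h : Λ.IsFreeOn deg z) (δ : G → B.tensor Λ)
    (hδ : ∀ g, δ g ∈ (B.tensor Λ).gr (deg g + 1)) :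
    ∃ D : B.tensor Λ →ₗ[ℚ] B.tensor Λ,
      (∀ i, ∀ c ∈ (B.tensor Λ).gr i, D c ∈ (B.tensor Λ).gr (i + 1)) ∧
      (∀ i, ∀ c ∈ (B.tensor Λ).gr i, ∀ b, D (c * b) = D c * b + (-1 : ℚ) ^ i • (c * D b)) ∧
      (∀ b, D ((B.inl Λ).toAlgHom b) = (B.inl Λ).toAlgHom (B.d b)) ∧
      ∀ g, D ((B.inr Λ).toAlgHom (z g)) = δ g := by
  obtain ⟨ψB, hψB⟩ := exists_dmat_hom (B.inl Λ)
  obtain ⟨ψZ, hψZ, hψZ'⟩ := h.exists_dmat (B.inr Λ) δ hδ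
  have hcomm : ∀ i j, ∀ b ∈ B.gr i, ∀ w ∈ Λ.gr j,
      ψB b * ψZ w = (-1 : ℚ) ^ (i * j) • (ψZ w * ψB b) := by
    intro i j b hb w hw
    obtain ⟨v, hv, e⟩ := hψZ' j w hw
    rw [hψB i b hb, e]
    exact dmat_comm ((B.inl Λ).map_gr hb) ((B.inl Λ).map_gr (B.d_mem hb)) ((B.inr Λ).map_gr hw) hv
  obtain ⟨ψ, hψm, hψl, hψr⟩ : ∃ ψ : B.tensor Λ →ₐ[ℚ] Matrix (Fin 2) (Fin 2) (B.tensor Λ),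
      (∀ b w, ψ ((B.inl Λ).toAlgHom b * (B.inr Λ).toAlgHom w) = ψB b * ψZ w) ∧
      (∀ b, ψ ((B.inl Λ).toAlgHom b) = ψB b) ∧ ∀ w, ψ ((B.inr Λ).toAlgHom w) = ψZ w :=
    ⟨tensorLift ψB ψZ hcomm, tensorLift_mul _ _ _, tensorLift_inl _ _ _, tensorLift_inr _ _ _⟩
  have hψ : ∀ i, ∀ c ∈ (B.tensor Λ).gr i, ∃ w ∈ (B.tensor Λ).gr (i + 1), ψ c = dmat i c w := by
    intro n c hc
    refine tensor_gr_induction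
      (P := fun c => ∃ w ∈ (B.tensor Λ).gr (n + 1), ψ c = dmat n c w) ?_ ?_ ?_ hc
    · exact ⟨0, zero_mem _, by rw [map_zero, dmat_zero]⟩
    · rintro i j rfl b hb w hw
      obtain ⟨v, hv, e⟩ := hψZ' j w hw
      refine ⟨_, ?_, by rw [hψm, hψB i b hb, e, dmat_mul]⟩
      refine add_mem (Submodule.smul_mem _ _ ?_) ?_
      · have := SetLike.GradedMul.mul_mem ((B.inl Λ).map_gr hb) hv
        rwa [← add_assoc] at this
      · have := SetLike.GradedMul.mul_mem ((B.inl Λ).map_gr (B.d_mem hb)) ((B.inr Λ).map_gr hw)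
        rwa [add_right_comm] at this
    · rintro s t ⟨v, hv, e⟩ ⟨v', hv', e'⟩
      exact ⟨v + v', add_mem hv hv', by rw [map_add, e, e', dmat_add]⟩
  have h11 : ∀ c, ψ c 1 1 = c := by
    intro c
    induction c using (B.tensor Λ).hom_induction with
    | h0 => simp
    | hh i c hc =>
      obtain ⟨w, -, e⟩ := hψ i c hc
      rw [e, dmat_one_one]
    | hadd a b ha hb => rw [map_add, Matrix.add_apply, ha, hb]
  refine ⟨(Matrix.entryLinearMap ℚ _ 0 1).comp ψ.toLinearMap, ?_, ?_, ?_, ?_⟩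
  · intro i c hc
    obtain ⟨w, hw, e⟩ := hψ i c hc
    change ψ c 0 1 ∈ _
    rw [e, dmat_zero_one]
    exact hw
  · intro i c hc b
    obtain ⟨w, hw, e⟩ := hψ i c hc
    change ψ (c * b) 0 1 = ψ c 0 1 * b + (-1 : ℚ) ^ i • (c * ψ b 0 1)
    rw [map_mul, Matrix.mul_apply, Fin.sum_univ_two, h11, e, add_comm, dmat_zero_zero,
      dmat_zero_one, smul_mul_assoc]
  · intro b
    change ψ ((B.inl Λ).toAlgHom b) 0 1 = (B.inl Λ).toAlgHom (B.d b)
    rw [hψl]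
    induction b using B.hom_induction with
    | h0 => simp
    | hh i b hb => rw [hψB i b hb, dmat_zero_one]
    | hadd a b ha hb => rw [map_add, Matrix.add_apply, ha, hb, map_add, map_add]
  · intro g
    change ψ ((B.inr Λ).toAlgHom (z g)) 0 1 = δ g
    rw [hψr, hψZ, dmat_zero_one]

/-- A morphism out of `B` and values on the generators of `Λ` extend to `B ⊗ Λ`. -/
theorem IsFreeOn.exists_extension (h : Λ.IsFreeOn deg z) {P : CDGA.{u}} (f : Hom B P) (v : G → P)
    (hv : ∀ g, v g ∈ P.gr (deg g)) :
    ∃ ξ : B.tensor Λ →ₐ[ℚ] P, (∀ i, ∀ c ∈ (B.tensor Λ).gr i, ξ c ∈ P.gr i) ∧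
      (∀ b, ξ ((B.inl Λ).toAlgHom b) = f.toAlgHom b) ∧
      ∀ g, ξ ((B.inr Λ).toAlgHom (z g)) = v g := by
  let φ : Λ →ₐ[ℚ] P := h.lift v (fun g g' => P.mul_comm' (hv g) (hv g'))
  have hφ : ∀ g, φ (z g) = v g := h.lift_gen _ _
  have hz : ∀ j, ∀ w ∈ Λ.gr j, φ w ∈ P.gr j := by
    intro j w hw
    rw [h.gr_eq] at hw
    refine Submodule.span_induction (p := fun w _ => φ w ∈ P.gr j) ?_ ?_ ?_ ?_ hw
    · rintro _ ⟨l, rfl, rfl⟩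
      clear hw
      induction l with
      | nil => simpa using SetLike.GradedOne.one_mem (A := P.gr)
      | cons i l ih =>
        simp only [List.map_cons, List.prod_cons, List.sum_cons, map_mul, hφ]
        exact SetLike.GradedMul.mul_mem (hv i) ih
    · rw [map_zero]; exact zero_mem _
    · intro s t _ _ hs ht; rw [map_add]; exact add_mem hs ht
    · intro c s _ hs; rw [map_smul]; exact Submodule.smul_mem _ _ hs
  have hc : ∀ i j, ∀ b ∈ B.gr i, ∀ w ∈ Λ.gr j, f.toAlgHom b * φ w =
      (-1 : ℚ) ^ (i * j) • (φ w * f.toAlgHom b) :=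
    fun i j b hb w hw => P.mul_comm' (f.map_gr hb) (hz j w hw)
  refine ⟨tensorLift f.toAlgHom φ hc, fun n c hc' => ?_, tensorLift_inl _ _ hc, fun g => ?_⟩
  · refine tensor_gr_induction (P := fun c => tensorLift f.toAlgHom φ hc c ∈ P.gr n) ?_ ?_ ?_ hc'
    · rw [map_zero]; exact zero_mem _
    · rintro i j rfl b hb w hw
      rw [tensorLift_mul]
      exact SetLike.GradedMul.mul_mem (f.map_gr hb) (hz j w hw)
    · intro s t hs ht
      rw [map_add]
      exact add_mem hs ht
  · rw [tensorLift_inr, hφ]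

/-- For a subset `N` of the set of generators of `Λ`, the map `B ⊗ Λ N → B ⊗ Λ` is injective. -/
theorem IsFreeOn.tensor_injective (h : Λ.IsFreeOn deg z) (N : Set G)
    (hz : ∀ k : N, (B.inr Λ).toAlgHom (z k.1) ∈ (B.tensor Λ).gr (deg k.1)) :
    Function.Injective (TensorProduct.lift ((LinearMap.mul ℚ (B.tensor Λ)).compl₁₂
      (B.inl Λ).toAlgHom.toLinearMap
      ((B.tensor Λ).freeLift (fun k : N => deg k.1)
        (fun k => (B.inr Λ).toAlgHom (z k.1)) hz).toLinearMap)) := by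
  classical
  let j : Free (fun k : N => deg k.1) →ₐ[ℚ] Λ :=
    Λ.freeLift (fun k : N => deg k.1) (fun k => z k.1) (fun k => h.mem k.1)
  have hjg : ∀ k : N, j (gen (fun k : N => deg k.1) k) = z k.1 := fun k => Λ.freeLift_gen _ _ k
  -- Generators outside `N` are sent to zero, which gives a left inverse.
  let ρ : Λ →ₐ[ℚ] Free (fun k : N => deg k.1) :=
    h.lift (fun g => if hg : g ∈ N then gen (fun k : N => deg k.1) ⟨g, hg⟩ else 0) (by
      intro g g'
      by_cases hg : g ∈ N
      · by_cases hg' : g' ∈ N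
        · rw [dif_pos hg, dif_pos hg']
          exact gen_mul_gen (deg := fun k : N => deg k.1) ⟨g, hg⟩ ⟨g', hg'⟩
        · simp [hg']
      · simp [hg])
  have hρj : ρ.comp j = AlgHom.id ℚ _ := free_hom_ext fun k => by
    rw [AlgHom.comp_apply, hjg, h.lift_gen, dif_pos k.2]
    rfl
  have hj : (B.tensor Λ).freeLift (fun k : N => deg k.1)
      (fun k => (B.inr Λ).toAlgHom (z k.1)) hz = (B.inr Λ).toAlgHom.comp j :=
    free_hom_ext fun k => by rw [freeLift_gen, AlgHom.comp_apply, hjg]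
  have e : ∀ t, TensorProduct.lift ((LinearMap.mul ℚ (B.tensor Λ)).compl₁₂
      (B.inl Λ).toAlgHom.toLinearMap
      ((B.tensor Λ).freeLift (fun k : N => deg k.1)
        (fun k => (B.inr Λ).toAlgHom (z k.1)) hz).toLinearMap) t =
      GradedTensorProduct.of ℚ B.gr Λ.gr (TensorProduct.map LinearMap.id j.toLinearMap t) := by
    intro t
    rw [hj]
    induction t using TensorProduct.induction_on with
    | zero => rw [map_zero, map_zero, map_zero]; rfl
    | tmul b w => exact inl_mul_inr b (j w)
    | add s t hs ht => rw [map_add, hs, ht, map_add, map_add]; rfl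
  intro s t hst
  rw [e, e] at hst
  have h1 := (GradedTensorProduct.of ℚ B.gr Λ.gr).injective hst
  have hid : ∀ t, TensorProduct.map (LinearMap.id (R := ℚ) (M := B)) ρ.toLinearMap
      (TensorProduct.map LinearMap.id j.toLinearMap t) = t := by
    intro t
    rw [← LinearMap.comp_apply, ← TensorProduct.map_comp, LinearMap.id_comp]
    have : ρ.toLinearMap ∘ₗ j.toLinearMap = LinearMap.id :=
      LinearMap.ext fun w => AlgHom.congr_fun hρj w
    rw [this, TensorProduct.map_id]
    rfl
  rw [← hid s, h1, hid]

end Derivation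

end CDGA

namespace CDGA

/-! ### Saturated free extensions -/

/-- An extension `F = B ⊗ Λ Z` of `B`, with a derivation `D` extending the differential of `B`, a
morphism `ξ : F → P` extending `f`, and generators of all degrees at least `2` on which `D` and `ξ`
take all possible pairs of values. Neither `D ∘ D = 0` nor `ξ ∘ D = d ∘ ξ` is required. Relative
Sullivan models of `f` are found inside `F`, by selection of generators. -/
structure SaturatedExtension {B P : CDGA.{u}} (f : Hom B P) where
  F : CDGA.{u}
  ι : Hom B F
  G : Type u
  deg : G → ℕ
  z : G → F
  D : F →ₗ[ℚ] F
  ξ : F →ₐ[ℚ] P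
  z_mem : ∀ g, z g ∈ F.gr (deg g)
  two_le : ∀ g, 2 ≤ deg g
  conn : F.IsOneConnected
  D_gr : ∀ i, ∀ c ∈ F.gr i, D c ∈ F.gr (i + 1)
  leibniz : ∀ i, ∀ c ∈ F.gr i, ∀ b, D (c * b) = D c * b + (-1 : ℚ) ^ i • (c * D b)
  D_ι : ∀ b, D (ι.toAlgHom b) = ι.toAlgHom (B.d b)
  ξ_gr : ∀ i, ∀ c ∈ F.gr i, ξ c ∈ P.gr i
  ξ_ι : ∀ b, ξ (ι.toAlgHom b) = f.toAlgHom b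
  exists_gen : ∀ k, 2 ≤ k → ∀ c ∈ F.gr (k + 1), ∀ q ∈ P.gr k,
    ∃ g, deg g = k ∧ D (z g) = c ∧ ξ (z g) = q
  injective : ∀ (N : Set G) (hz : ∀ k : N, z k.1 ∈ F.gr (deg k.1)),
    Function.Injective (TensorProduct.lift ((LinearMap.mul ℚ F).compl₁₂ ι.toAlgHom.toLinearMap
      (F.freeLift (fun k : N => deg k.1) (fun k => z k.1) hz).toLinearMap))

/-- Expressions for the elements of the free extension of `β` by generators which are indexed by
triples of an expression, an element of `κ` and a degree. -/
inductive Expr (β κ : Type u) : Type u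
  | base (b : β)
  | add (s t : Expr β κ)
  | mul (s t : Expr β κ)
  | var (t : Expr β κ) (q : κ) (k : ℕ)

/-- The element of an algebra denoted by an expression. -/
def Expr.eval {β κ F : Type u} [Add F] [Mul F] (b : β → F) (z : Expr β κ × κ × ℕ → F) :
    Expr β κ → F
  | .base c => b c
  | .add s t => s.eval b z + t.eval b z
  | .mul s t => s.eval b z * t.eval b z
  | .var t q k => z (t, q, k)

/-- The generators are indexed by expressions, so that each element of the extension is available as
the differential of a generator. -/
theorem exists_saturatedExtension {B P : CDGA.{u}} (f : Hom B P) (hB : B.IsOneConnected) :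
    Nonempty (SaturatedExtension f) := by
  let G : Type u := Expr B P × P × ℕ
  let deg : G → ℕ := fun g => g.2.2 + 2
  let Λ : CDGA.{u} := freeC deg
  obtain ⟨z, h⟩ : ∃ z : G → Λ, Λ.IsFreeOn deg z := ⟨gen deg, freeC_isFreeOn deg⟩
  clear_value Λ
  have hz : ∀ g, (B.inr Λ).toAlgHom (z g) ∈ (B.tensor Λ).gr (deg g) :=
    fun g => (B.inr Λ).map_gr (h.mem g)
  let ev : Expr B P → B.tensor Λ :=
    Expr.eval (B.inl Λ).toAlgHom (fun g => (B.inr Λ).toAlgHom (z g))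
  have hev : Function.Surjective ev := by
    intro t
    induction t using tensor_hom_induction with
    | h0 => exact ⟨.base 0, map_zero _⟩
    | hh i j b _ w hw =>
      clear hw
      obtain ⟨s, hs⟩ : ∃ s, ev s = (B.inr Λ).toAlgHom w := by
        induction w using h.induction with
        | hc c => exact ⟨.base (algebraMap ℚ B c), by
            change (B.inl Λ).toAlgHom _ = _
            rw [AlgHom.commutes, AlgHom.commutes]⟩
        | hv g => exact ⟨.var g.1 g.2.1 g.2.2, rfl⟩
        | hadd a b ha hb =>
          obtain ⟨s, hs⟩ := ha
          obtain ⟨t, ht⟩ := hb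
          exact ⟨.add s t, by rw [map_add, ← hs, ← ht]; rfl⟩
        | hmul a b ha hb =>
          obtain ⟨s, hs⟩ := ha
          obtain ⟨t, ht⟩ := hb
          exact ⟨.mul s t, by rw [map_mul, ← hs, ← ht]; rfl⟩
      exact ⟨.mul (.base b) s, by rw [← hs]; rfl⟩
    | hadd s t hs ht =>
      obtain ⟨s, rfl⟩ := hs
      obtain ⟨t, rfl⟩ := ht
      exact ⟨.add s t, rfl⟩
  obtain ⟨D, hDgr, hDl, hDι, hDz⟩ := h.exists_derivation (B := B)
    (fun g => (B.tensor Λ).comp (deg g + 1) (ev g.1)) (fun g => comp_mem _ _ _)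
  obtain ⟨ξ, hξgr, hξι, hξz⟩ := h.exists_extension f (fun g => P.comp (deg g) g.2.1)
    (fun g => comp_mem _ _ _)
  exact ⟨{
    F := B.tensor Λ
    ι := B.inl Λ
    G := G
    deg := deg
    z := fun g => (B.inr Λ).toAlgHom (z g)
    D := D
    ξ := ξ
    z_mem := hz
    two_le := fun g => Nat.le_add_left 2 _
    conn := tensor_isOneConnected hB (h.isOneConnected fun g => Nat.le_add_left 2 _)
    D_gr := hDgr
    leibniz := hDl
    D_ι := hDι
    ξ_gr := hξgr
    ξ_ι := hξι
    exists_gen := by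
      intro k hk c hc q hq
      obtain ⟨t, rfl⟩ := hev c
      obtain ⟨k, rfl⟩ := Nat.exists_eq_add_of_le' hk
      exact ⟨(t, q, k), rfl, (hDz _).trans (comp_same hc), (hξz _).trans (comp_same hq)⟩
    injective := fun N hzN => h.tensor_injective N hzN }⟩

namespace SaturatedExtension
variable {B P : CDGA.{u}} {f : Hom B P} (E : SaturatedExtension f)

theorem D_mul (a b : E.F) : E.D (a * b) = E.D a * b + E.F.sgn a * E.D b := by
  induction a using E.F.hom_induction with
  | h0 => simp
  | hadd a a' ha ha' => simp only [add_mul, map_add, ha, ha']; abel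
  | hh i a ha => rw [E.leibniz i a ha, E.F.sgn_of_mem ha, smul_mul_assoc]

theorem D_algebraMap (c : ℚ) : E.D (algebraMap ℚ E.F c) = 0 := by
  have h1 : E.D 1 = 0 := by
    have h := E.D_mul 1 1
    rw [mul_one, mul_one, sgn_one, one_mul] at h
    simpa using h
  rw [Algebra.algebraMap_eq_smul_one, map_smul, h1, smul_zero]

theorem D_sgn (a : E.F) : E.D (E.F.sgn a) = - E.F.sgn (E.D a) := by
  induction a using E.F.hom_induction with
  | h0 => simp
  | hadd a b ha hb => rw [map_add, map_add, ha, hb, map_add, map_add, neg_add]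
  | hh i a ha =>
    rw [E.F.sgn_of_mem ha, E.F.sgn_of_mem (E.D_gr i a ha), map_smul, pow_succ, mul_neg_one, neg_smul,
      neg_neg]

theorem ξ_sgn (a : E.F) : E.ξ (E.F.sgn a) = P.sgn (E.ξ a) := by
  induction a using E.F.hom_induction with
  | h0 => simp
  | hadd a b ha hb => simp only [map_add, ha, hb]
  | hh i a ha => rw [E.F.sgn_of_mem ha, P.sgn_of_mem (E.ξ_gr i a ha), map_smul]

/-- The subalgebra generated by `B` and the generators in `N`. -/
def sub (N : Set E.G) : Subalgebra ℚ E.F :=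
  Algebra.adjoin ℚ (Set.range E.ι.toAlgHom ∪ E.z '' N)

variable {E}

theorem ι_mem_sub (N : Set E.G) (b : B) : E.ι.toAlgHom b ∈ E.sub N :=
  Algebra.subset_adjoin (Or.inl ⟨b, rfl⟩)

theorem z_mem_sub {N : Set E.G} {g : E.G} (hg : g ∈ N) : E.z g ∈ E.sub N :=
  Algebra.subset_adjoin (Or.inr ⟨g, hg, rfl⟩)

theorem sub_mono {N N' : Set E.G} (h : N ⊆ N') : E.sub N ≤ E.sub N' :=
  Algebra.adjoin_mono (Set.union_subset_union_right _ (Set.image_mono h))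

theorem sub_empty {c : E.F} (hc : c ∈ E.sub ∅) : ∃ b, c = E.ι.toAlgHom b := by
  have : E.sub ∅ ≤ E.ι.toAlgHom.range := by
    rw [sub, Set.image_empty, Set.union_empty]
    exact Algebra.adjoin_le subset_rfl
  obtain ⟨b, hb⟩ := this hc
  exact ⟨b, hb.symm⟩

theorem sub_induction {N : Set E.G} {p : E.F → Prop} (hι : ∀ b, p (E.ι.toAlgHom b))
    (hz : ∀ g ∈ N, p (E.z g)) (hadd : ∀ a b, a ∈ E.sub N → b ∈ E.sub N → p a → p b → p (a + b))
    (hmul : ∀ a b, a ∈ E.sub N → b ∈ E.sub N → p a → p b → p (a * b)) {c : E.F}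
    (hc : c ∈ E.sub N) : p c := by
  refine Algebra.adjoin_induction (p := fun c _ => p c) ?_ ?_ (fun a b ha hb => hadd a b ha hb)
    (fun a b ha hb => hmul a b ha hb) hc
  · rintro _ (⟨b, rfl⟩ | ⟨g, hg, rfl⟩)
    · exact hι b
    · exact hz g hg
  · intro r
    rw [← AlgHom.commutes E.ι.toAlgHom]
    exact hι _

theorem sgn_mem_sub {N : Set E.G} {c : E.F} (hc : c ∈ E.sub N) : E.F.sgn c ∈ E.sub N := by
  refine sub_induction (p := fun c => E.F.sgn c ∈ E.sub N) ?_ ?_ ?_ ?_ hc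
  · intro b
    rw [← E.ι.map_sgn]
    exact ι_mem_sub N _
  · intro g hg
    rw [E.F.sgn_of_mem (E.z_mem g)]
    exact Subalgebra.smul_mem _ (z_mem_sub hg) _
  · intro a b _ _ ha hb
    rw [map_add]
    exact add_mem ha hb
  · intro a b _ _ ha hb
    rw [sgn_mul]
    exact mul_mem ha hb

theorem comp_mem_sub {N : Set E.G} (n : ℕ) {c : E.F} (hc : c ∈ E.sub N) :
    E.F.comp n c ∈ E.sub N := by
  set W : Set E.F := {c | c ∈ E.sub N ∧ ∃ n, c ∈ E.F.gr n} with hW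
  have hmul : Submodule.span ℚ W * Submodule.span ℚ W ≤ Submodule.span ℚ W := by
    rw [Submodule.span_mul_span, Submodule.span_le]
    rintro _ ⟨a, ⟨ha, i, hi⟩, b, ⟨hb, j, hj⟩, rfl⟩
    exact Submodule.subset_span ⟨mul_mem ha hb, i + j, SetLike.GradedMul.mul_mem hi hj⟩
  have hcW : c ∈ Submodule.span ℚ W := by
    refine sub_induction (p := fun c => c ∈ Submodule.span ℚ W) ?_ ?_ ?_ ?_ hc
    · intro b
      induction b using B.hom_induction with
      | h0 => rw [map_zero]; exact zero_mem _
      | hh i b hb => exact Submodule.subset_span ⟨ι_mem_sub N b, i, E.ι.map_gr hb⟩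
      | hadd a b ha hb => rw [map_add]; exact add_mem ha hb
    · intro g hg
      exact Submodule.subset_span ⟨z_mem_sub hg, _, E.z_mem g⟩
    · intro a b _ _ ha hb
      exact add_mem ha hb
    · intro a b _ _ ha hb
      exact hmul (Submodule.mul_mem_mul ha hb)
  refine Submodule.span_induction (p := fun c _ => E.F.comp n c ∈ E.sub N) ?_ ?_ ?_ ?_ hcW
  · rintro c ⟨hc, m, hm⟩
    by_cases hmn : m = n
    · subst hmn
      rwa [comp_same hm]
    · rw [comp_of_ne hm hmn]
      exact zero_mem _
  · rw [map_zero]; exact zero_mem _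
  · intro a b _ _ ha hb; rw [map_add]; exact add_mem ha hb
  · intro r a _ ha; rw [map_smul]; exact Subalgebra.smul_mem _ ha r

variable (E) in
/-- A set of generators is closed if the differentials of its members are cocycles in the algebra
which the set generates, and are compatible with `ξ`. -/
structure IsClosed (N : Set E.G) : Prop where
  mem : ∀ g ∈ N, E.D (E.z g) ∈ E.sub N
  D_D : ∀ g ∈ N, E.D (E.D (E.z g)) = 0
  ξ_D : ∀ g ∈ N, E.ξ (E.D (E.z g)) = P.d (E.ξ (E.z g))

variable {N : Set E.G} (hN : E.IsClosed N)
include hN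

theorem IsClosed.D_mem {c : E.F} (hc : c ∈ E.sub N) : E.D c ∈ E.sub N := by
  refine sub_induction (p := fun c => E.D c ∈ E.sub N) ?_ hN.mem ?_ ?_ hc
  · intro b
    rw [E.D_ι]
    exact ι_mem_sub N _
  · intro a b _ _ ha hb
    rw [map_add]
    exact add_mem ha hb
  · intro a b ha hb hDa hDb
    rw [E.D_mul]
    exact add_mem (mul_mem hDa hb) (mul_mem (sgn_mem_sub ha) hDb)

theorem IsClosed.D_D_eq_zero {c : E.F} (hc : c ∈ E.sub N) : E.D (E.D c) = 0 := by
  refine sub_induction (p := fun c => E.D (E.D c) = 0) ?_ hN.D_D ?_ ?_ hc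
  · intro b
    rw [E.D_ι, E.D_ι, B.d_d, map_zero]
  · intro a b _ _ ha hb
    rw [map_add, map_add, ha, hb, add_zero]
  · intro a b _ _ ha hb
    rw [E.D_mul, map_add, E.D_mul, E.D_mul, ha, hb, E.D_sgn]
    simp

theorem IsClosed.ξ_D_eq {c : E.F} (hc : c ∈ E.sub N) : E.ξ (E.D c) = P.d (E.ξ c) := by
  refine sub_induction (p := fun c => E.ξ (E.D c) = P.d (E.ξ c)) ?_ hN.ξ_D ?_ ?_ hc
  · intro b
    rw [E.D_ι, E.ξ_ι, E.ξ_ι, f.map_d]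
  · intro a b _ _ ha hb
    rw [map_add, map_add, ha, hb, map_add, map_add]
  · intro a b _ _ ha hb
    rw [E.D_mul, map_add, map_mul, map_mul, map_mul, P.d_mul, ha, hb, E.ξ_sgn]

/-- The homogeneous subalgebra generated by a closed set of generators. -/
def IsClosed.diffSub : DiffSubalgebra E.F where
  carrier := E.sub N
  D := E.D
  D_gr := E.D_gr
  leibniz := E.leibniz
  comp_mem n _ hc := comp_mem_sub n hc
  D_mem _ hc := hN.D_mem hc
  D_D _ hc := hN.D_D_eq_zero hc

/-- The cdga generated by `B` and a closed set of generators. -/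
noncomputable def IsClosed.cdga : CDGA.{u} := hN.diffSub.toCDGA

/-- The inclusion of `B`. -/
noncomputable def IsClosed.incl : Hom B hN.cdga where
  toAlgHom := E.ι.toAlgHom.codRestrict (E.sub N) (ι_mem_sub N)
  map_gr hb := E.ι.map_gr hb
  map_d b := Subtype.ext (E.D_ι b).symm

/-- The restriction of `ξ`. -/
noncomputable def IsClosed.proj : Hom hN.cdga P where
  toAlgHom := E.ξ.comp (E.sub N).val
  map_gr hc := E.ξ_gr _ _ hc
  map_d c := hN.ξ_D_eq c.2

/-- The degree of a generator serves as its level in the Sullivan condition. -/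
theorem IsClosed.isRelativeSullivan
    (hdeg : ∀ g ∈ N, E.D (E.z g) ∈ E.sub {g' ∈ N | E.deg g' < E.deg g}) :
    IsRelativeSullivan hN.incl := by
  let val : hN.cdga →ₐ[ℚ] E.F := (E.sub N).val
  have hval : Function.Injective val := Subtype.val_injective
  have hgr : ∀ i c, val c ∈ E.F.gr i → c ∈ hN.cdga.gr i := fun _ _ hc => hc
  have hsub : ∀ c ∈ E.sub N, ∃ c', val c' = c := fun c hc => ⟨⟨c, hc⟩, rfl⟩
  have hmem : ∀ c, val c ∈ E.sub N := fun c => c.2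
  have hvald : ∀ c, val (hN.cdga.d c) = E.D (val c) := fun _ => rfl
  have hincl : ∀ b, val (hN.incl.toAlgHom b) = E.ι.toAlgHom b := fun _ => rfl
  obtain ⟨ζ, hζ⟩ : ∃ ζ : N → hN.cdga, ∀ k, val (ζ k) = E.z k.1 :=
    ⟨_, fun k => (hsub _ (z_mem_sub k.2)).choose_spec⟩
  have hz : ∀ k, ζ k ∈ hN.cdga.gr (E.deg k.1) := fun k => hgr _ _ (by rw [hζ]; exact E.z_mem k.1)
  refine ⟨N, fun k => E.deg k.1, ζ, hz, fun k => E.deg k.1,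
    fun k => le_trans one_le_two (E.two_le k.1), ?_, fun k => ?_⟩
  · let φ := E.F.freeLift (fun k : N => E.deg k.1) (fun k => E.z k.1) (fun k => E.z_mem k.1)
    let M := TensorProduct.lift
      ((LinearMap.mul ℚ E.F).compl₁₂ E.ι.toAlgHom.toLinearMap φ.toLinearMap)
    have hM : ∀ b w, M (b ⊗ₜ w) = E.ι.toAlgHom b * φ w := fun b w => rfl
    have hφ : ∀ w, φ w = val (hN.cdga.freeLift (fun k : N => E.deg k.1)
        ζ hz w) := by
      have : φ = val.comp (hN.cdga.freeLift (fun k : N => E.deg k.1)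
          ζ hz) := free_hom_ext fun k => by
        rw [AlgHom.comp_apply, freeLift_gen, freeLift_gen, hζ]
      exact AlgHom.congr_fun this
    have key : ∀ t, val (TensorProduct.lift ((LinearMap.mul ℚ hN.cdga).compl₁₂
        hN.incl.toAlgHom.toLinearMap (hN.cdga.freeLift (fun k : N => E.deg k.1)
          ζ hz).toLinearMap) t) = M t := by
      intro t
      induction t using TensorProduct.induction_on with
      | zero => rw [map_zero, map_zero, map_zero]
      | tmul b w =>
        rw [hM, hφ, ← hincl]
        exact map_mul val _ _
      | add s t hs ht => rw [map_add, map_add, map_add, hs, ht]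
    -- The image of `M` is stable under left multiplication by the generators of the subalgebra.
    have hι : ∀ b t, ∃ t', M t' = E.ι.toAlgHom b * M t := by
      intro b t
      induction t using TensorProduct.induction_on with
      | zero => exact ⟨0, by rw [map_zero, mul_zero]⟩
      | tmul b' w => exact ⟨(b * b') ⊗ₜ w, by rw [hM, hM, map_mul, mul_assoc]⟩
      | add s t hs ht =>
        obtain ⟨s', hs⟩ := hs
        obtain ⟨t', ht⟩ := ht
        exact ⟨s' + t', by rw [map_add, map_add, hs, ht, mul_add]⟩
    have hzM : ∀ (k : N) t, ∃ t', M t' = E.z k.1 * M t := by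
      intro k t
      induction t using TensorProduct.induction_on with
      | zero => exact ⟨0, by rw [map_zero, mul_zero]⟩
      | tmul b w =>
        induction b using B.hom_induction with
        | h0 => exact ⟨0, by rw [TensorProduct.zero_tmul, map_zero, mul_zero]⟩
        | hh i b hb =>
          refine ⟨((-1 : ℚ) ^ (E.deg k.1 * i)) • (b ⊗ₜ (gen (fun k : N => E.deg k.1) k * w)), ?_⟩
          rw [map_smul, hM, hM, map_mul, ← mul_assoc, ← mul_assoc,
            E.F.mul_comm' (E.z_mem k.1) (E.ι.map_gr hb), smul_mul_assoc, E.F.freeLift_gen]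
        | hadd a b ha hb =>
          obtain ⟨s', hs⟩ := ha
          obtain ⟨t', ht⟩ := hb
          exact ⟨s' + t', by rw [map_add, TensorProduct.add_tmul, map_add, hs, ht, mul_add]⟩
      | add s t hs ht =>
        obtain ⟨s', hs⟩ := hs
        obtain ⟨t', ht⟩ := ht
        exact ⟨s' + t', by rw [map_add, map_add, hs, ht, mul_add]⟩
    refine ⟨fun s t hst => E.injective N (fun k => E.z_mem k.1) ?_, fun c => ?_⟩
    · exact (key s).symm.trans ((congrArg val hst).trans (key t))
    · have hc : ∀ c ∈ E.sub N, ∀ t, ∃ t', M t' = c * M t := by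
        intro c hc
        refine sub_induction (p := fun c => ∀ t, ∃ t', M t' = c * M t) hι
          (fun g hg => hzM ⟨g, hg⟩) ?_ ?_ hc
        · intro a b _ _ ha hb t
          obtain ⟨s', hs⟩ := ha t
          obtain ⟨t', ht⟩ := hb t
          exact ⟨s' + t', by rw [map_add, hs, ht, add_mul]⟩
        · intro a b _ _ ha hb t
          obtain ⟨t', ht⟩ := hb t
          obtain ⟨s', hs⟩ := ha t'
          exact ⟨s', by rw [hs, ht, mul_assoc]⟩
      obtain ⟨t, ht⟩ := hc _ (hmem c) (1 ⊗ₜ 1)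
      rw [hM, map_one, map_one, mul_one, mul_one] at ht
      exact ⟨t, hval ((key t).trans ht)⟩
  · have hmap : (Algebra.adjoin ℚ (Set.range hN.incl.toAlgHom ∪
        ζ '' {l | E.deg l.1 < E.deg k.1})).map val =
        E.sub {g' ∈ N | E.deg g' < E.deg k.1} := by
      rw [AlgHom.map_adjoin, SaturatedExtension.sub, Set.image_union, ← Set.range_comp,
        Set.image_image]
      congr 2
      ext c
      constructor
      · rintro ⟨l, hl, rfl⟩
        exact ⟨l.1, ⟨l.2, hl⟩, (hζ l).symm⟩
      · rintro ⟨g, ⟨hg, hl⟩, rfl⟩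
        exact ⟨⟨g, hg⟩, hl, hζ _⟩
    have hk := hdeg k.1 k.2
    rw [← hmap, ← hζ, ← hvald] at hk
    obtain ⟨c, hc, hck⟩ := hk
    rw [← hval hck]
    exact hc

end SaturatedExtension

end CDGA

namespace CDGA

/-! ### Existence of relative Sullivan models -/

section Filtration

/-- The elements all of whose components have degree at least `n`. -/
def filt (F : CDGA.{u}) (n : ℕ) : Submodule ℚ F :=
  Submodule.span ℚ {c | ∃ m, n ≤ m ∧ c ∈ F.gr m}

variable {F : CDGA.{u}}

theorem mem_filt {n m : ℕ} (h : n ≤ m) {c : F} (hc : c ∈ F.gr m) : c ∈ F.filt n :=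
  Submodule.subset_span ⟨m, h, hc⟩

theorem filt_anti {n m : ℕ} (h : n ≤ m) : F.filt m ≤ F.filt n :=
  Submodule.span_mono fun _ ⟨k, hk, hc⟩ => ⟨k, h.trans hk, hc⟩

theorem mem_filt_zero (c : F) : c ∈ F.filt 0 := by
  induction c using F.hom_induction with
  | h0 => exact zero_mem _
  | hh i c hc => exact mem_filt (Nat.zero_le i) hc
  | hadd a b ha hb => exact add_mem ha hb

theorem mul_mem_filt {i j : ℕ} {a b : F} (ha : a ∈ F.filt i) (hb : b ∈ F.filt j) :
    a * b ∈ F.filt (i + j) := by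
  have h : F.filt i * F.filt j ≤ F.filt (i + j) := by
    rw [filt, filt, Submodule.span_mul_span, Submodule.span_le]
    rintro _ ⟨a, ⟨m, hm, ha⟩, b, ⟨n, hn, hb⟩, rfl⟩
    exact mem_filt (add_le_add hm hn) (SetLike.GradedMul.mul_mem ha hb)
  exact h (Submodule.mul_mem_mul ha hb)

theorem comp_eq_zero_of_mem_filt {m n : ℕ} (h : m < n) {c : F} (hc : c ∈ F.filt n) :
    F.comp m c = 0 := by
  refine Submodule.span_induction (p := fun c _ => F.comp m c = 0) ?_ ?_ ?_ ?_ hc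
  · rintro c ⟨k, hk, hc⟩
    exact comp_of_ne hc (by omega)
  · rw [map_zero]
  · intro a b _ _ ha hb; rw [map_add, ha, hb, add_zero]
  · intro r a _ ha; rw [map_smul, ha, smul_zero]

theorem IsOneConnected.exists_sub_mem_filt (h : F.IsOneConnected) (c : F) :
    ∃ r : ℚ, c - algebraMap ℚ F r ∈ F.filt 2 := by
  induction c using F.hom_induction with
  | h0 => exact ⟨0, by rw [map_zero, sub_zero]; exact zero_mem _⟩
  | hh i c hc =>
    match i, hc with
    | 0, hc =>
      obtain ⟨r, rfl⟩ := h.zero c hc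
      exact ⟨r, by rw [sub_self]; exact zero_mem _⟩
    | 1, hc =>
      rw [h.one c hc]
      exact ⟨0, by rw [map_zero, sub_zero]; exact zero_mem _⟩
    | i + 2, hc => exact ⟨0, by rw [map_zero, sub_zero]; exact mem_filt (Nat.le_add_left 2 i) hc⟩
  | hadd a b ha hb =>
    obtain ⟨r, hr⟩ := ha
    obtain ⟨s, hs⟩ := hb
    exact ⟨r + s, by rw [map_add, add_sub_add_comm]; exact add_mem hr hs⟩

end Filtration

namespace SaturatedExtension
variable {B P : CDGA.{u}} {f : Hom B P} (E : SaturatedExtension f)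

/-- `X` consists of generators of degree `k` which bijectively represent a basis of the relative
cohomology, in degree `k`, of the map `ξ` restricted to the subalgebra generated by `N`. -/
structure IsSelection (N : Set E.G) (k : ℕ) (X : Set E.G) : Prop where
  deg_eq : ∀ g ∈ X, E.deg g = k
  mem : ∀ g ∈ X, E.D (E.z g) ∈ E.sub N
  D_D : ∀ g ∈ X, E.D (E.D (E.z g)) = 0
  ξ_D : ∀ g ∈ X, E.ξ (E.D (E.z g)) = P.d (E.ξ (E.z g))
  spans : ∀ c ∈ E.sub N, c ∈ E.F.gr (k + 1) → ∀ q ∈ P.gr k, E.D c = 0 → E.ξ c = P.d q →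
    ∃ v ∈ Submodule.span ℚ (E.z '' X), ∃ c' ∈ E.sub N, ∃ p,
      c = E.D (v + c') ∧ q = E.ξ (v + c') + P.d p
  independent : ∀ v ∈ Submodule.span ℚ (E.z '' X), ∀ c' ∈ E.sub N, c' ∈ E.F.gr k → ∀ p,
    E.D v = E.D c' → E.ξ v = E.ξ c' + P.d p → v = 0

theorem exists_selection (N : Set E.G) {k : ℕ} (hk : 2 ≤ k) : ∃ X, E.IsSelection N k X := by
  -- `Z` and `b` are relative cocycles and coboundaries. A basis of a complement of `Z ⊓ b` in `Z`
  -- is lifted to generators along `e`.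
  let e : E.F →ₗ[ℚ] E.F × P := E.D.prod E.ξ.toLinearMap
  let Z : Submodule ℚ (E.F × P) :=
    (Subalgebra.toSubmodule (E.sub N) ⊓ E.F.gr (k + 1) ⊓ LinearMap.ker E.D).prod (P.gr k) ⊓
      LinearMap.ker (E.ξ.toLinearMap ∘ₗ LinearMap.fst ℚ E.F P - P.d ∘ₗ LinearMap.snd ℚ E.F P)
  let b : Submodule ℚ (E.F × P) := (Subalgebra.toSubmodule (E.sub N) ⊓ E.F.gr k).map e ⊔
    (LinearMap.range P.d).map (LinearMap.inr ℚ E.F P)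
  obtain ⟨C, hC⟩ := Submodule.exists_isCompl (Z ⊓ b)
  let L := Z ⊓ C
  have hLZ : L ⊔ (Z ⊓ b) = Z := by
    change Z ⊓ C ⊔ (Z ⊓ b) = Z
    rw [sup_comm, inf_comm Z C, ← sup_inf_assoc_of_le C (inf_le_left : Z ⊓ b ≤ Z), hC.sup_eq_top,
      top_inf_eq]
  obtain ⟨s, hsL, hspan, hli⟩ := exists_linearIndependent ℚ (L : Set (E.F × P))
  rw [Submodule.span_eq] at hspan
  have hZ : ∀ w ∈ s, w ∈ Z := fun w hw => (hsL hw).1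
  have hg : ∀ w : s, ∃ g, E.deg g = k ∧ E.D (E.z g) = w.1.1 ∧ E.ξ (E.z g) = w.1.2 := fun w =>
    E.exists_gen k hk _ (hZ w.1 w.2).1.1.1.2 _ (hZ w.1 w.2).1.2
  choose g hdeg hD hξ using hg
  have he : ∀ w : s, e (E.z (g w)) = w := fun w => Prod.ext (hD w) (hξ w)
  have hrange : E.z '' Set.range g = Set.range fun w => E.z (g w) := (Set.range_comp _ _).symm
  have hmap : (Submodule.span ℚ (E.z '' Set.range g)).map e = L := by
    rw [hrange, Submodule.map_span, ← Set.range_comp, ← hspan]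
    congr 1
    ext w
    constructor
    · rintro ⟨w, rfl⟩
      rw [Function.comp_apply, he]
      exact w.2
    · exact fun hw => ⟨⟨w, hw⟩, he ⟨w, hw⟩⟩
  have hdisj : Disjoint (Submodule.span ℚ (E.z '' Set.range g)) (LinearMap.ker e) := by
    rw [hrange]
    refine Submodule.range_ker_disjoint ?_
    have : (e ∘ fun w => E.z (g w)) = ((↑) : s → E.F × P) := funext he
    rw [this]
    exact hli
  refine ⟨Set.range g, ⟨?_, ?_, ?_, ?_, ?_, ?_⟩⟩
  · rintro _ ⟨w, rfl⟩
    exact hdeg w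
  · rintro _ ⟨w, rfl⟩
    rw [hD]
    exact (hZ w.1 w.2).1.1.1.1
  · rintro _ ⟨w, rfl⟩
    rw [hD]
    exact (hZ w.1 w.2).1.1.2
  · rintro _ ⟨w, rfl⟩
    rw [hD, hξ]
    exact sub_eq_zero.mp (hZ w.1 w.2).2
  · intro c hc hck q hq hDc hξc
    have hcq : (c, q) ∈ Z := ⟨⟨⟨⟨hc, hck⟩, hDc⟩, hq⟩, sub_eq_zero.mpr hξc⟩
    rw [← hLZ, ← hmap] at hcq
    obtain ⟨_, ⟨v, hv, rfl⟩, w, ⟨-, hw⟩, hvw⟩ := Submodule.mem_sup.mp hcq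
    obtain ⟨_, ⟨c', ⟨hc', -⟩, rfl⟩, _, ⟨_, ⟨p, rfl⟩, rfl⟩, rfl⟩ := Submodule.mem_sup.mp hw
    refine ⟨v, hv, c', hc', p, ?_, ?_⟩
    · have := congrArg Prod.fst hvw
      simp only [Prod.fst_add, LinearMap.inr_apply, add_zero] at this
      rw [map_add]
      exact this.symm
    · have := congrArg Prod.snd hvw
      simp only [Prod.snd_add, LinearMap.inr_apply] at this
      rw [map_add, add_assoc]
      exact this.symm
  · intro v hv c' hc' hck p hDv hξv
    have hvL : e v ∈ L := hmap ▸ Submodule.mem_map_of_mem hv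
    have hvb : e v ∈ b := Submodule.mem_sup.mpr ⟨e c',
      Submodule.mem_map_of_mem ⟨hc', hck⟩, (0, P.d p),
      ⟨P.d p, ⟨p, rfl⟩, rfl⟩, Prod.ext ((add_zero _).trans hDv.symm) hξv.symm⟩
    have h0 : e v = 0 := by
      have := hC.disjoint.le_bot ⟨⟨hvL.1, hvb⟩, hvL.2⟩
      exact this
    exact (Submodule.mem_bot ℚ).mp (hdisj.le_bot ⟨hv, h0⟩)

open Classical in
/-- The generators which are added in degree `k` to those in `N`. -/
noncomputable def pick (N : Set E.G) (k : ℕ) : Set E.G :=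
  if hk : 2 ≤ k then (E.exists_selection N hk).choose else ∅

theorem pick_of_lt (N : Set E.G) {k : ℕ} (hk : k < 2) : E.pick N k = ∅ := dif_neg (by omega)

theorem pick_isSelection (N : Set E.G) {k : ℕ} (hk : 2 ≤ k) : E.IsSelection N k (E.pick N k) := by
  rw [pick, dif_pos hk]
  exact (E.exists_selection N hk).choose_spec

/-- The selected generators of degree less than `k`. -/
noncomputable def stage : ℕ → Set E.G
  | 0 => ∅
  | k + 1 => stage k ∪ E.pick (stage k) k

/-- All selected generators. -/
noncomputable def total : Set E.G := ⋃ k, E.stage k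

theorem stage_mono : Monotone E.stage := monotone_nat_of_le_succ fun _ => Set.subset_union_left

theorem stage_subset_total (k : ℕ) : E.stage k ⊆ E.total := Set.subset_iUnion _ k

variable {E}

theorem two_le_of_mem_pick {N : Set E.G} {k : ℕ} {g : E.G} (hg : g ∈ E.pick N k) : 2 ≤ k := by
  by_contra h
  rw [E.pick_of_lt N (by omega)] at hg
  exact hg

theorem deg_lt_of_mem_stage {k : ℕ} {g : E.G} (hg : g ∈ E.stage k) : E.deg g < k := by
  induction k with
  | zero => exact hg.elim
  | succ k ih =>
    rcases hg with hg | hg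
    · exact (ih hg).trans (Nat.lt_succ_self k)
    · rw [(E.pick_isSelection _ (two_le_of_mem_pick hg)).deg_eq g hg]
      exact Nat.lt_succ_self k

theorem mem_pick_of_mem_total {g : E.G} (hg : g ∈ E.total) :
    g ∈ E.pick (E.stage (E.deg g)) (E.deg g) := by
  obtain ⟨k, hk⟩ := Set.mem_iUnion.mp hg
  induction k with
  | zero => exact hk.elim
  | succ k ih =>
    rcases hk with hk | hk
    · exact ih hk
    · rwa [(E.pick_isSelection _ (two_le_of_mem_pick hk)).deg_eq g hk]

theorem selection_of_mem_total (g : E.G) :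
    E.IsSelection (E.stage (E.deg g)) (E.deg g) (E.pick (E.stage (E.deg g)) (E.deg g)) :=
  E.pick_isSelection _ (E.two_le g)

variable (E) in
theorem total_isClosed : E.IsClosed E.total where
  mem _ hg := sub_mono (E.stage_subset_total _)
    ((selection_of_mem_total _).mem _ (mem_pick_of_mem_total hg))
  D_D _ hg := (selection_of_mem_total _).D_D _ (mem_pick_of_mem_total hg)
  ξ_D _ hg := (selection_of_mem_total _).ξ_D _ (mem_pick_of_mem_total hg)

variable (E) in
theorem total_isRelativeSullivan : IsRelativeSullivan E.total_isClosed.incl := by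
  refine E.total_isClosed.isRelativeSullivan fun g hg => ?_
  refine sub_mono ?_ ((selection_of_mem_total _).mem _ (mem_pick_of_mem_total hg))
  exact fun g' hg' => ⟨E.stage_subset_total _ hg', deg_lt_of_mem_stage hg'⟩

theorem exists_stage {c : E.F} (hc : c ∈ E.sub E.total) : ∃ k, c ∈ E.sub (E.stage k) := by
  have mono : ∀ {k l : ℕ}, k ≤ l → E.sub (E.stage k) ≤ E.sub (E.stage l) :=
    fun h => sub_mono (E.stage_mono h)
  refine sub_induction (p := fun c => ∃ k, c ∈ E.sub (E.stage k)) ?_ ?_ ?_ ?_ hc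
  · exact fun b => ⟨0, ι_mem_sub _ b⟩
  · intro g hg
    obtain ⟨k, hk⟩ := Set.mem_iUnion.mp hg
    exact ⟨k, z_mem_sub hk⟩
  · rintro a b - - ⟨k, ha⟩ ⟨l, hb⟩
    exact ⟨max k l, add_mem (mono (le_max_left k l) ha) (mono (le_max_right k l) hb)⟩
  · rintro a b - - ⟨k, ha⟩ ⟨l, hb⟩
    exact ⟨max k l, mul_mem (mono (le_max_left k l) ha) (mono (le_max_right k l) hb)⟩

variable (E) in
/-- The span of the generators selected in degree `k`. -/
noncomputable def layer (k : ℕ) : Submodule ℚ E.F :=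
  Submodule.span ℚ (E.z '' E.pick (E.stage k) k)

theorem layer_le_gr (k : ℕ) : E.layer k ≤ E.F.gr k := by
  rw [layer, Submodule.span_le]
  rintro _ ⟨g, hg, rfl⟩
  have := E.z_mem g
  rwa [(E.pick_isSelection _ (two_le_of_mem_pick hg)).deg_eq g hg] at this

theorem layer_le_sub (k : ℕ) : E.layer k ≤ Subalgebra.toSubmodule (E.sub (E.stage (k + 1))) := by
  rw [layer, Submodule.span_le]
  rintro _ ⟨g, hg, rfl⟩
  exact z_mem_sub (Or.inr hg)

/-- Up to elements of degree at least `k + 2`, the generators of degree `k` enter the algebra which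
they generate only linearly: all elements of positive degree have degree at least `2`. -/
theorem exists_linear_part {k : ℕ} (hk : 2 ≤ k) {c : E.F} (hc : c ∈ E.sub (E.stage (k + 1))) :
    ∃ a ∈ E.sub (E.stage k), ∃ v ∈ E.layer k, c - a - v ∈ E.F.filt (k + 2) := by
  refine sub_induction (p := fun c => ∃ a ∈ E.sub (E.stage k), ∃ v ∈ E.layer k,
    c - a - v ∈ E.F.filt (k + 2)) ?_ ?_ ?_ ?_ hc
  · intro b
    exact ⟨_, ι_mem_sub _ b, 0, zero_mem _, by rw [sub_self, sub_zero]; exact zero_mem _⟩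
  · rintro g (hg | hg)
    · exact ⟨_, z_mem_sub hg, 0, zero_mem _, by rw [sub_self, sub_zero]; exact zero_mem _⟩
    · exact ⟨0, zero_mem _, _, Submodule.subset_span ⟨g, hg, rfl⟩,
        by rw [sub_zero, sub_self]; exact zero_mem _⟩
  · rintro c c' - - ⟨a, ha, v, hv, h⟩ ⟨a', ha', v', hv', h'⟩
    refine ⟨a + a', add_mem ha ha', v + v', add_mem hv hv', ?_⟩
    have : c + c' - (a + a') - (v + v') = (c - a - v) + (c' - a' - v') := by abel
    rw [this]
    exact add_mem h h'
  · rintro c c' - - ⟨a, ha, v, hv, h⟩ ⟨a', ha', v', hv', h'⟩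
    obtain ⟨r, hr⟩ := E.conn.exists_sub_mem_filt a
    obtain ⟨r', hr'⟩ := E.conn.exists_sub_mem_filt a'
    refine ⟨a * a', mul_mem ha ha', r • v' + r' • v,
      add_mem (Submodule.smul_mem _ _ hv') (Submodule.smul_mem _ _ hv), ?_⟩
    have hvf : v ∈ E.F.filt k := mem_filt le_rfl (layer_le_gr k hv)
    have hvf' : v' ∈ E.F.filt k := mem_filt le_rfl (layer_le_gr k hv')
    have e : c * c' - a * a' - (r • v' + r' • v) =
        (a - algebraMap ℚ E.F r) * v' + v * (a' - algebraMap ℚ E.F r') + v * v' +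
          ((c - a - v) * c' + (a + v) * (c' - a' - v')) := by
      rw [sub_mul, mul_sub, ← Algebra.smul_def, ← Algebra.commutes, ← Algebra.smul_def]
      noncomm_ring
    rw [e]
    refine add_mem (add_mem (add_mem ?_ ?_) ?_) (add_mem ?_ ?_)
    · have := mul_mem_filt hr hvf'
      rwa [add_comm] at this
    · exact mul_mem_filt hvf hr'
    · exact filt_anti (by omega) (mul_mem_filt hvf hvf')
    · have := mul_mem_filt h (mem_filt_zero c')
      rwa [add_zero] at this
    · have := mul_mem_filt (mem_filt_zero (a + v)) h'
      rwa [zero_add] at this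

/-- Elements of degree `k + 1` of the algebra generated by all selected generators involve only
generators of degree at most `k + 1`. -/
theorem mem_stage_of_mem_gr {k : ℕ} {c : E.F} (hc : c ∈ E.sub E.total) (hck : c ∈ E.F.gr (k + 1)) :
    c ∈ E.sub (E.stage (k + 2)) := by
  obtain ⟨m, hm⟩ := exists_stage hc
  induction m with
  | zero => exact sub_mono (E.stage_mono (Nat.zero_le _)) hm
  | succ m ih =>
    by_cases hmk : m + 1 ≤ k + 2
    · exact sub_mono (E.stage_mono hmk) hm
    · obtain ⟨a, ha, v, hv, h⟩ := exists_linear_part (by omega) hm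
      have h0 := comp_eq_zero_of_mem_filt (m := k + 1) (by omega) h
      rw [map_sub, map_sub, comp_same hck, comp_of_ne (layer_le_gr m hv) (by omega), sub_zero,
        sub_eq_zero] at h0
      exact ih (h0 ▸ comp_mem_sub _ ha)

theorem stage_two : E.stage 2 = ∅ := by
  simp only [stage, E.pick_of_lt _ zero_lt_two, E.pick_of_lt _ one_lt_two, Set.union_empty]

/-- A cocycle of degree `k + 1` whose image is a coboundary was already present before generators of
degree `k + 1` were added, by their independence, and before generators of degree `k` were
added, for reasons of degree. So it became a coboundary when the latter were added. -/
theorem exists_D_eq (hf : Function.Injective f.toAlgHom) (hP : P.IsOneConnected) {k : ℕ} {c : E.F}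
    (hc : c ∈ E.sub E.total) (hck : c ∈ E.F.gr (k + 1)) {p : P} (hp : p ∈ P.gr k)
    (hD : E.D c = 0) (hξ : E.ξ c = P.d p) : ∃ c' ∈ E.sub E.total, c = E.D c' := by
  rcases Nat.eq_zero_or_pos k with rfl | hk
  · rw [E.conn.one c hck]
    exact ⟨0, zero_mem _, (map_zero _).symm⟩
  obtain ⟨a, ha, v, hv, h⟩ := exists_linear_part (by omega) (mem_stage_of_mem_gr hc hck)
  have h0 := comp_eq_zero_of_mem_filt (m := k + 1) (by omega) h
  rw [map_sub, map_sub, comp_same hck, comp_same (layer_le_gr _ hv), sub_sub, sub_eq_zero] at h0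
  have ha' := comp_mem_sub (k + 1) ha
  -- The differential of `v` is that of `-a`, so `v` vanishes by independence.
  have hv0 : v = 0 := by
    refine (E.pick_isSelection _ (by omega)).independent v hv (-E.F.comp (k + 1) a) (neg_mem ha')
      (neg_mem (comp_mem _ _ _)) p ?_ ?_
    · rw [h0, map_add] at hD
      rw [map_neg]
      exact eq_neg_of_add_eq_zero_right hD
    · rw [h0, map_add] at hξ
      rw [map_neg, ← hξ]
      abel
  have hck' : c ∈ E.sub (E.stage (k + 1)) := by
    rw [h0, hv0, add_zero]
    exact ha'
  rcases Nat.lt_or_ge k 2 with hk2 | hk2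
  · obtain rfl : k = 1 := by omega
    rw [stage_two] at hck'
    obtain ⟨b, rfl⟩ := sub_empty hck'
    rw [hP.one p hp, map_zero, E.ξ_ι] at hξ
    rw [hf (hξ.trans (map_zero _).symm), map_zero]
    exact ⟨0, zero_mem _, (map_zero _).symm⟩
  · obtain ⟨a₁, ha₁, v₁, hv₁, h₁⟩ := exists_linear_part hk2 hck'
    have h0₁ := comp_eq_zero_of_mem_filt (m := k + 1) (by omega) h₁
    rw [map_sub, map_sub, comp_same hck, comp_of_ne (layer_le_gr k hv₁) (by omega), sub_zero,
      sub_eq_zero] at h0₁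
    obtain ⟨v', hv', c', hc', q, h1, -⟩ := (E.pick_isSelection _ hk2).spans c
      (h0₁ ▸ comp_mem_sub _ ha₁) hck p hp hD hξ
    exact ⟨v' + c', add_mem (sub_mono (E.stage_subset_total _) (layer_le_sub k hv'))
      (sub_mono (E.stage_subset_total _) hc'), h1⟩

theorem total_isQuasiIso (hf : Function.Injective f.toAlgHom) (hP : P.IsOneConnected) :
    E.total_isClosed.proj.IsQuasiIso := by
  let C := E.total_isClosed.cdga
  let val : C →ₐ[ℚ] E.F := (E.sub E.total).val
  have hval : Function.Injective val := Subtype.val_injective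
  have hsub : ∀ c ∈ E.sub E.total, ∃ c', val c' = c := fun c hc => ⟨⟨c, hc⟩, rfl⟩
  have hmem : ∀ c, val c ∈ E.sub E.total := fun c => c.2
  have hd : ∀ c, val (C.d c) = E.D (val c) := fun _ => rfl
  have hgr : ∀ i, ∀ c ∈ C.gr i, val c ∈ E.F.gr i := fun _ _ hc => hc
  have hproj : ∀ c, E.total_isClosed.proj.toAlgHom c = E.ξ (val c) := fun _ => rfl
  refine Hom.isQuasiIso_of_homogeneous _ ?_ ?_ ?_
  · intro c hc _ h0
    obtain ⟨r, hr⟩ := E.conn.zero _ (hgr 0 c hc)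
    rw [hproj, hr, ← AlgHom.commutes E.ι.toAlgHom, E.ξ_ι] at h0
    apply hval
    rw [hr, ← AlgHom.commutes E.ι.toAlgHom, hf (h0.trans (map_zero _).symm), map_zero, map_zero]
  · intro k c hc p hp hdc hcp
    obtain ⟨c', hc', h⟩ := exists_D_eq hf hP (hmem c) (hgr _ c hc) hp
      (by rw [← hd, hdc, map_zero]) hcp
    obtain ⟨c', rfl⟩ := hsub c' hc'
    exact ⟨c', hval h⟩
  · intro k q hq hdq
    match k, hq with
    | 0, hq =>
      obtain ⟨r, rfl⟩ := hP.zero q hq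
      refine ⟨algebraMap ℚ C r, 0, hval ?_, ?_⟩
      · rw [hd, AlgHom.commutes, E.D_algebraMap, map_zero]
      · rw [AlgHom.commutes, sub_self, map_zero]
    | 1, hq =>
      rw [hP.one q hq]
      exact ⟨0, 0, map_zero _, by rw [map_zero, map_zero, sub_self]⟩
    | k + 2, hq =>
      obtain ⟨v, hv, c', hc', p, h1, h2⟩ := (E.pick_isSelection (E.stage (k + 2))
        (Nat.le_add_left 2 k)).spans 0 (zero_mem _) (zero_mem _) q hq (map_zero _)
        (by rw [map_zero, hdq])
      obtain ⟨c, hc⟩ := hsub (v + c') (add_mem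
        (sub_mono (E.stage_subset_total _) (layer_le_sub _ hv))
        (sub_mono (E.stage_subset_total _) hc'))
      refine ⟨c, -p, hval ?_, ?_⟩
      · rw [hd, hc, ← h1, map_zero]
      · rw [hproj, hc, map_neg, h2]
        abel

end SaturatedExtension

/-- An injective morphism between simply connected cdgas has a relative Sullivan model. -/
theorem Hom.exists_relativeSullivanModel {B P : CDGA.{u}} (f : Hom B P)
    (hf : Function.Injective f.toAlgHom) (hB : B.IsOneConnected) (hP : P.IsOneConnected) :
    ∃ (C : CDGA.{u}) (i : Hom B C) (ξ : Hom C P), IsRelativeSullivan i ∧ ξ.IsQuasiIso ∧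
      ∀ b, ξ.toAlgHom (i.toAlgHom b) = f.toAlgHom b := by
  obtain ⟨E⟩ := exists_saturatedExtension f hB
  exact ⟨_, _, _, E.total_isRelativeSullivan, E.total_isQuasiIso hf hP, E.ξ_ι⟩

end CDGA

namespace CDGA

/-! ### Homotopy retractions and topological complexity -/

theorem quotient_isOneConnected {T : CDGA.{u}} (hT : T.IsOneConnected) {K : Ideal T}
    [K.IsTwoSided] (hK : T.IsDGIdeal K) : (T.quotient K hK).IsOneConnected where
  zero := by
    rintro _ ⟨t, ht, rfl⟩
    obtain ⟨c, rfl⟩ := hT.zero t ht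
    exact ⟨c, AlgHom.commutes (T.toQuotient K hK).toAlgHom c⟩
  one := by
    rintro _ ⟨t, ht, rfl⟩
    exact (congrArg _ (hT.one t ht)).trans (map_zero _)

/-- The projection `T ⧸ K → T ⧸ I` for `K ≤ I`. -/
noncomputable def factor {T : CDGA.{u}} {K I : Ideal T} [K.IsTwoSided] [I.IsTwoSided]
    (hK : T.IsDGIdeal K) (hI : T.IsDGIdeal I) (h : K ≤ I) :
    Hom (T.quotient K hK) (T.quotient I hI) where
  toAlgHom := Ideal.Quotient.factorₐ ℚ h
  map_gr := by
    rintro i _ ⟨t, ht, rfl⟩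
    exact ⟨t, ht, rfl⟩
  map_d := by
    intro q
    obtain ⟨t, rfl⟩ := Ideal.Quotient.mkₐ_surjective ℚ K q
    rfl

/-- If `K` is contained in an acyclic ideal `I` of `T`, then `T → T ⧸ K` admits a homotopy
retraction: the fibre product of `T` and `T ⧸ K` over `T ⧸ I` is quasi-isomorphic to `T ⧸ K`, and
it retracts to `T`. -/
theorem hasHomotopyRetraction_of_acyclic {T : CDGA.{u}} (hT : T.IsOneConnected) {K I : Ideal T}
    [K.IsTwoSided] [I.IsTwoSided] (hK : T.IsDGIdeal K) (hI : T.IsDGIdeal I) (h : K ≤ I)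
    (hac : ∀ t ∈ I, T.d t = 0 → ∃ s ∈ I, T.d s = t) :
    HasHomotopyRetraction (T.toQuotient K hK) := by
  let g := T.toQuotient I hI
  let k := factor hK hI h
  have hgI : ∀ t, g.toAlgHom t = 0 ↔ t ∈ I := fun t => Ideal.Quotient.eq_zero_iff_mem
  have hgk : ∀ t, k.toAlgHom ((T.toQuotient K hK).toAlgHom t) = g.toAlgHom t := fun _ => rfl
  have hqi : (pullback.snd g k).IsQuasiIso := by
    refine pullback.snd_isQuasiIso (Ideal.Quotient.mkₐ_surjective ℚ I) fun t ht hdt => ?_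
    obtain ⟨s, hs, hst⟩ := hac t ((hgI t).mp ht) hdt
    exact ⟨s, (hgI s).mpr hs, hst⟩
  -- Elements of degree `0` in an acyclic ideal are coboundaries, hence zero.
  have hI0 : ∀ c : ℚ, algebraMap ℚ T c ∈ I → algebraMap ℚ T c = 0 := by
    intro c hc
    have hdc : T.d (algebraMap ℚ T c) = 0 := by
      rw [Algebra.algebraMap_eq_smul_one, map_smul, T.d_one, smul_zero]
    have hc0 : algebraMap ℚ T c ∈ T.gr 0 := by
      rw [Algebra.algebraMap_eq_smul_one]
      exact Submodule.smul_mem _ _ SetLike.GradedOne.one_mem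
    obtain ⟨s, -, hs⟩ := hac _ hc hdc
    rw [← comp_same hc0, ← hs, T.comp_zero_d]
  have hQ := quotient_isOneConnected hT hK
  have hP : (pullback g k).IsOneConnected := by
    constructor
    · intro p hp
      obtain ⟨c, hc⟩ := hT.zero _ ((pullback.fst g k).map_gr hp)
      obtain ⟨c', hc'⟩ := hQ.zero _ ((pullback.snd g k).map_gr hp)
      refine ⟨c, pullback.ext ?_ ?_⟩
      · rw [hc, AlgHom.commutes]
      · have h1 := pullback.condition g k p
        rw [hc, hc', AlgHom.commutes, AlgHom.commutes, ← sub_eq_zero, ← map_sub,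
          ← AlgHom.commutes g.toAlgHom, hgI] at h1
        have h2 := hI0 _ h1
        have h3 : algebraMap ℚ (T.quotient K hK) (c - c') = 0 := by
          rw [← AlgHom.commutes (T.toQuotient K hK).toAlgHom, h2, map_zero]
        rw [map_sub, sub_eq_zero] at h3
        rw [hc', AlgHom.commutes, h3]
    · intro p hp
      refine pullback.ext ?_ ?_
      · rw [hT.one _ ((pullback.fst g k).map_gr hp), map_zero]
      · rw [hQ.one _ ((pullback.snd g k).map_gr hp), map_zero]
  let id : Hom T T := ⟨AlgHom.id ℚ T, fun ht => ht, fun _ => rfl⟩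
  let j : Hom T (pullback g k) := pullback.lift id (T.toQuotient K hK) fun t => (hgk t).symm
  have hj : Function.Injective j.toAlgHom :=
    Function.LeftInverse.injective (g := (pullback.fst g k).toAlgHom) fun _ => rfl
  obtain ⟨C, i, ξ, hi, hξ, hξi⟩ := j.exists_relativeSullivanModel hj hT hP
  refine ⟨C, i, (pullback.snd g k).comp ξ, hi, hqi.comp hξ, fun b => ?_,
    (pullback.fst g k).comp ξ, fun b => ?_⟩
  · exact congrArg (pullback.snd g k).toAlgHom (hξi b)
  · exact congrArg (pullback.fst g k).toAlgHom (hξi b)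

/-- A homotopy retraction of a quotient map detects cohomology classes: cocycles in the ideal are
coboundaries. -/
theorem HasHomotopyRetraction.exists_d_eq {B Q : CDGA.{u}} {ρ : Hom B Q}
    (h : HasHomotopyRetraction ρ) {b : B} (hb : B.d b = 0) (hρ : ρ.toAlgHom b = 0) :
    b ∈ LinearMap.range B.d := by
  obtain ⟨C, i, ξ, -, hξ, hξi, r, hr⟩ := h
  obtain ⟨c, hc⟩ := hξ.exists_d_eq (a := i.toAlgHom b) (b := 0)
    (by rw [← i.map_d, hb, map_zero]) (by rw [hξi, hρ, map_zero])
  exact ⟨r.toAlgHom c, by rw [← r.map_d, ← hc, hr]⟩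

end CDGA

theorem theorem5p3 {A : CDGA.{u}} {n : ℕ} {p q : Fin n → ℕ} {r : ℕ} {x u : Fin n → A} {y : A}
    (h : A.IsEllipticExtension p q r x u y) :
    A.TC = (Module.finrank ℚ (Submodule.span ℚ (Set.range x ∪ Set.range u ∪ {y})) : ℕ∞) ∧
    Module.finrank ℚ (Submodule.span ℚ (Set.range x ∪ Set.range u ∪ {y})) = 2 * n + 1 ∧
    ∃ Ω ∈ A.kerMu ^ (n + 1), ∃ β ∈ A.kerMu ^ n,
      (A.tensor A).d Ω = 0 ∧ (A.tensor A).d β = 0 ∧ Ω * β ∈ A.kerMu ^ (2 * n + 1) ∧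
      Ω * β ∉ LinearMap.range (A.tensor A).d := by
  have hcl := h.exists_classes
  refine ⟨?_, h.finrank_eq, hcl⟩
  obtain ⟨Ω, -, β, -, hdΩ, hdβ, hmem, hne⟩ := hcl
  rw [h.finrank_eq, CDGA.TC]
  apply le_antisymm
  · apply sInf_le
    refine ⟨2 * n + 1, rfl, ?_⟩
    have hA : A.IsOneConnected := h.free.isOneConnected (by
      rintro (i | i | i)
      exacts [h.two_le_x i, h.two_le_u i, h.two_le_y])
    have hI := h.pairs.isDGIdeal Set.univ
    have := hI.twoSided
    refine CDGA.hasHomotopyRetraction_of_acyclic (CDGA.tensor_isOneConnected hA hA)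
      _ hI h.kerMu_pow_le ?_
    intro t ht hdt
    have := h.pairs.acyclic Finset.univ (t := t) (by rwa [Finset.coe_univ]) hdt
    rwa [Finset.coe_univ] at this
  · apply le_sInf
    rintro _ ⟨m, rfl, hm⟩
    rw [Nat.cast_le]
    by_contra hlt
    refine hne (hm.exists_d_eq ?_ ?_)
    · rw [CDGA.d_mul, hdΩ, hdβ, zero_mul, mul_zero, add_zero]
    · exact Ideal.Quotient.eq_zero_iff_mem.mpr (Ideal.pow_le_pow_right (by omega) hmem)
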